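/- **Notation.** Let $n\in\{0,1,2,\dots\}$, let $d>0$, $\Delta_1,\Delta_2$ be real, $\Delta_\pm=\tfrac12(\Delta_1\pm\Delta_2)$, $\Gamma(x\pm\alpha)=\Gamma(x+\alpha)\Gamma(x-\alpha)$, $(x)_n=x(x+1)\cdots(x+n-1)$. $P_n^{(a,b)}$ is the Jacobi polynomial, $\mathcal C_n^{(\lambda)}(x)=\frac{(2\lambda)_n}{(\lambda+1/2)_n}P_n^{(\lambda-1/2,\lambda-1/2)}(x)$ the Gegenbauer polynomial, and $\mathfrak p_n(\alpha;a,b,c,e)=(a+b)_n(a+c)_n(a+e)_n\,{}_4F_3\big({-n,\,a+\alpha,\,a-\alpha,\,n+a+b+c+e-1\atop a+b,\,a+c,\,a+e};1\big)$ the Wilson polynomial (extended polynomially in its parameters). For $0<x<1$ put $$\vartheta^{(p,q)}_\alpha(x)={}_2F_1\Big({\tfrac12(1+p+q)+\alpha,\ \tfrac12(1+p+q)-\alpha\atop 1+p};\tfrac{x-1}{x}\Big),\qquad Q_{p,q}(\alpha)=\frac{2\Gamma(1+p)\Gamma(-2\alpha)}{\Gamma(\frac12(1+p+q)-\alpha)\Gamma(\frac12(1+p-q)-\alpha)},$$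 and $N_{p,q}(\alpha)=\tfrac12Q_{p,q}(\alpha)Q_{p,q}(-\alpha)$, which equals $\tfrac12|Q_{p,q}(\alpha)|^2$ for imaginary $\alpha$. **Three alpha space transforms.** A weight $w$, partial waves $\Psi_\alpha$ and a normalization $N$ define $$\widehat f(\alpha)=\int_0^1 dx\,w(x)f(x)\Psi_\alpha(x),\qquad f(x)=\frac1{2\pi i}\int\frac{d\alpha}{N(\alpha)}\,\widehat f(\alpha)\Psi_\alpha(x).$$ * Crosscap ($x=\eta$): $w=(1-\eta)^{d/2-1}\eta^{-d/2-1}$, $\Psi_\alpha=\eta^{-\Delta_-}\vartheta_\alpha^{(d/2-1,2\Delta_-)}(\eta)$, $N=N_{d/2-1,2\Delta_-}$. * Bulk ($x=\rho$): $w=\rho^{-d/2-1}$, $\Psi_\alpha=\big(\tfrac{1-\rho}{\rho}\big)^{\Delta_-}\vartheta_\alpha^{(2\Delta_-,d/2-1)}(\rho)$, $N=N_{2\Delta_-,d/2-1}$. * Boundary ($x=\rho$): $w=\rho^{d/2-1}(1-\rho)^{-d}$, $\Psi_\nu=\vartheta_\nu^{(d/2-1,d/2-1)}(1-\rho)$,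 $N=N_{d/2-1,d/2-1}$. The inverse transform is a Mellin–Barnes integral: it runs from $-i\infty$ to $i\infty$ along the imaginary axis, deformed if necessary so that the poles of the factors $\Gamma(a_j-\alpha)$ lie to its right and those of the factors $\Gamma(a_j+\alpha)$ to its left, where $\Gamma(a_j\pm\alpha)$, $j=1,2,3$, are the Gamma factors in the numerator of the integrand. (In the exceptional case that a nonzero point is a pole of both families, the mean of the contours passing it on either side is taken; at $\alpha=0$ the integrand is then regular.) **Basis functions in alpha space.** $$\xi_n^{\rm proj}(\alpha)=\Gamma(\tfrac d2)\,\Gamma(\Delta_+-\tfrac d4\pm\alpha)\,\mathfrak p_n\big(\alpha;\tfrac d4+\Delta_-,\tfrac d4-\Delta_-,\Delta_+-\tfrac d4,\tfrac{3d}4-\Delta_+\big),$$ $$\xi_n^{\rm bulk}(\alpha)=\Gamma(1+2\Delta_-)\,\Gamma(\Delta_+-\tfrac d4\pm\alpha)\,\mathfrak p_n\big(\alpha;\Delta_+-\tfrac d4,\tfrac{3d}4-\Delta_+,1-\tfrac d4+\Delta_-,\tfrac d4+\Delta_-\big),$$ $$\xi_n^{\rm bdy}(\nu)=\Gamma(\tfrac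 d2)\,\Gamma(\Delta_1+\tfrac12-\tfrac d2\pm\nu)\,\mathfrak p_n\big(\nu;\tfrac12,\tfrac d2-\tfrac12,\Delta_1+\tfrac12-\tfrac d2,\tfrac12+\tfrac d2-\Delta_2\big).$$ **Statement.** In position space these functions are, for $0<\eta,\rho<1$, $$\xi_n^{\rm proj}(\eta)=\frac{n!\,(\frac d2)_n\,\Gamma(\Delta_1+n)\Gamma(\Delta_2+n)}{(d-1)_n}\,\eta^{\Delta_+}\,\mathcal C_n^{(d/2-1/2)}(1-2\eta),$$ $$\begin{bmatrix}\xi_n^{\rm bulk}(\rho)\\ \xi_n^{\rm bdy}(\rho)\end{bmatrix}=n!\,\Gamma(\Delta_1+n)\Gamma(\Delta_1+1-\tfrac d2+n)\begin{bmatrix}\rho^{\Delta_+}(1-\rho)^{\Delta_-}\\(-1)^n(1-\rho)^{\Delta_1}\end{bmatrix}P_n^{(d/2-1,\,2\Delta_-)}(1-2\rho),$$ where for $d=1$ the first right-hand side is read as its limit $n!\,\Gamma(\Delta_1+n)\Gamma(\Delta_2+n)\,\eta^{\Delta_+}P_n^{(-1/2,-1/2)}(1-2\eta)$ as $d\to1$.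 Precisely: 1. *Inverse transforms.* The inverse transforms of $\xi_n^{\rm proj}(\alpha)$, $\xi_n^{\rm bulk}(\alpha)$, $\xi_n^{\rm bdy}(\nu)$ converge absolutely and equal these three functions, provided that none of the following numbers is in $\{0,-1,-2,\dots\}$: $\Delta_1,\Delta_2$ (crosscap); $\Delta_1$, $\Delta_1+1-\frac d2$, $1+2\Delta_-$ (bulk); $\Delta_1$, $\Delta_1+1-\frac d2$ (boundary). 2. *Transforms.* The transforms of these three functions are $\xi_n^{\rm proj}(\alpha)$, $\xi_n^{\rm bulk}(\alpha)$, $\xi_n^{\rm bdy}(\nu)$, with absolutely convergent integrals, for $|{\rm Re}\,\alpha|<\Delta_+-\frac d4$ (crosscap); $|{\rm Re}\,\alpha|<\Delta_+-\frac d4$ and $2\Delta_->-1$ (bulk); $|{\rm Re}\,\nu|<\Delta_1+\frac12-\frac d2$ (boundary); each time provided that the Gamma functions in the constant of the position-space function are finite. -/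

import Mathlib

open Complex MeasureTheory Filter Topology

noncomputable section

namespace AlphaSpace

/-! ### Classical special functions -/

/-- The Pochhammer symbol `(x)_n = x (x + 1) ⋯ (x + n - 1)`. -/
def poch {K : Type*} [CommRing K] (x : K) (n : ℕ) : K := (ascPochhammer K n).eval x

/-- The Jacobi polynomial
`P_n^{(a,b)}(x) = (a+1)_n / n! * ₂F₁(-n, n+a+b+1; a+1; (1-x)/2)`,
with `(a+1)_n / (a+1)_k` written as `(a+1+k)_{n-k}`, so that it makes sense for every `a`. -/
def jacobiP (n : ℕ) (a b x : ℝ) : ℝ :=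
  ∑ k ∈ Finset.range (n + 1),
    poch (n + a + b + 1) k * poch (a + 1 + k) (n - k)
      / ((k.factorial : ℝ) * ((n - k).factorial : ℝ)) * ((x - 1) / 2) ^ k

/-- The Gegenbauer polynomial
`C_n^{(l)}(x) = (2l)_n / (l+1/2)_n * P_n^{(l-1/2, l-1/2)}(x)` (for `l > -1/2`). -/
def gegenbauerC (n : ℕ) (l x : ℝ) : ℝ :=
  poch (2 * l) n / poch (l + 1 / 2) n * jacobiP n (l - 1 / 2) (l - 1 / 2) x

/-- The Wilson polynomial `(a+b)_n (a+c)_n (a+d)_n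
  * ₄F₃(-n, a+α, a-α, n+a+b+c+d-1; a+b, a+c, a+d; 1)`,
with `(y)_n / (y)_k` written as `(y+k)_{n-k}` for `y = a+b, a+c, a+d`. -/
def wilsonP (n : ℕ) (a b c d : ℝ) (α : ℂ) : ℂ :=
  ∑ k ∈ Finset.range (n + 1),
    poch (-(n : ℂ)) k * poch ((n : ℂ) + a + b + c + d - 1) k * poch ((a : ℂ) + α) k
      * poch ((a : ℂ) - α) k / (k.factorial : ℂ)
      * (poch ((a : ℂ) + b + k) (n - k) * poch ((a : ℂ) + c + k) (n - k)
        * poch ((a : ℂ) + d + k) (n - k))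

/-- The (principal branch of the) Gauss hypergeometric function on the half plane `Re z < 1/2`.
Mathlib's `₂F₁` is the power series, which converges only in the unit disc; the analytic
continuation to `Re z < 1/2` is given by Pfaff's formula
`(1 - z) ^ (-a) * ₂F₁(a, c-b; c; z/(z-1))`, where `|z/(z-1)| < 1`. -/
def hyp (a b c z : ℂ) : ℂ := (1 - z) ^ (-a) * ₂F₁ a (c - b) c (z / (z - 1))

/-- `Γ(x ± α) = Γ(x + α) Γ(x - α)`. -/
def gammaPM (x : ℝ) (α : ℂ) : ℂ := Gamma (x + α) * Gamma (x - α)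

/-! ### Jacobi functions -/

/-- The Jacobi function `ϑ_α^{(p,q)}(x)`, `0 < x ≤ 1`. -/
def jacobiFun (p q : ℝ) (α : ℂ) (x : ℝ) : ℂ :=
  hyp ((1 + p + q) / 2 + α) ((1 + p + q) / 2 - α) (1 + p) (((x - 1) / x : ℝ) : ℂ)

/-- The coefficient `Q_{p,q}(α)`. -/
def jacobiQ (p q : ℝ) (α : ℂ) : ℂ :=
  2 * Gamma (1 + p) * Gamma (-2 * α)
    / (Gamma ((1 + p + q) / 2 - α) * Gamma ((1 + p - q) / 2 - α))

/-- The normalization `N_{p,q}(α)`: the meromorphic function of `α` that equals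
`|Q_{p,q}(α)|² / 2` on the imaginary axis, see `jacobiN_imag`. -/
def jacobiN (p q : ℝ) (α : ℂ) : ℂ := jacobiQ p q α * jacobiQ p q (-α) / 2

theorem jacobiQ_conj (p q : ℝ) (α : ℂ) :
    jacobiQ p q ((starRingEnd ℂ) α) = (starRingEnd ℂ) (jacobiQ p q α) := by
  simp [jacobiQ, map_ofNat, ← Complex.Gamma_conj]

theorem jacobiN_imag (p q t : ℝ) :
    jacobiN p q (t * I) = ((‖jacobiQ p q (t * I)‖ ^ 2 / 2 : ℝ) : ℂ) := by
  have h : -((t : ℂ) * I) = (starRingEnd ℂ) ((t : ℂ) * I) := by simp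
  rw [jacobiN, h, jacobiQ_conj, Complex.mul_conj, Complex.normSq_eq_norm_sq]
  push_cast
  ring

/-! ### Mellin-Barnes integrals -/

/-- The residue of `f` at the isolated singularity `z₀`: the integral of `f` over a small circle
around `z₀`, divided by `2πi`. -/
def residue (f : ℂ → ℂ) (z₀ : ℂ) : ℂ :=
  limUnder (𝓝[>] (0 : ℝ)) fun r : ℝ => (2 * Real.pi * I)⁻¹ * ∮ z in C(z₀, r), f z

/-- The poles of `∏ Γ(a - α)`, `a ∈ A`: the points `a + k`. They have to lie to the right
of the contour. -/
def rightPoles (A : Set ℝ) : Set ℝ := {x | ∃ a ∈ A, ∃ k : ℕ, x = a + k}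

/-- The poles of `∏ Γ(a + α)`, `a ∈ A`: the points `-a - k`. They have to lie to the left
of the contour. -/
def leftPoles (A : Set ℝ) : Set ℝ := {x | ∃ a ∈ A, ∃ k : ℕ, x = -a - k}

open Classical in
/-- The weight of a pole that lies on the wrong side of the imaginary axis: `1` in general, and
`1/2` if the point belongs to both families. In the latter (exceptional) case no contour separates
the families; one takes the mean of the contours that pass the point on either side. -/
def poleWeight (A : Set ℝ) (x : ℝ) : ℂ := if x ∈ rightPoles A ∩ leftPoles A then 1 / 2 else 1

/-- The Mellin-Barnes integral `∫ [dα] f(α) = (1/2πi) ∫ dα f(α)`, for a function with the two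
families of poles `rightPoles A` and `leftPoles A`. The contour goes from `-i∞` to `i∞` and
separates the two families, i.e. it is the imaginary axis, pulled across those poles that lie on the
wrong side of it. Each left pole in the right half plane contributes a counterclockwise circle,
each right pole in the left half plane a clockwise one. -/
def mellinBarnes (A : Set ℝ) (f : ℂ → ℂ) : ℂ :=
  1 / (2 * Real.pi) * (∫ t : ℝ, f (t * I))
    + (∑ᶠ x ∈ {x : ℝ | x ∈ leftPoles A ∧ 0 < x}, poleWeight A x * residue f x)
    - ∑ᶠ x ∈ {x : ℝ | x ∈ rightPoles A ∧ x < 0}, poleWeight A x * residue f x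

/-! ### Alpha space transforms

For a weight `w` on `[0,1]`, partial waves `Ψ_α(x)` and a normalization `N(α)`. -/

/-- The integrand of the transform `f ↦ F`. -/
def transformIntegrand (w : ℝ → ℝ) (Ψ : ℂ → ℝ → ℂ) (f : ℝ → ℝ) (α : ℂ) (x : ℝ) : ℂ :=
  (w x : ℂ) * (f x : ℂ) * Ψ α x

/-- `F(α) = ∫_0^1 dx w(x) f(x) Ψ_α(x)`. -/
def alphaTransform (w : ℝ → ℝ) (Ψ : ℂ → ℝ → ℂ) (f : ℝ → ℝ) (α : ℂ) : ℂ :=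
  ∫ x in (0 : ℝ)..1, transformIntegrand w Ψ f α x

/-- The integrand of the inverse transform `F ↦ f`. -/
def inverseIntegrand (N : ℂ → ℂ) (Ψ : ℂ → ℝ → ℂ) (F : ℂ → ℂ) (x : ℝ) (α : ℂ) : ℂ :=
  F α / N α * Ψ α x

/-- `f(x) = ∫ [dα] / N(α) F(α) Ψ_α(x)`, as a Mellin-Barnes integral; `A` describes the poles of
the integrand. -/
def inverseTransform (A : Set ℝ) (N : ℂ → ℂ) (Ψ : ℂ → ℝ → ℂ) (F : ℂ → ℂ) (x : ℝ) : ℂ :=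
  mellinBarnes A (inverseIntegrand N Ψ F x)

/-! ### Crosscap -/

def wProj (d η : ℝ) : ℝ := (1 - η) ^ (d / 2 - 1) / η ^ (d / 2 + 1)

/-- The crosscap partial wave `Φ_α(η)`. -/
def waveProj (d Δ₁ Δ₂ : ℝ) (α : ℂ) (η : ℝ) : ℂ :=
  ((η ^ (-((Δ₁ - Δ₂) / 2)) : ℝ) : ℂ) * jacobiFun (d / 2 - 1) (Δ₁ - Δ₂) α η

def normProj (d Δ₁ Δ₂ : ℝ) (α : ℂ) : ℂ := jacobiN (d / 2 - 1) (Δ₁ - Δ₂) α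

/-- The alpha space function `ξ_n^proj(α)`. -/
def xiProj (n : ℕ) (d Δ₁ Δ₂ : ℝ) (α : ℂ) : ℂ :=
  Gamma (d / 2) * gammaPM ((Δ₁ + Δ₂) / 2 - d / 4) α
    * wilsonP n (d / 4 + (Δ₁ - Δ₂) / 2) (d / 4 - (Δ₁ - Δ₂) / 2) ((Δ₁ + Δ₂) / 2 - d / 4)
        (3 * d / 4 - (Δ₁ + Δ₂) / 2) α

/-- The poles of `ξ_n^proj(α) / N_proj(α)`: the first two from `1 / N_proj`, the last from
`ξ_n^proj`. -/
def polesProj (d Δ₁ Δ₂ : ℝ) : Set ℝ :=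
  {d / 4 + (Δ₁ - Δ₂) / 2, d / 4 - (Δ₁ - Δ₂) / 2, (Δ₁ + Δ₂) / 2 - d / 4}

/-- The claimed position space function `ξ_n^proj(η)`. For `d = 1` the prefactor
`1 / (d-1)_n` is singular and `C_n^{(0)} = 0` (if `n ≥ 1`); there the expression is to be read as its
limit `d → 1`, see `posProj_eq`. -/
def posProj (n : ℕ) (d Δ₁ Δ₂ η : ℝ) : ℝ :=
  if d = 1 then
    (n.factorial : ℝ) * Real.Gamma (Δ₁ + n) * Real.Gamma (Δ₂ + n)
      * η ^ ((Δ₁ + Δ₂) / 2) * jacobiP n (-1 / 2) (-1 / 2) (1 - 2 * η)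
  else
    (n.factorial : ℝ) * poch (d / 2) n * Real.Gamma (Δ₁ + n) * Real.Gamma (Δ₂ + n)
      / poch (d - 1) n * η ^ ((Δ₁ + Δ₂) / 2) * gegenbauerC n (d / 2 - 1 / 2) (1 - 2 * η)

theorem poch_ne_zero {x : ℝ} {n : ℕ} (h : ∀ k : ℕ, x ≠ -k) : poch x n ≠ 0 := by
  unfold poch
  induction n with
  | zero => simp
  | succ m ih =>
    rw [ascPochhammer_succ_eval]
    exact mul_ne_zero ih fun h0 => h m (by linarith)

/-- The position space function in terms of Jacobi polynomials, without singular factors. -/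
theorem posProj_eq (n : ℕ) {d : ℝ} (hd : 0 < d) (Δ₁ Δ₂ η : ℝ) :
    posProj n d Δ₁ Δ₂ η = (n.factorial : ℝ) * Real.Gamma (Δ₁ + n) * Real.Gamma (Δ₂ + n)
      * η ^ ((Δ₁ + Δ₂) / 2) * jacobiP n (d / 2 - 1) (d / 2 - 1) (1 - 2 * η) := by
  unfold posProj
  split_ifs with h
  · subst h
    norm_num
  · have h1 : poch (d / 2) n ≠ 0 := poch_ne_zero fun k => by
      have : (0 : ℝ) ≤ k := k.cast_nonneg
      intro h0
      linarith
    have h2 : poch (d - 1) n ≠ 0 := poch_ne_zero fun k => by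
      rcases k with _ | k
      · simpa [sub_eq_zero] using h
      · have : (0 : ℝ) ≤ k := k.cast_nonneg
        intro h0
        push_cast at h0
        linarith
    have e1 : 2 * (d / 2 - 1 / 2) = d - 1 := by ring
    have e2 : d / 2 - 1 / 2 + 1 / 2 = d / 2 := by ring
    have e3 : d / 2 - 1 / 2 - 1 / 2 = d / 2 - 1 := by ring
    rw [gegenbauerC, e1, e2, e3]
    field_simp

/-! ### Boundary CFT: bulk channel -/

def wBulk (d ρ : ℝ) : ℝ := 1 / ρ ^ (d / 2 + 1)

/-- The bulk partial wave `Ψ_α^bulk(ρ)`. -/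
def waveBulk (d Δ₁ Δ₂ : ℝ) (α : ℂ) (ρ : ℝ) : ℂ :=
  ((((1 - ρ) / ρ) ^ ((Δ₁ - Δ₂) / 2) : ℝ) : ℂ) * jacobiFun (Δ₁ - Δ₂) (d / 2 - 1) α ρ

def normBulk (d Δ₁ Δ₂ : ℝ) (α : ℂ) : ℂ := jacobiN (Δ₁ - Δ₂) (d / 2 - 1) α

/-- The alpha space function `ξ_n^bulk(α)`. -/
def xiBulk (n : ℕ) (d Δ₁ Δ₂ : ℝ) (α : ℂ) : ℂ :=
  Gamma (1 + (Δ₁ - Δ₂)) * gammaPM ((Δ₁ + Δ₂) / 2 - d / 4) α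
    * wilsonP n ((Δ₁ + Δ₂) / 2 - d / 4) (3 * d / 4 - (Δ₁ + Δ₂) / 2)
        (1 - d / 4 + (Δ₁ - Δ₂) / 2) (d / 4 + (Δ₁ - Δ₂) / 2) α

/-- The poles of `ξ_n^bulk(α) / N_bulk(α)`. -/
def polesBulk (d Δ₁ Δ₂ : ℝ) : Set ℝ :=
  {d / 4 + (Δ₁ - Δ₂) / 2, 1 - d / 4 + (Δ₁ - Δ₂) / 2, (Δ₁ + Δ₂) / 2 - d / 4}

/-- The claimed position space function `ξ_n^bulk(ρ)`. -/
def posBulk (n : ℕ) (d Δ₁ Δ₂ ρ : ℝ) : ℝ :=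
  (n.factorial : ℝ) * Real.Gamma (Δ₁ + n) * Real.Gamma (Δ₁ + 1 - d / 2 + n)
    * (ρ ^ ((Δ₁ + Δ₂) / 2) * (1 - ρ) ^ ((Δ₁ - Δ₂) / 2))
    * jacobiP n (d / 2 - 1) (Δ₁ - Δ₂) (1 - 2 * ρ)

/-! ### Boundary CFT: boundary channel -/

def wBdy (d ρ : ℝ) : ℝ := ρ ^ (d / 2 - 1) / (1 - ρ) ^ d

/-- The boundary partial wave `Ψ_ν^bdy(ρ)`. -/
def waveBdy (d : ℝ) (ν : ℂ) (ρ : ℝ) : ℂ := jacobiFun (d / 2 - 1) (d / 2 - 1) ν (1 - ρ)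

def normBdy (d : ℝ) (ν : ℂ) : ℂ := jacobiN (d / 2 - 1) (d / 2 - 1) ν

/-- The alpha space function `ξ_n^bdy(ν)`. -/
def xiBdy (n : ℕ) (d Δ₁ Δ₂ : ℝ) (ν : ℂ) : ℂ :=
  Gamma (d / 2) * gammaPM (Δ₁ + 1 / 2 - d / 2) ν
    * wilsonP n (1 / 2) (d / 2 - 1 / 2) (Δ₁ + 1 / 2 - d / 2) (1 / 2 + d / 2 - Δ₂) ν

/-- The poles of `ξ_n^bdy(ν) / N_bdy(ν)`. -/
def polesBdy (d Δ₁ : ℝ) : Set ℝ := {1 / 2, d / 2 - 1 / 2, Δ₁ + 1 / 2 - d / 2}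

/-- The claimed position space function `ξ_n^bdy(ρ)`. -/
def posBdy (n : ℕ) (d Δ₁ Δ₂ ρ : ℝ) : ℝ :=
  (n.factorial : ℝ) * Real.Gamma (Δ₁ + n) * Real.Gamma (Δ₁ + 1 - d / 2 + n)
    * ((-1) ^ n * (1 - ρ) ^ Δ₁) * jacobiP n (d / 2 - 1) (Δ₁ - Δ₂) (1 - 2 * ρ)

end AlphaSpace

end

open AlphaSpace

/-! ### Pochhammer symbols: the Chu-Vandermonde and Pfaff-Saalschütz sums -/

section PochAlgebra

variable {K : Type*} [CommRing K]

/-! The three transform pairs are one statement. Put `x = η`, `ρ` or `1 - ρ`, then `t = 1 - x`, `u =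
(1+p+q)/2`, `v = (1+p-q)/2`. The partial wave is an elementary factor times the Jacobi function `th
u v t α`. Up to a constant, `1/N` is `Γ(u ± α) Γ(v ± α) α sin(2πα)`. Since the Wilson polynomials
are symmetric in their parameters, every `ξ_n(α)` can be written as `Γ(1+p) Γ(s ± α)` times a Wilson
polynomial with first parameter `s`. Its coefficients in the basis `(s+α)_k (s-α)_k` are, up to
Pochhammer factors, those of `n! P_n^{(r,p)}(1-2x)` in the basis `x^k`, and `(s+α)_k (s-α)_k Γ(s ±
α) = Γ(s+k ± α)`. So degree `n` reduces to degree `0` with `s` replaced by `s + k`.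

Transforms. The transform of a power of `x` is computed by integrating the hypergeometric series
termwise: each term is a beta integral, and the resulting `₂F₁(1)` is summed by Gauss
(`integral_rpow_mul_th`).

Inverse transforms. Let `mbInt u v s E` be the Mellin-Barnes integral of `Γ(u ± α) Γ(v ± α) Γ(s ± α)
α sin(2πα) E(α)` for `E` even, entire and polynomially bounded on vertical strips. It vanishes on
the image of the difference operator `E ↦ [(u+α)(v+α)(s+α) E(α+1/2) - (u-α)(v-α)(s-α) E(α-1/2)] /
(2α)`, because the integrand is then a difference of two half-shifts of one kernel
(`mbInt_eq_zero`). The `t`-derivative of `(1-t)^{-(s+u)} th u v t` is in this image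
(`hasDerivAt_one_sub_cpow_mul_hF`), whence `mbInt_th`: `mbInt u v s (th u v t) = (1-t)^{s+u} mbInt u
v s 1`.

The constant is `mbInt u v s 1 = -π Γ(u+v) Γ(u+s) Γ(v+s)` (`mbInt_const_one`). The difference
operator applied to `E = 1` shows that the quotient of the two sides has period one in each
parameter. Integrating `mbInt_th` against a beta weight with a further parameter `s'` gives an
integral that is symmetric in `s` and `s'`, so the quotient does not depend on `s`, hence on no
parameter. At `(1/2, 1/2, 1/2)` the integral is elementary.

Two technical points remain. The Jacobi function must be polynomially bounded on vertical strips;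
this comes from an energy estimate for the hypergeometric equation in the variable `t = tanh² x`.
And the parameters are arbitrary real numbers, so poles may cross the imaginary axis and a point may
be a pole of both families. The weight `1/2` of such points is what makes the residues in the
contour shift cancel exactly. -/

@[simp] theorem poch_zero (x : K) : poch x 0 = 1 := by simp [poch]

theorem poch_succ (x : K) (n : ℕ) : poch x (n + 1) = poch x n * (x + n) := by
  simp [poch, ascPochhammer_succ_eval]

theorem poch_succ_left (x : K) (n : ℕ) : poch x (n + 1) = x * poch (x + 1) n := by
  simp [poch, ascPochhammer_succ_left]

@[simp] theorem poch_one (x : K) : poch x 1 = x := by simp [poch]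

theorem poch_add (x : K) (m k : ℕ) : poch x (m + k) = poch x m * poch (x + m) k := by
  induction k with
  | zero => simp
  | succ k ih =>
    rw [← add_assoc, poch_succ, ih, poch_succ]
    push_cast
    ring

theorem poch_reflect (x : K) (m : ℕ) : poch x m = (-1) ^ m * poch (1 - x - m) m := by
  induction m generalizing x with
  | zero => simp
  | succ m ih =>
    rw [poch_succ_left, ih (x + 1), poch_succ _ m]
    have h : 1 - (x + 1) - (m : K) = 1 - x - ((m + 1 : ℕ) : K) := by push_cast; ring
    rw [h]
    push_cast
    ring

theorem map_poch {L : Type*} [CommRing L] (f : K →+* L) (x : K) (n : ℕ) :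
    f (poch x n) = poch (f x) n := by
  induction n with
  | zero => simp
  | succ n ih => simp [poch_succ, ih]

theorem poch_ofReal (x : ℝ) (n : ℕ) : ((poch x n : ℝ) : ℂ) = poch (x : ℂ) n :=
  map_poch Complex.ofRealHom x n

theorem poch_neg_natCast {L : Type*} [Field L] [CharZero L] {n k : ℕ} (h : k ≤ n) :
    poch (-(n : L)) k = (-1) ^ k * (n.factorial / (n - k).factorial : L) := by
  induction k with
  | zero => simp [div_self (Nat.cast_ne_zero.mpr n.factorial_ne_zero : (n.factorial : L) ≠ 0)]
  | succ k ih =>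
    obtain ⟨j, rfl⟩ := Nat.exists_eq_add_of_le h
    have e1 : k + 1 + j - k = j + 1 := by omega
    have e2 : k + 1 + j - (k + 1) = j := by omega
    rw [poch_succ, ih (by omega), e1, e2, Nat.factorial_succ j]
    have h1 : (j.factorial : L) ≠ 0 := Nat.cast_ne_zero.mpr j.factorial_ne_zero
    have h2 : ((j : L) + 1) ≠ 0 := by exact_mod_cast Nat.succ_ne_zero j
    push_cast
    field_simp
    ring

/-- Pascal's rule. It drives the induction on the length of the sum in both summation formulas
below. -/
theorem sum_choose_succ (m : ℕ) (T : ℕ → K) :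
    ∑ k ∈ Finset.range (m + 2), ((m + 1).choose k : K) * T k
      = ∑ k ∈ Finset.range (m + 1), (m.choose k : K) * (T k + T (k + 1)) := by
  rw [Finset.sum_range_succ' _ (m + 1)]
  have h : ∀ k ∈ Finset.range (m + 1), ((m + 1).choose (k + 1) : K) * T (k + 1)
      = (m.choose k : K) * T (k + 1) + (m.choose (k + 1) : K) * T (k + 1) := fun k _ => by
    rw [Nat.choose_succ_succ]; push_cast; ring
  rw [Finset.sum_congr rfl h, Finset.sum_add_distrib]
  have h2 : ∑ k ∈ Finset.range (m + 1), (m.choose (k + 1) : K) * T (k + 1)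
        + ((m + 1).choose 0 : K) * T 0
      = ∑ k ∈ Finset.range (m + 1), (m.choose k : K) * T k := by
    have := Finset.sum_range_succ' (fun k => (m.choose k : K) * T k) (m + 1)
    rw [Finset.sum_range_succ _ (m + 1)] at this
    simp only [Nat.choose_succ_self, Nat.cast_zero, zero_mul, add_zero, Nat.choose_zero_right]
      at this ⊢
    exact this.symm
  rw [add_assoc, h2, ← Finset.sum_add_distrib]
  exact Finset.sum_congr rfl fun k _ => by ring

/-- The Chu-Vandermonde sum. -/
theorem poch_vandermonde (X C : K) (N : ℕ) :
    ∑ i ∈ Finset.range (N + 1), (N.choose i : K) * ((-1) ^ i * poch X i * poch (C + i) (N - i))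
      = poch (C - X) N := by
  induction N generalizing X C with
  | zero => simp
  | succ N ih =>
    rw [sum_choose_succ]
    -- Two neighbouring terms share all factors but one, and the difference of these is `C - X`;
    -- what is left is the sum of length `N` with `C + 1` in place of `C`.
    have h : ∀ i ∈ Finset.range (N + 1), (N.choose i : K) *
        ((-1) ^ i * poch X i * poch (C + i) (N + 1 - i)
          + (-1) ^ (i + 1) * poch X (i + 1) * poch (C + (i + 1 : ℕ)) (N + 1 - (i + 1)))
        = (C - X) * ((N.choose i : K) * ((-1) ^ i * poch X i * poch (C + 1 + i) (N - i))) := by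
      intro i hi
      have e : N + 1 - i = (N - i) + 1 := by have := Finset.mem_range.mp hi; omega
      have e2 : C + ((i + 1 : ℕ) : K) = C + 1 + i := by push_cast; ring
      have e3 : C + (i : K) + 1 = C + 1 + i := by ring
      rw [e, poch_succ_left, poch_succ, Nat.add_sub_add_right, e2, e3]
      ring
    rw [Finset.sum_congr rfl h, ← Finset.mul_sum, ih, poch_succ_left]
    congr 2
    ring

/-- The Pfaff-Saalschütz sum. -/
theorem poch_saalschuetz (A B c : K) (m : ℕ) :
    ∑ k ∈ Finset.range (m + 1), (m.choose k : K) * (poch A k * poch B k * poch (c + k) (m - k)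
        * poch (c - A - B) (m - k)) = poch (c - A) m * poch (c - B) m := by
  induction m with
  | zero => simp
  | succ m ih =>
    set e := c - A - B with he
    set F : ℕ → K := fun k => (m.choose k : K) * (poch A k * poch B k * poch (c + k) (m - k)
        * poch e (m - k)) with hF
    -- Telescoping certificate for the recurrence in `m`. It vanishes at `k = 0` through the factor
    -- `k` and at `k = m + 1` through the binomial coefficient.
    set H : ℕ → K := fun k => (k : K) * F k * (e + m - k) with hH
    rw [sum_choose_succ]
    have key : ∀ k ∈ Finset.range (m + 1), (m.choose k : K) *
        (poch A k * poch B k * poch (c + k) (m + 1 - k) * poch e (m + 1 - k)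
          + poch A (k + 1) * poch B (k + 1) * poch (c + (k + 1 : ℕ)) (m + 1 - (k + 1))
            * poch e (m + 1 - (k + 1)))
        = (c - A + m) * (c - B + m) * F k + (H (k + 1) - H k) := by
      intro k hk
      rcases Nat.lt_or_ge k m with h | h
      · obtain ⟨i, rfl⟩ := Nat.exists_eq_add_of_lt h
        have e1 : k + i + 1 + 1 - k = i + 2 := by omega
        have e2 : k + i + 1 + 1 - (k + 1) = i + 1 := by omega
        have e3 : k + i + 1 - k = i + 1 := by omega
        have e4 : k + i + 1 - (k + 1) = i := by omega
        have hc : ((k + i + 1).choose (k + 1) : K) * ((k : K) + 1)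
            = ((k + i + 1).choose k : K) * ((i : K) + 1) := by
          have := Nat.choose_succ_right_eq (k + i + 1) k
          rw [e3] at this
          have := congrArg (Nat.cast : ℕ → K) this
          push_cast at this
          exact this
        have e5 : c + ((k + 1 : ℕ) : K) = c + k + 1 := by push_cast; ring
        simp only [hH, hF, e1, e2, e3, e4, e5]
        rw [poch_succ_left (c + k) (i + 1), poch_succ (c + k + 1) i, poch_succ_left (c + k) i,
          poch_succ e (i + 1), poch_succ e i, poch_succ A k, poch_succ B k]
        have hH1 : ((k + 1 : ℕ) : K) * (((k + i + 1).choose (k + 1) : K) * (poch A k * (A + k)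
            * (poch B k * (B + k)) * poch (c + k + 1) i * poch e i))
              * (e + (k + i + 1 : ℕ) - (k + 1 : ℕ))
            = ((k + i + 1).choose k : K) * ((i : K) + 1) * (poch A k * (A + k)
            * (poch B k * (B + k)) * poch (c + k + 1) i * poch e i) * (e + i) := by
          rw [← hc]; push_cast; ring
        rw [hH1, he]
        push_cast
        ring
      · have : k = m := le_antisymm (by simpa [Nat.lt_succ_iff] using hk) h
        subst this
        simp only [hH, hF, Nat.choose_succ_self, Nat.choose_self]
        simp [poch_succ, he]
        ring
    rw [Finset.sum_congr rfl key, Finset.sum_add_distrib, ← Finset.mul_sum, Finset.sum_range_sub,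
      ih, poch_succ, poch_succ]
    simp [hH, hF]
    ring

end PochAlgebra

/-! ### Symmetries of the Jacobi and Wilson polynomials -/

/-- Reflection of the Jacobi polynomials. -/
theorem jacobiP_neg (n : ℕ) (a b x : ℝ) : jacobiP n a b (-x) = (-1) ^ n * jacobiP n b a x := by
  unfold jacobiP
  set X := (x - 1) / 2 with hX
  have hx : (-x - 1) / 2 = -(1 + X) := by rw [hX]; ring
  rw [hx]
  have hexp : ∀ k : ℕ, (-(1 + X)) ^ k = ∑ j ∈ Finset.range (k + 1), (-1) ^ k * (k.choose j : ℝ) * X ^ j := by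
    intro k
    rw [neg_pow, add_comm, add_pow, Finset.mul_sum]
    exact Finset.sum_congr rfl fun j _ => by rw [one_pow]; ring
  simp_rw [hexp, Finset.mul_sum]
  rw [Finset.sum_comm' (t' := Finset.range (n + 1)) (s' := fun j => Finset.Ico j (n + 1))
    (by intro k j; simp only [Finset.mem_range, Finset.mem_Ico]; omega)]
  refine Finset.sum_congr rfl fun j hj => ?_
  have hj' : j ≤ n := by have := Finset.mem_range.mp hj; omega
  obtain ⟨N, rfl⟩ := Nat.exists_eq_add_of_le hj'
  rw [Finset.sum_Ico_eq_sum_range]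
  have e0 : j + N + 1 - j = N + 1 := by omega
  have e1 : j + N - j = N := by omega
  rw [e0, e1]
  -- The coefficient of `X ^ j` is a sum over the tail `k = j + i`, `i ≤ N`, of Chu-Vandermonde
  -- type.
  have hv := poch_vandermonde (((j + N : ℕ) : ℝ) + a + b + 1 + j) (a + 1 + j) N
  have hr : poch (a + 1 + j - (((j + N : ℕ) : ℝ) + a + b + 1 + j)) N
      = (-1) ^ N * poch (b + 1 + j) N := by
    rw [poch_reflect]
    congr 2
    push_cast
    ring
  rw [hr] at hv
  have hsum : ∀ i ∈ Finset.range (N + 1),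
      poch (((j + N : ℕ) : ℝ) + a + b + 1) (j + i) * poch (a + 1 + ((j + i : ℕ) : ℝ)) (j + N - (j + i))
        / (((j + i).factorial : ℝ) * ((j + N - (j + i)).factorial : ℝ))
        * ((-1) ^ (j + i) * ((j + i).choose j : ℝ) * X ^ j)
      = ((-1) ^ j * poch (((j + N : ℕ) : ℝ) + a + b + 1) j / ((j.factorial : ℝ) * N.factorial) * X ^ j)
        * ((N.choose i : ℝ) * ((-1) ^ i * poch (((j + N : ℕ) : ℝ) + a + b + 1 + j) i
          * poch (a + 1 + j + i) (N - i))) := by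
    intro i hi
    have hi' : i ≤ N := by have := Finset.mem_range.mp hi; omega
    have e2 : j + N - (j + i) = N - i := by omega
    have e3 : a + 1 + ((j + i : ℕ) : ℝ) = a + 1 + j + i := by push_cast; ring
    rw [e2, e3, poch_add, Nat.cast_choose ℝ hi', Nat.cast_choose ℝ (Nat.le_add_right j i),
      Nat.add_sub_cancel_left]
    have f1 : ((j + i).factorial : ℝ) ≠ 0 := Nat.cast_ne_zero.mpr (Nat.factorial_ne_zero _)
    have f2 : (j.factorial : ℝ) ≠ 0 := Nat.cast_ne_zero.mpr (Nat.factorial_ne_zero _)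
    have f3 : (i.factorial : ℝ) ≠ 0 := Nat.cast_ne_zero.mpr (Nat.factorial_ne_zero _)
    have f4 : ((N - i).factorial : ℝ) ≠ 0 := Nat.cast_ne_zero.mpr (Nat.factorial_ne_zero _)
    have f5 : (N.factorial : ℝ) ≠ 0 := Nat.cast_ne_zero.mpr (Nat.factorial_ne_zero _)
    rw [pow_add]
    field_simp
  rw [Finset.sum_congr rfl hsum, ← Finset.mul_sum, hv]
  have e4 : ((j + N : ℕ) : ℝ) + b + a + 1 = ((j + N : ℕ) : ℝ) + a + b + 1 := by ring
  rw [e4, pow_add]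
  ring

/-- Symmetry of the Wilson polynomials in the first two parameters. -/
theorem wilsonP_swap (n : ℕ) (a b c d : ℝ) (α : ℂ) :
    wilsonP n a b c d α = wilsonP n b a c d α := by
  unfold wilsonP
  set S : ℂ := (n : ℂ) + a + b + c + d - 1 with hS
  have hS' : (n : ℂ) + b + a + c + d - 1 = S := by rw [hS]; ring
  rw [hS']
  -- Saalschütz read backwards: the basis `(a ± α)_k` is expanded in the basis `(b ± α)_j`.
  have hexp : ∀ k : ℕ, poch ((a : ℂ) + α) k * poch ((a : ℂ) - α) k
      = ∑ j ∈ Finset.range (k + 1), (k.choose j : ℂ) * (poch ((b : ℂ) + α) j * poch ((b : ℂ) - α) j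
        * poch ((a : ℂ) + b + j) (k - j) * poch ((a : ℂ) - b) (k - j)) := by
    intro k
    have := poch_saalschuetz ((b : ℂ) + α) ((b : ℂ) - α) ((a : ℂ) + b) k
    have e1 : (a : ℂ) + b - (b + α) - (b - α) = a - b := by ring
    have e2 : (a : ℂ) + b - (b + α) = a - α := by ring
    have e3 : (a : ℂ) + b - (b - α) = a + α := by ring
    rw [e1, e2, e3] at this
    rw [this, mul_comm]
  have hl : ∀ k : ℕ, poch (-(n : ℂ)) k * poch S k * poch ((a : ℂ) + α) k
      * poch ((a : ℂ) - α) k / (k.factorial : ℂ)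
      * (poch ((a : ℂ) + b + k) (n - k) * poch ((a : ℂ) + c + k) (n - k)
        * poch ((a : ℂ) + d + k) (n - k))
      = ∑ j ∈ Finset.range (k + 1), poch (-(n : ℂ)) k * poch S k / (k.factorial : ℂ)
      * (poch ((a : ℂ) + b + k) (n - k) * poch ((a : ℂ) + c + k) (n - k)
        * poch ((a : ℂ) + d + k) (n - k)) * ((k.choose j : ℂ) * (poch ((b : ℂ) + α) j * poch ((b : ℂ) - α) j
        * poch ((a : ℂ) + b + j) (k - j) * poch ((a : ℂ) - b) (k - j))) := by
    intro k
    rw [← Finset.mul_sum, ← hexp]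
    ring
  simp_rw [hl]
  rw [Finset.sum_comm' (t' := Finset.range (n + 1)) (s' := fun j => Finset.Ico j (n + 1))
    (by intro k j; simp only [Finset.mem_range, Finset.mem_Ico]; omega)]
  refine Finset.sum_congr rfl fun j hj => ?_
  have hj' : j ≤ n := by have := Finset.mem_range.mp hj; omega
  obtain ⟨N, rfl⟩ := Nat.exists_eq_add_of_le hj'
  rw [Finset.sum_Ico_eq_sum_range]
  have e0 : j + N + 1 - j = N + 1 := by omega
  have e1 : j + N - j = N := by omega
  rw [e0, e1]
  -- After interchanging the sums, the coefficient of `(b ± α)_j` is again a Saalschütz sum; the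
  -- balancing condition holds because `S` contains `n - 1`.
  have hv := poch_saalschuetz (S + j) ((a : ℂ) - b) ((a : ℂ) + c + j) N
  have hr : (-1) ^ N * poch ((a : ℂ) + c + j - (S + j)) N = poch ((b : ℂ) + d + j) N := by
    rw [poch_reflect ((b : ℂ) + d + j)]
    congr 2
    rw [hS]
    push_cast
    ring
  have hr2 : (a : ℂ) + c + j - (a - b) = b + c + j := by ring
  rw [hr2] at hv
  have hsum : ∀ i ∈ Finset.range (N + 1),
      poch (-((j + N : ℕ) : ℂ)) (j + i) * poch S (j + i) / ((j + i).factorial : ℂ)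
      * (poch ((a : ℂ) + b + (j + i : ℕ)) (j + N - (j + i))
        * poch ((a : ℂ) + c + (j + i : ℕ)) (j + N - (j + i))
        * poch ((a : ℂ) + d + (j + i : ℕ)) (j + N - (j + i)))
      * (((j + i).choose j : ℂ) * (poch ((b : ℂ) + α) j * poch ((b : ℂ) - α) j
        * poch ((a : ℂ) + b + j) (j + i - j) * poch ((a : ℂ) - b) (j + i - j)))
      = (poch (-((j + N : ℕ) : ℂ)) j * poch S j * poch ((b : ℂ) + α) j * poch ((b : ℂ) - α) j
          / (j.factorial : ℂ) * poch ((b : ℂ) + a + j) N * (-1) ^ N)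
        * ((N.choose i : ℂ) * (poch (S + j) i * poch ((a : ℂ) - b) i
          * poch ((a : ℂ) + c + j + i) (N - i)
          * poch ((a : ℂ) + c + j - (S + j) - (a - b)) (N - i))) := by
    intro i hi
    have hi' : i ≤ N := by have := Finset.mem_range.mp hi; omega
    obtain ⟨l, rfl⟩ := Nat.exists_eq_add_of_le hi'
    have e2 : j + (i + l) - (j + i) = l := by omega
    have e3 : j + i - j = i := by omega
    have e4 : i + l - i = l := by omega
    have e5 : (a : ℂ) + c + (j + i : ℕ) = a + c + j + i := by push_cast; ring
    have e6 : poch ((b : ℂ) + a + j) (i + l) = poch ((a : ℂ) + b + j) i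
        * poch ((a : ℂ) + b + (j + i : ℕ)) l := by
      rw [poch_add, add_comm (b : ℂ) a]
      congr 2
      push_cast
      ring
    have e7 : poch ((a : ℂ) + d + (j + i : ℕ)) l = (-1) ^ l *
        poch ((a : ℂ) + c + j - (S + j) - (a - b)) l := by
      rw [poch_reflect]
      congr 2
      rw [hS]
      push_cast
      ring
    have e8 : -((j + (i + l) : ℕ) : ℂ) + j = -((i + l : ℕ) : ℂ) := by push_cast; ring
    rw [e2, e3, e4, e5, e6, e7, poch_add _ j i, poch_add S j i, e8, poch_neg_natCast hi',
      Nat.cast_choose ℂ hi', Nat.cast_choose ℂ (Nat.le_add_right j i), e3, e4]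
    have f1 : ((j + i).factorial : ℂ) ≠ 0 := Nat.cast_ne_zero.mpr (Nat.factorial_ne_zero _)
    have f2 : (j.factorial : ℂ) ≠ 0 := Nat.cast_ne_zero.mpr (Nat.factorial_ne_zero _)
    have f3 : (i.factorial : ℂ) ≠ 0 := Nat.cast_ne_zero.mpr (Nat.factorial_ne_zero _)
    have f4 : (l.factorial : ℂ) ≠ 0 := Nat.cast_ne_zero.mpr (Nat.factorial_ne_zero _)
    have f5 : ((i + l).factorial : ℂ) ≠ 0 := Nat.cast_ne_zero.mpr (Nat.factorial_ne_zero _)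
    rw [pow_add]
    generalize poch (-((j + (i + l) : ℕ) : ℂ)) j = g1
    generalize poch S j = g2
    generalize poch (S + j) i = g3
    generalize poch ((a : ℂ) + b + j) i = g4
    generalize poch ((a : ℂ) + b + (j + i : ℕ)) l = g5
    generalize poch ((a : ℂ) + c + j + i) l = g6
    generalize poch ((a : ℂ) + c + j - (S + j) - (a - b)) l = g7
    generalize poch ((b : ℂ) + α) j = g8
    generalize poch ((b : ℂ) - α) j = g9
    generalize poch ((a : ℂ) - b) i = g10
    generalize ((j + i).factorial : ℂ) = p1 at f1 ⊢
    generalize (j.factorial : ℂ) = p2 at f2 ⊢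
    generalize (i.factorial : ℂ) = p3 at f3 ⊢
    generalize (l.factorial : ℂ) = p4 at f4 ⊢
    generalize ((i + l).factorial : ℂ) = p5 at f5 ⊢
    generalize ((-1 : ℂ)) ^ i = q1
    generalize ((-1 : ℂ)) ^ l = q2
    have h1 : p1 * p1⁻¹ = 1 := mul_inv_cancel₀ f1
    simp only [div_eq_mul_inv, mul_inv]
    refine Eq.trans (b := (g1 * g2 * g8 * g9 * p2⁻¹ * (g4 * g5) * (q1 * q2) *
      (p5 * (p3⁻¹ * p4⁻¹) * (g3 * g10 * g6 * g7))) * (p1 * p1⁻¹)) ?_ ?_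
    · ring
    · rw [h1, mul_one]
  rw [Finset.sum_congr rfl hsum, ← Finset.mul_sum, hv, ← hr]
  ring

theorem wilsonP_swap_two_three (n : ℕ) (a b c d : ℝ) (α : ℂ) :
    wilsonP n a b c d α = wilsonP n a c b d α := by
  unfold wilsonP
  refine Finset.sum_congr rfl fun k _ => ?_
  rw [show (n : ℂ) + a + b + c + d - 1 = n + a + c + b + d - 1 by ring]
  ring

theorem wilsonP_swap_one_three (n : ℕ) (a b c d : ℝ) (α : ℂ) :
    wilsonP n a b c d α = wilsonP n c b a d α := by
  rw [wilsonP_swap_two_three, wilsonP_swap, wilsonP_swap_two_three]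

/-! ### The Gauss hypergeometric series and its contiguous relations -/

section Series

/-- The coefficients of the Gauss hypergeometric series. -/
noncomputable def hcoef (a b c : ℂ) (m : ℕ) : ℂ :=
  poch a m * poch b m / (poch c m * (m.factorial : ℂ))

/-- The Gauss hypergeometric series. -/
noncomputable def hF (a b c t : ℂ) : ℂ := ∑' m : ℕ, hcoef a b c m * t ^ m

theorem poch_ne_zero_of_field {K : Type*} [Field K] {x : K} {n : ℕ} (h : ∀ k : ℕ, x ≠ -k) :
    poch x n ≠ 0 := by
  induction n with
  | zero => simp
  | succ m ih =>
    rw [poch_succ]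
    exact mul_ne_zero ih fun h0 => h m (eq_neg_of_add_eq_zero_left h0)

theorem ordinaryHypergeometric_eq_hF (a b c t : ℂ) : ₂F₁ a b c t = hF a b c t := by
  rw [ordinaryHypergeometric_eq_tsum, hF]
  refine tsum_congr fun m => ?_
  simp only [hcoef, poch, smul_eq_mul, div_eq_mul_inv, mul_inv]
  ring

theorem hcoef_succ {a b c : ℂ} (hc : ∀ k : ℕ, c ≠ -k) (m : ℕ) :
    hcoef a b c (m + 1) = hcoef a b c m * ((a + m) * (b + m) / ((c + m) * (m + 1))) := by
  have h1 : poch c m ≠ 0 := poch_ne_zero_of_field hc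
  have h2 : c + m ≠ 0 := fun h => hc m (eq_neg_of_add_eq_zero_left h)
  have h3 : (m.factorial : ℂ) ≠ 0 := Nat.cast_ne_zero.mpr m.factorial_ne_zero
  have h4 : (m : ℂ) + 1 ≠ 0 := by exact_mod_cast m.succ_ne_zero
  simp only [hcoef, poch_succ, Nat.factorial_succ]
  push_cast
  field_simp

@[simp] theorem hcoef_zero (a b c : ℂ) : hcoef a b c 0 = 1 := by simp [hcoef]

/-- Ratio test: the quotient of consecutive coefficients tends to `1`. -/
theorem summable_norm_hcoef {a b c : ℂ} (hc : ∀ k : ℕ, c ≠ -k) {r : ℝ} (h0 : 0 ≤ r) (h1 : r < 1) :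
    Summable fun m => ‖hcoef a b c m‖ * r ^ m := by
  obtain ⟨r', hr, hr'⟩ := exists_between h1
  have hlim : Tendsto (fun m : ℕ => ‖(a + m) * (b + m) / ((c + m) * (m + 1))‖ * r) atTop (𝓝 r) := by
    have l1 := tendsto_add_mul_div_add_mul_atTop_nhds a c 1 (one_ne_zero (α := ℂ))
    have l2 := tendsto_add_mul_div_add_mul_atTop_nhds b 1 1 (one_ne_zero (α := ℂ))
    have := ((l1.mul l2).norm.mul_const r)
    simp only [div_one, mul_one, norm_one, one_mul] at this
    refine this.congr fun m => ?_
    rw [div_mul_div_comm, add_comm (m : ℂ) 1]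
  have hev := hlim.eventually_le_const hr
  refine summable_of_ratio_norm_eventually_le hr' (hev.mono fun m hm => ?_)
  rw [Real.norm_of_nonneg (by positivity), Real.norm_of_nonneg (by positivity), hcoef_succ hc,
    norm_mul, pow_succ]
  calc _ = (‖(a + m) * (b + m) / ((c + m) * (m + 1))‖ * r) * (‖hcoef a b c m‖ * r ^ m) := by
        generalize ‖(a + m) * (b + m) / ((c + m) * (m + 1))‖ = q
        ring
    _ ≤ _ := mul_le_mul_of_nonneg_right hm (by positivity)

theorem hasSum_of_eq {f g : ℕ → ℂ} {s : ℂ} (h : HasSum f s) (e : ∀ m, g m = f m) : HasSum g s := by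
  rwa [funext e]

theorem summable_powerSeries {f : ℕ → ℂ} (hf : ∀ r : ℝ, 0 ≤ r → r < 1 → Summable fun m => ‖f m‖ * r ^ m)
    {t : ℂ} (ht : ‖t‖ < 1) : Summable fun m => f m * t ^ m :=
  Summable.of_norm (by simpa using hf ‖t‖ (norm_nonneg _) ht)

theorem hasDerivAt_powerSeries {f : ℕ → ℂ}
    (hf : ∀ r : ℝ, 0 ≤ r → r < 1 → Summable fun m => ‖f m‖ * r ^ m) {t : ℂ} (ht : ‖t‖ < 1) :
    HasSum (fun m : ℕ => ((m : ℂ) + 1) * f (m + 1) * t ^ m)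
        (deriv (fun z => ∑' m, f m * z ^ m) t) ∧
      HasDerivAt (fun z => ∑' m, f m * z ^ m) (deriv (fun z => ∑' m, f m * z ^ m) t) t := by
  obtain ⟨r, hr, hr1⟩ := exists_between ht
  obtain ⟨s, hs, hs1⟩ := exists_between hr1
  have hr0 : 0 < r := lt_of_le_of_lt (norm_nonneg _) hr
  have hs0 : 0 < s := hr0.trans hs
  have hu : Summable fun m : ℕ => ‖f m‖ * (m * r ^ (m - 1)) := by
    have hq : ‖r / s‖ < 1 := by
      rw [Real.norm_eq_abs, abs_of_pos (div_pos hr0 hs0), div_lt_one hs0]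
      exact hs
    have hb := (summable_pow_mul_geometric_of_norm_lt_one 1 hq).tendsto_atTop_zero.bddAbove_range
    obtain ⟨C, hC⟩ := hb
    refine Summable.of_nonneg_of_le (fun m => by positivity) (fun m => ?_)
      ((hf s hs0.le hs1).mul_left (C / r))
    have := hC ⟨m, rfl⟩
    simp only [pow_one, div_pow] at this
    -- With `r < s < 1` the sequence `m (r/s)^m` is bounded by `C`, so the factor `m` from
    -- differentiation is absorbed by passing from `r` to `s`.
    have h1 : (m : ℝ) * r ^ (m - 1) ≤ C / r * s ^ m := by
      rcases m with _ | m
      · simp only [Nat.cast_zero, zero_mul, pow_zero, mul_one] at this ⊢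
        positivity
      · rw [Nat.add_sub_cancel, div_mul_eq_mul_div, le_div_iff₀ hr0, mul_assoc, ← pow_succ]
        rw [mul_div_assoc', div_le_iff₀ (by positivity)] at this
        exact this
    calc _ ≤ ‖f m‖ * (C / r * s ^ m) := by gcongr
      _ = _ := by ring
  have hd := hasDerivAt_tsum_of_isPreconnected (g := fun m z => f m * z ^ m)
    (g' := fun m z => f m * (m * z ^ (m - 1))) (y := t) (y₀ := 0) hu Metric.isOpen_ball
    (convex_ball (0 : ℂ) r).isPreconnected
    (fun m y _ => (hasDerivAt_pow m y).const_mul _) (fun m y hy => by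
      have : ‖y‖ ≤ r := by simpa using (Metric.mem_ball.mp hy).le
      rw [norm_mul, norm_mul, norm_pow, Complex.norm_natCast]
      gcongr) (by simpa using hr0)
    (summable_powerSeries hf (by simp)) (by simpa using hr)
  rw [hd.deriv]
  refine ⟨?_, hd⟩
  have hs' : Summable fun m : ℕ => f m * (m * t ^ (m - 1)) := by
    refine Summable.of_norm (Summable.of_nonneg_of_le (fun m => norm_nonneg _) (fun m => ?_) hu)
    rw [norm_mul, norm_mul, norm_pow, Complex.norm_natCast]
    gcongr
  have := (hasSum_nat_add_iff' 1).mpr hs'.hasSum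
  simp only [Finset.range_one, Finset.sum_singleton, Nat.cast_zero, zero_mul, mul_zero, sub_zero]
    at this
  refine hasSum_of_eq this fun m => ?_
  rw [Nat.add_sub_cancel, mul_comm ((m : ℂ) + 1), mul_assoc, Nat.cast_add, Nat.cast_one]

/-- Multiplying the derivative of a power series by the variable. -/
theorem hasSum_mul_deriv {f : ℕ → ℂ} {t D : ℂ}
    (h : HasSum (fun m : ℕ => ((m : ℂ) + 1) * f (m + 1) * t ^ m) D) :
    HasSum (fun m : ℕ => (m : ℂ) * f m * t ^ m) (t * D) := by
  rw [← hasSum_nat_add_iff' 1]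
  simp only [Finset.range_one, Finset.sum_singleton, Nat.cast_zero, zero_mul, sub_zero]
  refine hasSum_of_eq (h.mul_left t) fun m => ?_
  push_cast
  ring

variable {a b c : ℂ}

theorem hasSum_hF (hc : ∀ k : ℕ, c ≠ -k) {t : ℂ} (ht : ‖t‖ < 1) :
    HasSum (fun m => hcoef a b c m * t ^ m) (hF a b c t) :=
  (summable_powerSeries (fun _ h0 h1 => summable_norm_hcoef hc h0 h1) ht).hasSum

theorem hasDerivAt_hF (hc : ∀ k : ℕ, c ≠ -k) {t : ℂ} (ht : ‖t‖ < 1) :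
    HasDerivAt (hF a b c) (deriv (hF a b c) t) t :=
  (hasDerivAt_powerSeries (fun _ h0 h1 => summable_norm_hcoef hc h0 h1) ht).2

theorem hasSum_deriv_hF (hc : ∀ k : ℕ, c ≠ -k) {t : ℂ} (ht : ‖t‖ < 1) :
    HasSum (fun m : ℕ => ((m : ℂ) + 1) * hcoef a b c (m + 1) * t ^ m) (deriv (hF a b c) t) :=
  (hasDerivAt_powerSeries (fun _ h0 h1 => summable_norm_hcoef hc h0 h1) ht).1

theorem hF_zero (a b c : ℂ) : hF a b c 0 = 1 := by
  rw [hF, tsum_eq_single 0 (fun m hm => by simp [hm])]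
  simp

theorem hcoef_c_add_one (hc : ∀ k : ℕ, c ≠ -k) (m : ℕ) :
    hcoef a b (c + 1) m * (c + m) = hcoef a b c m * c := by
  have h1 : poch c m ≠ 0 := poch_ne_zero_of_field hc
  have h1' : poch (c + 1) m ≠ 0 := poch_ne_zero_of_field fun k h => hc (k + 1) (by
    push_cast; linear_combination h)
  have h3 : (m.factorial : ℂ) ≠ 0 := Nat.cast_ne_zero.mpr m.factorial_ne_zero
  have h5 : poch c m * (c + m) = c * poch (c + 1) m := by rw [← poch_succ, poch_succ_left]
  simp only [hcoef]
  field_simp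
  linear_combination poch a m * poch b m * h5

theorem hcoef_a_add_one (m : ℕ) :
    a * hcoef (a + 1) b c m = (a + m) * hcoef a b c m := by
  have h5 : poch a m * (a + m) = a * poch (a + 1) m := by rw [← poch_succ, poch_succ_left]
  simp only [hcoef]
  linear_combination -(poch b m / (poch c m * (m.factorial : ℂ))) * h5

theorem add_one_ne_neg (hc : ∀ k : ℕ, c ≠ -k) (k : ℕ) : c + 1 ≠ -k := fun h =>
  hc (k + 1) (by push_cast; linear_combination h)

/-- `(1-t) F'(a,b;c) = (a+b-c) F(a,b;c) + (c-a)(c-b)/c F(a,b;c+1)`. -/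
theorem one_sub_mul_deriv_hF (hc : ∀ k : ℕ, c ≠ -k) {t : ℂ} (ht : ‖t‖ < 1) :
    (1 - t) * deriv (hF a b c) t
      = (a + b - c) * hF a b c t + (c - a) * (c - b) / c * hF a b (c + 1) t := by
  have h1 := hasSum_deriv_hF (a := a) (b := b) hc ht
  have h2 := hasSum_mul_deriv h1
  have h3 := (hasSum_hF (a := a) (b := b) hc ht).mul_left (a + b - c)
  have h4 := (hasSum_hF (a := a) (b := b) (add_one_ne_neg hc) ht).mul_left ((c - a) * (c - b) / c)
  have h5 := h1.sub h2
  have h6 := h3.add h4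
  rw [show (1 - t) * deriv (hF a b c) t = deriv (hF a b c) t - t * deriv (hF a b c) t by ring]
  refine h5.unique (hasSum_of_eq h6 fun m => ?_)
  have hc0 : c ≠ 0 := by simpa using hc 0
  have hcm : c + m ≠ 0 := fun h => hc m (eq_neg_of_add_eq_zero_left h)
  have h7 : hcoef a b (c + 1) m = hcoef a b c m * c / (c + m) := by
    rw [eq_div_iff hcm, hcoef_c_add_one hc]
  have h8 : (m : ℂ) + 1 ≠ 0 := by exact_mod_cast m.succ_ne_zero
  rw [h7, hcoef_succ hc]
  field_simp
  ring

/-- `F'(a,b;c) = (a b / c) F(a+1,b+1;c+1)`. -/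
theorem deriv_hF (hc : ∀ k : ℕ, c ≠ -k) {t : ℂ} (ht : ‖t‖ < 1) :
    deriv (hF a b c) t = a * b / c * hF (a + 1) (b + 1) (c + 1) t := by
  have h1 := hasSum_deriv_hF (a := a) (b := b) hc ht
  have h2 := (hasSum_hF (a := a + 1) (b := b + 1) (add_one_ne_neg hc) ht).mul_left (a * b / c)
  refine h1.unique (hasSum_of_eq h2 fun m => ?_)
  have hc0 : c ≠ 0 := by simpa using hc 0
  have h1 : poch (c + 1) m ≠ 0 := poch_ne_zero_of_field (add_one_ne_neg hc)
  have h3 : (m.factorial : ℂ) ≠ 0 := Nat.cast_ne_zero.mpr m.factorial_ne_zero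
  have h8 : (m : ℂ) + 1 ≠ 0 := by exact_mod_cast m.succ_ne_zero
  simp only [hcoef, poch_succ_left, Nat.factorial_succ]
  push_cast
  field_simp

/-- `(1-t) F'(a,b;c) = a F(a,b;c) - a(c-b)/c F(a+1,b;c+1)`. -/
theorem one_sub_mul_deriv_hF' (hc : ∀ k : ℕ, c ≠ -k) {t : ℂ} (ht : ‖t‖ < 1) :
    (1 - t) * deriv (hF a b c) t
      = a * hF a b c t - a * (c - b) / c * hF (a + 1) b (c + 1) t := by
  have h1 := hasSum_deriv_hF (a := a) (b := b) hc ht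
  have h2 := hasSum_mul_deriv h1
  have h3 := (hasSum_hF (a := a) (b := b) hc ht).mul_left a
  have h4 := (hasSum_hF (a := a + 1) (b := b) (add_one_ne_neg hc) ht).mul_left (a * (c - b) / c)
  have h5 := h1.sub h2
  have h6 := h3.sub h4
  rw [show (1 - t) * deriv (hF a b c) t = deriv (hF a b c) t - t * deriv (hF a b c) t by ring]
  refine h5.unique (hasSum_of_eq h6 fun m => ?_)
  have hc0 : c ≠ 0 := by simpa using hc 0
  have hcm : c + m ≠ 0 := fun h => hc m (eq_neg_of_add_eq_zero_left h)
  have h7 : a * hcoef (a + 1) b (c + 1) m = (a + m) * (hcoef a b c m * c / (c + m)) := by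
    rw [hcoef_a_add_one]
    congr 1
    rw [eq_div_iff hcm, hcoef_c_add_one hc]
  have h8 : (m : ℂ) + 1 ≠ 0 := by exact_mod_cast m.succ_ne_zero
  rw [show a * (c - b) / c * (hcoef (a + 1) b (c + 1) m * t ^ m)
    = (c - b) / c * (a * hcoef (a + 1) b (c + 1) m) * t ^ m by ring, h7, hcoef_succ hc]
  field_simp
  ring

/-- `t (1-t) F'(a+1,b;c+1) = c F(a,b;c) - (c-bt) F(a+1,b;c+1)`. -/
theorem mul_one_sub_mul_deriv_hF (hc : ∀ k : ℕ, c ≠ -k) {t : ℂ} (ht : ‖t‖ < 1) :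
    t * (1 - t) * deriv (hF (a + 1) b (c + 1)) t
      = c * hF a b c t - (c - b * t) * hF (a + 1) b (c + 1) t := by
  set g := hcoef (a + 1) b (c + 1) with hg
  have h1 := hasSum_mul_deriv (hasSum_deriv_hF (a := a + 1) (b := b) (add_one_ne_neg hc) ht)
  have h2 := hasSum_hF (a := a + 1) (b := b) (add_one_ne_neg hc) ht
  have h3 := (hasSum_hF (a := a) (b := b) hc ht).mul_left c
  have h4 := (h1.add (h2.mul_left c)).sub h3
  have h5 := (h1.add (h2.mul_left b)).mul_left t
  have h6 := (hasSum_nat_add_iff' 1).mpr h4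
  simp only [Finset.range_one, Finset.sum_singleton] at h6
  have h7 := h6.unique (hasSum_of_eq h5 ?_)
  · simp only [hcoef_zero, Nat.cast_zero] at h7
    linear_combination h7
  · intro m
    have hcm : c + (m + 1) ≠ 0 := fun h => hc (m + 1) (by
      push_cast; exact eq_neg_of_add_eq_zero_left h)
    have h8 : (m : ℂ) + 1 ≠ 0 := by exact_mod_cast m.succ_ne_zero
    have h1 : poch (c + 1) m ≠ 0 := poch_ne_zero_of_field (add_one_ne_neg hc)
    have h3 : (m.factorial : ℂ) ≠ 0 := Nat.cast_ne_zero.mpr m.factorial_ne_zero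
    have hcm' : c + 1 + m ≠ 0 := by rwa [add_assoc, add_comm (1 : ℂ)]
    have hc0 : c ≠ 0 := by simpa using hc 0
    have e1 : hcoef (a + 1) b (c + 1) (m + 1)
        = hcoef (a + 1) b (c + 1) m * ((a + 1 + m) * (b + m) / ((c + 1 + m) * (m + 1))) :=
      hcoef_succ (add_one_ne_neg hc) m
    have e2 : c * hcoef a b c (m + 1)
        = hcoef (a + 1) b (c + 1) m * (a * (b + m) / (m + 1)) := by
      simp only [hcoef, poch_succ_left, Nat.factorial_succ]
      rw [show b * poch (b + 1) m = poch b m * (b + m) by rw [← poch_succ_left, poch_succ]]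
      push_cast
      field_simp
    push_cast
    rw [show c * (hcoef a b c (m + 1) * t ^ (m + 1)) = (c * hcoef a b c (m + 1)) * t ^ (m + 1) by ring,
      e1, e2, pow_succ]
    field_simp
    ring

end Series

/-! ### The Jacobi function: symmetry, derivatives, local bounds -/

section JacobiFunction

/-- The binomial series. -/
theorem hF_one_one (e : ℂ) {t : ℂ} (ht : ‖t‖ < 1) : hF e 1 1 t = (1 - t) ^ (-e) := by
  have h := (Complex.one_div_one_sub_cpow_hasFPowerSeriesOnBall_zero e).hasSum (y := t)
    (by rw [mem_eball_zero_iff, ← ofReal_norm]; exact ENNReal.ofReal_lt_one.mpr ht)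
  have h2 : HasSum (fun m => hcoef e 1 1 m * t ^ m) ((1 - t) ^ (-e)) := by
    rw [zero_add, one_div, ← Complex.cpow_neg] at h
    refine hasSum_of_eq h fun m => ?_
    have hm : (m.factorial : ℂ) ≠ 0 := Nat.cast_ne_zero.mpr m.factorial_ne_zero
    have h1 : Ring.choose (e + m - 1) m = Ring.multichoose e m := by
      rw [Ring.choose]
      congr 1
      ring
    have h3 : (m.factorial : ℂ) * Ring.multichoose e m = poch e m := by
      have := Ring.factorial_nsmul_multichoose_eq_ascPochhammer e m
      rwa [Polynomial.ascPochhammer_smeval_eq_eval, nsmul_eq_mul] at this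
    have h4 : poch (1 : ℂ) m ≠ 0 := poch_ne_zero_of_field fun k hk => by
      have : ((1 + k : ℕ) : ℂ) = 0 := by push_cast; linear_combination hk
      rw [Nat.cast_eq_zero] at this
      omega
    rw [FormalMultilinearSeries.ofScalars_apply_eq, h1, smul_eq_mul, hcoef, ← h3]
    field_simp
  exact h2.tsum_eq

variable {a b c : ℂ}

/-- Euler's transformation. -/
theorem hF_euler (hc : ∀ k : ℕ, c ≠ -k) {t : ℂ} (ht : ‖t‖ < 1) :
    hF a b c t * (1 - t) ^ (-(c - a - b)) = hF (c - a) (c - b) c t := by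
  have h1 : ∀ k : ℕ, (1 : ℂ) ≠ -k := fun k hk => by
    have : ((1 + k : ℕ) : ℂ) = 0 := by push_cast; linear_combination hk
    rw [Nat.cast_eq_zero] at this
    omega
  have s1 : Summable fun m => ‖hcoef a b c m * t ^ m‖ := by
    simpa using summable_norm_hcoef (a := a) (b := b) hc (norm_nonneg t) ht
  have s2 : Summable fun m => ‖hcoef (c - a - b) 1 1 m * t ^ m‖ := by
    simpa using summable_norm_hcoef (a := c - a - b) (b := 1) h1 (norm_nonneg t) ht
  rw [← hF_one_one _ ht]
  simp only [hF]
  -- The coefficients of the Cauchy product are Saalschütz sums.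
  rw [tsum_mul_tsum_eq_tsum_sum_range_of_summable_norm s1 s2]
  refine tsum_congr fun m => ?_
  have hS := poch_saalschuetz a b c m
  have hm : (m.factorial : ℂ) ≠ 0 := Nat.cast_ne_zero.mpr m.factorial_ne_zero
  have hcm : poch c m ≠ 0 := poch_ne_zero_of_field hc
  have : hcoef (c - a) (c - b) c m = ∑ k ∈ Finset.range (m + 1),
      hcoef a b c k * hcoef (c - a - b) 1 1 (m - k) := by
    rw [hcoef, ← hS, Finset.sum_div]
    refine Finset.sum_congr rfl fun k hk => ?_
    have hk' : k ≤ m := by have := Finset.mem_range.mp hk; omega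
    obtain ⟨l, rfl⟩ := Nat.exists_eq_add_of_le hk'
    have hck : poch c k ≠ 0 := poch_ne_zero_of_field hc
    have h1l : poch (1 : ℂ) l ≠ 0 := poch_ne_zero_of_field h1
    have hckl : poch (c + k) l ≠ 0 := by
      intro h0
      rw [poch_add, h0, mul_zero] at hcm
      exact hcm rfl
    have f1 : (k.factorial : ℂ) ≠ 0 := Nat.cast_ne_zero.mpr (Nat.factorial_ne_zero _)
    have f2 : (l.factorial : ℂ) ≠ 0 := Nat.cast_ne_zero.mpr (Nat.factorial_ne_zero _)
    rw [Nat.cast_choose ℂ hk', Nat.add_sub_cancel_left, poch_add]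
    simp only [hcoef]
    field_simp
  rw [this, Finset.sum_mul]
  refine Finset.sum_congr rfl fun k hk => ?_
  have hk' : k ≤ m := by have := Finset.mem_range.mp hk; omega
  obtain ⟨l, rfl⟩ := Nat.exists_eq_add_of_le hk'
  rw [Nat.add_sub_cancel_left, pow_add]
  ring

/-- The Jacobi function in the variable `t = 1 - x`, with `u + v = 1 + p`, `u - v = q`. -/
noncomputable def th (u v t : ℝ) (α : ℂ) : ℂ :=
  (1 - (t : ℂ)) ^ ((u : ℂ) + α) * hF (u + α) (v + α) (u + v) t

theorem norm_ofReal_lt_one {t : ℝ} (h0 : 0 ≤ t) (h1 : t < 1) : ‖(t : ℂ)‖ < 1 := by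
  rwa [Complex.norm_of_nonneg h0]

theorem one_sub_ofReal_ne_zero {t : ℝ} (h1 : t < 1) : 1 - (t : ℂ) ≠ 0 := by
  rw [← Complex.ofReal_one, ← Complex.ofReal_sub, Complex.ofReal_ne_zero]
  linarith

/-- For `z = (x-1)/x` one has `1 - z = 1/x` and `z/(z-1) = 1 - x`, so Pfaff's form of the
continuation is already a convergent series in `t = 1 - x`. -/
theorem jacobiFun_eq_th (p q : ℝ) (α : ℂ) {x : ℝ} (hx : 0 < x) :
    jacobiFun p q α x = th ((1 + p + q) / 2) ((1 + p - q) / 2) (1 - x) α := by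
  have hx' : (x : ℂ) ≠ 0 := Complex.ofReal_ne_zero.mpr hx.ne'
  rw [jacobiFun, hyp, th, ordinaryHypergeometric_eq_hF]
  have e1 : (1 - (((x - 1) / x : ℝ) : ℂ)) = ((x⁻¹ : ℝ) : ℂ) := by
    push_cast
    field_simp
    ring
  have e2 : (((x - 1) / x : ℝ) : ℂ) / ((((x - 1) / x : ℝ) : ℂ) - 1) = ((1 - x : ℝ) : ℂ) := by
    rw [show ((((x - 1) / x : ℝ) : ℂ) - 1) = -((x⁻¹ : ℝ) : ℂ) by rw [← e1]; ring]
    push_cast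
    field_simp
    ring
  have e3 : ((x⁻¹ : ℝ) : ℂ) ^ (-((1 + (p : ℂ) + q) / 2 + α))
      = (1 - ((1 - x : ℝ) : ℂ)) ^ ((((1 + p + q) / 2 : ℝ) : ℂ) + α) := by
    rw [Complex.ofReal_inv, Complex.inv_cpow _ _ (by
      rw [Complex.arg_ofReal_of_nonneg hx.le]; exact Real.pi_pos.ne), ← Complex.cpow_neg, neg_neg]
    push_cast
    congr 1
    ring
  rw [e2, e1, e3]
  congr 2 <;> push_cast <;> ring

variable {u v : ℝ}

theorem th_zero (α : ℂ) : th u v 0 α = 1 := by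
  simp [th, hF_zero]

/-- Euler's transformation exchanges `α` and `-α`. Evenness in `α` is what makes left and right
poles contribute equally later. -/
theorem th_neg (hc : ∀ k : ℕ, u + v ≠ -k) {t : ℝ} (h0 : 0 ≤ t) (h1 : t < 1) (α : ℂ) :
    th u v t (-α) = th u v t α := by
  have hc' : ∀ k : ℕ, (u : ℂ) + v ≠ -k := fun k hk => hc k (by exact_mod_cast hk)
  have h := hF_euler (a := u + α) (b := v + α) hc' (norm_ofReal_lt_one h0 h1)
  have e1 : (u : ℂ) + v - (u + α) = v + -α := by ring
  have e2 : (u : ℂ) + v - (v + α) = u + -α := by ring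
  have e3 : -((v : ℂ) + -α - (v + α)) = 2 * α := by ring
  rw [e1, e2, e3] at h
  have hsymm : hF (u + -α) (v + -α) (u + v) t = hF (v + -α) (u + -α) (u + v) t := by
    simp only [hF, hcoef]
    exact tsum_congr fun m => by rw [mul_comm (poch _ m)]
  have hp : (1 - (t : ℂ)) ^ ((u : ℂ) + α) = (1 - (t : ℂ)) ^ ((u : ℂ) + -α) * (1 - (t : ℂ)) ^ (2 * α) := by
    rw [← Complex.cpow_add _ _ (one_sub_ofReal_ne_zero h1)]
    ring_nf
  rw [th, th, hsymm, ← h, hp]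
  ring

theorem hasDerivAt_one_sub_cpow (a : ℂ) {t : ℝ} (h1 : t < 1) :
    HasDerivAt (fun t : ℝ => (1 - (t : ℂ)) ^ a) (-a * (1 - (t : ℂ)) ^ (a - 1)) t := by
  have h : HasDerivAt (fun z : ℂ => (1 - z) ^ a) (-a * (1 - (t : ℂ)) ^ (a - 1)) (t : ℂ) := by
    have h2 : HasDerivAt (fun z : ℂ => 1 - z) (-1) (t : ℂ) := by
      simpa using (hasDerivAt_id (t : ℂ)).const_sub 1
    have := h2.cpow_const (c := a) (by
      rw [← Complex.ofReal_one, ← Complex.ofReal_sub]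
      exact Complex.ofReal_mem_slitPlane.mpr (by linarith))
    convert this using 1
    ring
  exact h.comp_ofReal

/-- With `hasDerivAt_th_add_one` this is a closed first-order system for the pair `th u v`, `th (u +
1) v`, a form of the hypergeometric equation. The energy estimate uses the system, and the present
formula alone lowers `u` by one in the growth bounds. -/
theorem hasDerivAt_th (hc : ∀ k : ℕ, u + v ≠ -k) {t : ℝ} (h0 : 0 ≤ t) (h1 : t < 1) (α : ℂ) :
    HasDerivAt (fun t => th u v t α)
      (-((u + α) * (u - α) / (u + v)) * ((1 - (t : ℂ)) ^ 2)⁻¹ * th (u + 1) v t α) t := by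
  have hc' : ∀ k : ℕ, (u : ℂ) + v ≠ -k := fun k hk => hc k (by exact_mod_cast hk)
  have ht := norm_ofReal_lt_one h0 h1
  have hne := one_sub_ofReal_ne_zero h1
  have h := (hasDerivAt_one_sub_cpow ((u : ℂ) + α) h1).mul
    (hasDerivAt_hF (a := u + α) (b := v + α) hc' ht).comp_ofReal
  refine HasDerivAt.congr_deriv h ?_
  have hd := one_sub_mul_deriv_hF' (a := u + α) (b := v + α) hc' ht
  have e1 : (u : ℂ) + v - (v + α) = u - α := by ring
  rw [e1] at hd
  have hc0 : (u : ℂ) + v ≠ 0 := by simpa using hc' 0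
  rw [th]
  symm
  have e2 : ((u + 1 : ℝ) : ℂ) + α = (u + α) - 1 + 1 + 1 := by push_cast; ring
  have e3 : ((u + 1 : ℝ) : ℂ) + α = u + α + 1 := by push_cast; ring
  have e4 : ((u + 1 : ℝ) : ℂ) + (v : ℂ) = u + v + 1 := by push_cast; ring
  have hp : (1 - (t : ℂ)) ^ (((u + 1 : ℝ) : ℂ) + α)
      = (1 - (t : ℂ)) ^ ((u : ℂ) + α - 1) * (1 - t) * (1 - t) := by
    rw [e2, Complex.cpow_add _ _ hne, Complex.cpow_add _ _ hne, Complex.cpow_one]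
  have hp2 : (1 - (t : ℂ)) ^ ((u : ℂ) + α) = (1 - (t : ℂ)) ^ ((u : ℂ) + α - 1) * (1 - t) := by
    conv_lhs => rw [show (u : ℂ) + α = u + α - 1 + 1 by ring]
    rw [Complex.cpow_add _ _ hne, Complex.cpow_one]
  rw [hp, hp2, e3, e4]
  generalize (1 - (t : ℂ)) ^ ((u : ℂ) + α - 1) = P at *
  have hd' : (1 - (t : ℂ)) * deriv (hF (u + α) (v + α) (u + v)) t * P
    = ((u + α) * hF (u + α) (v + α) (u + v) t - (u + α) * (u - α) / (u + v)
      * hF (u + α + 1) (v + α) (u + v + 1) t) * P := by rw [hd]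
  generalize hF (u + α + 1) (v + α) (u + v + 1) t = G at *
  have : -((u + α) * (u - α) / (u + v)) * ((1 - (t : ℂ)) ^ 2)⁻¹ * (P * (1 - t) * (1 - t) * G)
     = -((u + α) * (u - α) / (u + v)) * (P * G) := by field_simp
  rw [this]
  linear_combination -hd'

theorem hasDerivAt_th_add_one (hc : ∀ k : ℕ, u + v ≠ -k) {t : ℝ} (h0 : 0 < t) (h1 : t < 1) (α : ℂ) :
    HasDerivAt (fun t => th (u + 1) v t α)
      ((t : ℂ)⁻¹ * ((u + v) * th u v t α
        - (u + v + (u - v + 1) * t) * (1 - (t : ℂ))⁻¹ * th (u + 1) v t α)) t := by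
  have hc' : ∀ k : ℕ, (u : ℂ) + v ≠ -k := fun k hk => hc k (by exact_mod_cast hk)
  have ht := norm_ofReal_lt_one h0.le h1
  have hne := one_sub_ofReal_ne_zero h1
  have ht0 : (t : ℂ) ≠ 0 := Complex.ofReal_ne_zero.mpr h0.ne'
  have e3 : ((u + 1 : ℝ) : ℂ) + α = u + α + 1 := by push_cast; ring
  have e4 : ((u + 1 : ℝ) : ℂ) + (v : ℂ) = u + v + 1 := by push_cast; ring
  have h := (hasDerivAt_one_sub_cpow ((u : ℂ) + α + 1) h1).mul
    (hasDerivAt_hF (a := u + α + 1) (b := v + α) (add_one_ne_neg hc') ht).comp_ofReal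
  simp only [th, e3, e4]
  refine HasDerivAt.congr_deriv h ?_
  symm
  have hd := mul_one_sub_mul_deriv_hF (a := u + α) (b := v + α) hc' ht
  have hp2 : (1 - (t : ℂ)) ^ ((u : ℂ) + α + 1) = (1 - (t : ℂ)) ^ ((u : ℂ) + α) * (1 - t) := by
    rw [Complex.cpow_add _ _ hne, Complex.cpow_one]
  rw [hp2, add_sub_cancel_right]
  generalize (1 - (t : ℂ)) ^ ((u : ℂ) + α) = P at *
  have hd' := congrArg (fun z => z * P) hd
  generalize hF (u + α + 1) (v + α) (u + v + 1) t = G at *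
  generalize hF (u + α) (v + α) (u + v) t = F at *
  generalize deriv (hF (u + α + 1) (v + α) (u + v + 1)) t = G' at *
  field_simp
  linear_combination -hd'

theorem norm_poch_le {x : ℂ} {X : ℝ} (h : ‖x‖ ≤ X) (m : ℕ) : ‖poch x m‖ ≤ poch X m := by
  have hX : 0 ≤ X := (norm_nonneg x).trans h
  induction m with
  | zero => simp
  | succ m ih =>
    rw [poch_succ, poch_succ, norm_mul]
    refine mul_le_mul ih ?_ (norm_nonneg _) ((norm_nonneg _).trans ih)
    exact (norm_add_le _ _).trans (by rw [Complex.norm_natCast]; gcongr)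

/-- A majorant that depends only on bounds for the upper parameters, hence is uniform for `α` in a
disc. -/
theorem norm_hcoef_le {U V : ℝ} (ha : ‖a‖ ≤ U) (hb : ‖b‖ ≤ V) (m : ℕ) :
    ‖hcoef a b c m‖ ≤ ‖hcoef U V c m‖ := by
  have h1 := norm_poch_le ha m
  have h2 := norm_poch_le hb m
  have h1' : ‖poch (U : ℂ) m‖ = poch U m := by
    rw [← poch_ofReal, Complex.norm_of_nonneg ((norm_nonneg _).trans h1)]
  have h2' : ‖poch (V : ℂ) m‖ = poch V m := by
    rw [← poch_ofReal, Complex.norm_of_nonneg ((norm_nonneg _).trans h2)]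
  simp only [hcoef, norm_div, norm_mul, h1', h2']
  have := (norm_nonneg _).trans h1
  gcongr

theorem differentiable_poch_add (x : ℂ) (m : ℕ) : Differentiable ℂ fun α : ℂ => poch (x + α) m := by
  induction m with
  | zero => simp
  | succ m ih =>
    simp only [poch_succ]
    exact ih.mul (by fun_prop)

theorem norm_add_le_of_norm_le {w : ℝ} {α : ℂ} {R : ℝ} (h : ‖α‖ ≤ R) : ‖(w : ℂ) + α‖ ≤ |w| + R :=
  (norm_add_le _ _).trans (by rw [Complex.norm_real, Real.norm_eq_abs]; gcongr)

theorem differentiable_th (hc : ∀ k : ℕ, u + v ≠ -k) {t : ℝ} (h0 : 0 ≤ t) (h1 : t < 1) :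
    Differentiable ℂ (th u v t) := by
  have hc' : ∀ k : ℕ, (u : ℂ) + v ≠ -k := fun k hk => hc k (by exact_mod_cast hk)
  have hne := one_sub_ofReal_ne_zero h1
  have hF' : Differentiable ℂ fun α : ℂ => hF (u + α) (v + α) (u + v) t := by
    intro α₀
    refine (differentiableOn_tsum_of_summable_norm (U := Metric.ball 0 (‖α₀‖ + 1))
      (summable_norm_hcoef (a := ((|u| + (‖α₀‖ + 1) : ℝ) : ℂ))
        (b := ((|v| + (‖α₀‖ + 1) : ℝ) : ℂ)) hc' h0 h1) ?_ Metric.isOpen_ball ?_).differentiableAt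
        (Metric.isOpen_ball.mem_nhds (by simp))
    · intro m
      have := ((differentiable_poch_add (u : ℂ) m).mul (differentiable_poch_add (v : ℂ) m)).div_const
        (poch ((u : ℂ) + v) m * (m.factorial : ℂ))
      exact (this.mul_const _).differentiableOn
    · intro m α hα
      have hα' : ‖α‖ ≤ ‖α₀‖ + 1 := by simpa using (Metric.mem_ball.mp hα).le
      rw [norm_mul, norm_pow, Complex.norm_of_nonneg h0]
      gcongr
      exact norm_hcoef_le (norm_add_le_of_norm_le hα') (norm_add_le_of_norm_le hα') m
  have hpow : Differentiable ℂ fun α : ℂ => (1 - (t : ℂ)) ^ ((u : ℂ) + α) := fun α =>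
    (((hasDerivAt_id α).const_add (u : ℂ)).const_cpow (Or.inl hne)).differentiableAt
  exact hpow.mul hF'

theorem norm_th_le_of_norm_le (hc : ∀ k : ℕ, u + v ≠ -k) {t₀ : ℝ} (h0 : 0 ≤ t₀) (h1 : t₀ < 1)
    (R : ℝ) : ∃ C : ℝ, ∀ t ∈ Set.Icc 0 t₀, ∀ α : ℂ, ‖α‖ ≤ R → ‖th u v t α‖ ≤ C := by
  have hc' : ∀ k : ℕ, (u : ℂ) + v ≠ -k := fun k hk => hc k (by exact_mod_cast hk)
  refine ⟨(1 - t₀) ^ (-(|u| + R)) * ∑' m, ‖hcoef ((|u| + R : ℝ) : ℂ) ((|v| + R : ℝ) : ℂ) (u + v) m‖ * t₀ ^ m,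
    fun t ht α hα => ?_⟩
  have ht1 : t < 1 := ht.2.trans_lt h1
  rw [th, norm_mul]
  have hsum := summable_norm_hcoef (a := ((|u| + R : ℝ) : ℂ)) (b := ((|v| + R : ℝ) : ℂ)) hc' h0 h1
  have hle : ∀ m, ‖hcoef (u + α) (v + α) (u + v) m * (t : ℂ) ^ m‖
      ≤ ‖hcoef ((|u| + R : ℝ) : ℂ) ((|v| + R : ℝ) : ℂ) (u + v) m‖ * t₀ ^ m := fun m => by
    rw [norm_mul, norm_pow, Complex.norm_of_nonneg ht.1]
    have := ht.1
    have := ht.2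
    gcongr
    exact norm_hcoef_le (norm_add_le_of_norm_le hα) (norm_add_le_of_norm_le hα) m
  have hb : ‖hF (u + α) (v + α) (u + v) t‖
      ≤ ∑' m, ‖hcoef ((|u| + R : ℝ) : ℂ) ((|v| + R : ℝ) : ℂ) (u + v) m‖ * t₀ ^ m :=
    tsum_of_norm_bounded hsum.hasSum hle
  refine mul_le_mul ?_ hb (norm_nonneg _) (by have : 0 < 1 - t₀ := by linarith
                                              positivity)
  rw [← Complex.ofReal_one, ← Complex.ofReal_sub, Complex.norm_cpow_eq_rpow_re_of_pos (by linarith)]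
  have hre : -(|u| + R) ≤ ((u : ℂ) + α).re := by
    have := (abs_le.mp ((Complex.abs_re_le_norm _).trans (norm_add_le_of_norm_le (w := u) hα))).1
    exact this
  calc (1 - t) ^ ((u : ℂ) + α).re ≤ (1 - t) ^ (-(|u| + R)) :=
        Real.rpow_le_rpow_of_exponent_ge (by linarith) (by linarith [ht.1]) hre
    _ ≤ (1 - t₀) ^ (-(|u| + R)) := by
        refine Real.rpow_le_rpow_of_nonpos (by linarith) (by linarith [ht.2]) ?_
        have : 0 ≤ R := (norm_nonneg _).trans hα
        have := abs_nonneg u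
        linarith

end JacobiFunction

/-! ### Energy estimate for the hypergeometric equation -/

section Energy

theorem energy_cross_le {s h I m Z W : ℝ} (hm : 0 < m) (hI : 0 ≤ I) :
    4 * s * h * I * Z * W ≤ 2 * I / √m * (s ^ 2 * h ^ 2 * Z ^ 2 + m * W ^ 2) := by
  have hq : 0 < √m := Real.sqrt_pos.mpr hm
  have hm' : m = √m ^ 2 := (Real.sq_sqrt hm.le).symm
  have h1 : 2 * (s * h * Z) * (√m * W) ≤ s ^ 2 * h ^ 2 * Z ^ 2 + m * W ^ 2 := by
    nlinarith [sq_nonneg (s * h * Z - √m * W)]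
  calc 4 * s * h * I * Z * W = 2 * I / √m * (2 * (s * h * Z) * (√m * W)) := by
        field_simp
        ring
    _ ≤ _ := by gcongr

/-- Dissipation of the energy of the hypergeometric equation. -/
theorem energy_deriv_le {s h u v : ℝ} (hs : 0 < s) (hh : 0 < h) (hsh : h ^ 2 = 1 + s ^ 2)
    (hc : 1 / 2 ≤ u + v) (hu : 0 ≤ u) {k G W G' W' : ℂ} (hm : 0 < (k * (u + v : ℝ)).re)
    (hG' : G' = (2 / (s * h) : ℝ) * ((u + v : ℝ) * W
      - (((u + v) * h ^ 2 + (u - v + 1) * s ^ 2 : ℝ) : ℂ) * G))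
    (hW' : W' = -(2 * s * h : ℝ) * (k * G)) :
    ‖k‖ ^ 2 * (2 * s * h * (h ^ 2 + s ^ 2) * ‖G‖ ^ 2 + s ^ 2 * h ^ 2 * (2 * inner ℝ G G'))
        + (k * (u + v : ℝ)).re * (2 * inner ℝ W W')
      ≤ 2 * |(k * (u + v : ℝ)).im| / √((k * (u + v : ℝ)).re)
        * (‖k‖ ^ 2 * (s ^ 2 * h ^ 2 * ‖G‖ ^ 2) + (k * (u + v : ℝ)).re * ‖W‖ ^ 2) := by
  have h1 := energy_cross_le (s := s) (h := h) (Z := ‖k * G‖) (W := ‖W‖) hm (abs_nonneg (k * (u + v : ℝ)).im)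
  have h2 : -((k * (u + v : ℝ)).im * ((starRingEnd ℂ) (k * G) * W).im)
      ≤ |(k * (u + v : ℝ)).im| * (‖k * G‖ * ‖W‖) := by
    calc _ ≤ |(k * (u + v : ℝ)).im * ((starRingEnd ℂ) (k * G) * W).im| := neg_le_abs _
      _ ≤ _ := by
        rw [abs_mul]
        gcongr
        refine (Complex.abs_im_le_norm _).trans ?_
        rw [norm_mul, Complex.norm_conj]
  -- The derivative of the energy, exactly. The weights of `‖G‖²` and `‖W‖²` are such that the cross
  -- terms cancel except for one proportional to the imaginary part of `k (u + v)`.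
  have h3 : ‖k‖ ^ 2 * (2 * s * h * (h ^ 2 + s ^ 2) * ‖G‖ ^ 2 + s ^ 2 * h ^ 2 * (2 * inner ℝ G G'))
        + (k * (u + v : ℝ)).re * (2 * inner ℝ W W')
      = 2 * s * h * ‖k * G‖ ^ 2 * ((1 - 2 * (u + v)) - 4 * u * s ^ 2)
        + 4 * s * h * (-((k * (u + v : ℝ)).im * ((starRingEnd ℂ) (k * G) * W).im)) := by
    have e1 : s ^ 2 * h ^ 2 * (2 * inner ℝ G G') = 4 * (s * h) * (((u + v) * W
      - (((u + v) * h ^ 2 + (u - v + 1) * s ^ 2 : ℝ) : ℂ) * G) * (starRingEnd ℂ) G).re := by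
      have e2 : ∀ z : ℂ, (((2 / (s * h) : ℝ) : ℂ) * z * (starRingEnd ℂ) G).re
          = 2 / (s * h) * (z * (starRingEnd ℂ) G).re := fun z => by
        rw [mul_assoc, Complex.re_ofReal_mul]
      rw [hG', Complex.inner, e2, Complex.ofReal_add u v]
      field_simp
      ring
    rw [e1, hW', Complex.inner]
    simp only [Complex.sq_norm, Complex.normSq_apply, mul_re, mul_im, sub_re, sub_im,
      ofReal_re, ofReal_im, conj_re, conj_im, add_re, add_im, neg_re, neg_im, ofReal_add, ofReal_mul,
      ofReal_ofNat, re_ofNat, im_ofNat]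
    rw [hsh]
    ring
  rw [h3]
  -- The damping term; `u + v ≥ 1/2` and `u ≥ 0` give its sign.
  have h4 : 2 * s * h * ‖k * G‖ ^ 2 * ((1 - 2 * (u + v)) - 4 * u * s ^ 2) ≤ 0 := by
    refine mul_nonpos_of_nonneg_of_nonpos (by positivity) ?_
    nlinarith [mul_nonneg hu (sq_nonneg s)]
  have h5 : ‖k‖ ^ 2 * (s ^ 2 * h ^ 2 * ‖G‖ ^ 2) = s ^ 2 * h ^ 2 * ‖k * G‖ ^ 2 := by
    rw [norm_mul]; ring
  rw [h5]
  have h6 := mul_le_mul_of_nonneg_left h2 (show 0 ≤ 4 * s * h by positivity)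
  linarith

variable {u v : ℝ}

theorem hasDerivAt_tanhSq (x : ℝ) : HasDerivAt (fun x => (Real.sinh x / Real.cosh x) ^ 2)
    (2 * Real.sinh x / Real.cosh x ^ 3) x := by
  have hh := (Real.cosh_pos x).ne'
  have := ((Real.hasDerivAt_sinh x).div (Real.hasDerivAt_cosh x) hh).pow 2
  refine this.congr_deriv ?_
  have := Real.cosh_sq x
  simp only [Nat.cast_ofNat, Nat.add_one_sub_one, pow_one, Pi.div_apply]
  field_simp
  linear_combination Real.sinh x * this

theorem tanhSq_lt_one (x : ℝ) : (Real.sinh x / Real.cosh x) ^ 2 < 1 := by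
  have hh := Real.cosh_pos x
  rw [div_pow, div_lt_one (by positivity), Real.cosh_sq]
  linarith

/-- Grönwall's argument for the energy of the pair `th u v`, `th (u + 1) v` along `t = tanh² x`. The
growth rate involves only `Im (u+α)(u-α)` relative to the square root of its real part, so it stays
bounded as `α` goes to infinity in a vertical strip. -/
theorem norm_th_tanhSq_le (hc : 1 / 2 ≤ u + v) (hu : 0 ≤ u) {α : ℂ}
    (hm : 0 < ((u + α) * (u - α)).re) {x : ℝ} (hx : 0 ≤ x) :
    ‖th u v ((Real.sinh x / Real.cosh x) ^ 2) α‖ ^ 2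
      ≤ Real.exp (2 * |((u + α) * (u - α)).im| / √(((u + α) * (u - α)).re) * x) := by
  have hcne : ∀ k : ℕ, u + v ≠ -k := fun k hk => by
    have : (0 : ℝ) ≤ k := k.cast_nonneg
    linarith
  have hc0 : ((u + v : ℝ) : ℂ) ≠ 0 := Complex.ofReal_ne_zero.mpr (by linarith)
  set k : ℂ := (u + α) * (u - α) / ((u + v : ℝ) : ℂ) with hk
  have hkc : k * ((u + v : ℝ) : ℂ) = (u + α) * (u - α) := by rw [hk]; field_simp
  rw [← hkc] at hm ⊢
  set m := (k * ((u + v : ℝ) : ℂ)).re with hmdef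
  set κ := 2 * |(k * ((u + v : ℝ) : ℂ)).im| / √m with hκ
  set T : ℝ → ℝ := fun x => (Real.sinh x / Real.cosh x) ^ 2 with hT
  set W : ℝ → ℂ := fun x => th u v (T x) α with hW
  set G : ℝ → ℂ := fun x => th (u + 1) v (T x) α with hG
  set E : ℝ → ℝ := fun x => ‖k‖ ^ 2 * (Real.sinh x ^ 2 * Real.cosh x ^ 2 * ‖G x‖ ^ 2)
    + m * ‖W x‖ ^ 2 with hE
  have hT1 : ∀ x : ℝ, (1 - ((T x : ℝ) : ℂ)) = ((1 / Real.cosh x ^ 2 : ℝ) : ℂ) := fun x => by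
    rw [← Complex.ofReal_one, ← Complex.ofReal_sub]
    congr 1
    have hh := (Real.cosh_pos x).ne'
    simp only [hT]
    field_simp
    rw [Real.cosh_sq]
    ring
  have dW : ∀ x : ℝ, 0 ≤ x → HasDerivAt W (-(2 * Real.sinh x * Real.cosh x : ℝ) * (k * G x)) x := by
    intro x hx
    have h := (hasDerivAt_th hcne (sq_nonneg _) (tanhSq_lt_one x) α).scomp x (hasDerivAt_tanhSq x)
    refine HasDerivAt.congr_deriv h ?_
    have hh := Complex.ofReal_ne_zero.mpr (Real.cosh_pos x).ne'
    have e := hT1 x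
    simp only [hT] at e
    rw [e]
    simp only [hG, hT, hk, Complex.real_smul]
    push_cast at hc0 ⊢
    field_simp
  have dG : ∀ x : ℝ, 0 < x → HasDerivAt G ((2 / (Real.sinh x * Real.cosh x) : ℝ) * (((u + v : ℝ) : ℂ) * W x
      - (((u + v) * Real.cosh x ^ 2 + (u - v + 1) * Real.sinh x ^ 2 : ℝ) : ℂ) * G x)) x := by
    intro x hx
    have hs0 := Real.sinh_pos_iff.mpr hx
    have hh0 := Real.cosh_pos x
    have h := (hasDerivAt_th_add_one hcne (t := T x) (by simp only [hT]; positivity)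
      (tanhSq_lt_one x) α).scomp x (hasDerivAt_tanhSq x)
    refine HasDerivAt.congr_deriv h ?_
    have hh := Complex.ofReal_ne_zero.mpr hh0.ne'
    have hs := Complex.ofReal_ne_zero.mpr hs0.ne'
    rw [hT1 x]
    simp only [hG, hW, Complex.real_smul]
    generalize th u v (T x) α = w
    generalize th (u + 1) v (T x) α = g
    simp only [hT]
    push_cast at hh hs ⊢
    field_simp
  have dE : ∀ x : ℝ, 0 < x → HasDerivAt E (‖k‖ ^ 2 * (2 * Real.sinh x * Real.cosh x
      * (Real.cosh x ^ 2 + Real.sinh x ^ 2) * ‖G x‖ ^ 2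
        + Real.sinh x ^ 2 * Real.cosh x ^ 2 * (2 * inner ℝ (G x) (deriv G x)))
        + m * (2 * inner ℝ (W x) (deriv W x))) x := by
    intro x hx
    have h1 := (dG x hx).differentiableAt.hasDerivAt.norm_sq
    have h2 := (dW x hx.le).differentiableAt.hasDerivAt.norm_sq
    have h3 := ((Real.hasDerivAt_sinh x).pow 2).mul ((Real.hasDerivAt_cosh x).pow 2)
    have h4 := ((h3.mul h1).const_mul (‖k‖ ^ 2)).add (h2.const_mul m)
    refine HasDerivAt.congr_deriv h4 ?_
    simp only [Pi.mul_apply, Pi.pow_apply, Nat.cast_ofNat, Nat.add_one_sub_one, pow_one]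
    ring
  have hEle : ∀ x : ℝ, 0 < x → deriv E x ≤ κ * E x := by
    intro x hx
    rw [(dE x hx).deriv, (dG x hx).deriv, (dW x hx.le).deriv]
    exact energy_deriv_le (Real.sinh_pos_iff.mpr hx) (Real.cosh_pos x)
      (by rw [Real.cosh_sq]; ring) hc hu hm rfl rfl
  have hGc : ∀ x : ℝ, 0 ≤ x → ContinuousAt G x := by
    intro x hx
    have hcne' : ∀ k : ℕ, (u + 1) + v ≠ -k := fun k hk => by
      have : (0 : ℝ) ≤ k := k.cast_nonneg
      linarith
    exact ((hasDerivAt_th hcne' (sq_nonneg _) (tanhSq_lt_one x) α).scomp x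
      (hasDerivAt_tanhSq x)).continuousAt
  have hanti : AntitoneOn (fun x => Real.exp (-(κ * x)) * E x) (Set.Ici 0) := by
    refine antitoneOn_of_deriv_nonpos (convex_Ici 0) ?_ ?_ ?_
    · intro x hx
      refine ContinuousAt.continuousWithinAt ?_
      have h1 := hGc x hx
      have h2 := (dW x hx).continuousAt
      simp only [hE]
      fun_prop
    · intro x hx
      rw [interior_Ici] at hx
      refine DifferentiableAt.differentiableWithinAt ?_
      have := (dE x hx).differentiableAt
      fun_prop
    · intro x hx
      rw [interior_Ici] at hx
      have h1 : HasDerivAt (fun x : ℝ => Real.exp (-(κ * x))) (Real.exp (-(κ * x)) * (-κ)) x := by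
        have : HasDerivAt (fun x : ℝ => -(κ * x)) (-κ) x := by
          exact ((hasDerivAt_id x).const_mul κ).neg.congr_deriv (by simp)
        exact this.exp
      have h2 := h1.mul (dE x hx).differentiableAt.hasDerivAt
      have h3 : deriv (fun x => Real.exp (-(κ * x)) * E x) x = _ := h2.deriv
      rw [h3]
      have := hEle x hx
      have hpos := Real.exp_pos (-(κ * x))
      nlinarith
  have hfin := hanti (Set.self_mem_Ici) (Set.mem_Ici.mpr hx) hx
  -- At the origin `sinh` kills the first term of the energy and `th` equals `1`.
  have hE0 : E 0 = m := by
    simp [hE, hW, hT, th_zero]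
  simp only [mul_zero, neg_zero, Real.exp_zero, one_mul, hE0] at hfin
  rw [Real.exp_neg, inv_mul_le_iff₀ (Real.exp_pos _)] at hfin
  have : m * ‖W x‖ ^ 2 ≤ E x := by
    simp only [hE]
    have : 0 ≤ ‖k‖ ^ 2 * (Real.sinh x ^ 2 * Real.cosh x ^ 2 * ‖G x‖ ^ 2) := by positivity
    linarith
  have h7 : m * ‖W x‖ ^ 2 ≤ m * Real.exp (κ * x) := by linarith
  exact le_of_mul_le_mul_left h7 hm

end Energy

/-! ### Polynomial bounds on vertical strips -/

section StripBounds

/-- Entire even functions that are polynomially bounded on vertical strips. -/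
structure StripPoly (E : ℂ → ℂ) : Prop where
  differentiable : Differentiable ℂ E
  even : ∀ α, E (-α) = E α
  bound : ∀ B : ℝ, ∃ (C : ℝ) (N : ℕ), 0 ≤ C ∧ ∀ α : ℂ, |α.re| ≤ B → ‖E α‖ ≤ C * (1 + |α.im|) ^ N

theorem pow_one_add_abs_le {x : ℝ} {M N : ℕ} (h : M ≤ N) : (1 + |x|) ^ M ≤ (1 + |x|) ^ N :=
  pow_le_pow_right₀ (by linarith [abs_nonneg x]) h

theorem one_le_one_add_abs_pow (x : ℝ) (N : ℕ) : 1 ≤ (1 + |x|) ^ N :=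
  one_le_pow₀ (by linarith [abs_nonneg x])

namespace StripPoly

variable {E F : ℂ → ℂ}

theorem const (c : ℂ) : StripPoly fun _ => c where
  differentiable := by fun_prop
  even _ := rfl
  bound _ := ⟨‖c‖, 0, norm_nonneg _, fun α _ => by simp⟩

theorem add (hE : StripPoly E) (hF : StripPoly F) : StripPoly fun α => E α + F α where
  differentiable := hE.differentiable.add hF.differentiable
  even α := by rw [hE.even, hF.even]
  bound B := by
    obtain ⟨C, N, hC, h⟩ := hE.bound B
    obtain ⟨C', N', hC', h'⟩ := hF.bound B
    refine ⟨C + C', max N N', by positivity, fun α hα => (norm_add_le _ _).trans ?_⟩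
    rw [add_mul]
    gcongr
    · refine (h α hα).trans ?_
      exact mul_le_mul_of_nonneg_left (pow_one_add_abs_le (le_max_left _ _)) hC
    · refine (h' α hα).trans ?_
      exact mul_le_mul_of_nonneg_left (pow_one_add_abs_le (le_max_right _ _)) hC'

theorem mul (hE : StripPoly E) (hF : StripPoly F) : StripPoly fun α => E α * F α where
  differentiable := hE.differentiable.mul hF.differentiable
  even α := by rw [hE.even, hF.even]
  bound B := by
    obtain ⟨C, N, hC, h⟩ := hE.bound B
    obtain ⟨C', N', hC', h'⟩ := hF.bound B
    refine ⟨C * C', N + N', by positivity, fun α hα => ?_⟩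
    rw [norm_mul, pow_add]
    calc _ ≤ (C * (1 + |α.im|) ^ N) * (C' * (1 + |α.im|) ^ N') :=
          mul_le_mul (h α hα) (h' α hα) (norm_nonneg _) ((norm_nonneg _).trans (h α hα))
      _ = _ := by ring

theorem const_mul (c : ℂ) (hE : StripPoly E) : StripPoly fun α => c * E α := (const c).mul hE

theorem norm_le_one_add {α : ℂ} {B : ℝ} (h : |α.re| ≤ B) : ‖α‖ ≤ (1 + B) * (1 + |α.im|) := by
  have := Complex.norm_le_abs_re_add_abs_im α
  have h1 := abs_nonneg α.re
  nlinarith [abs_nonneg α.im]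

theorem sq : StripPoly fun α => α ^ 2 where
  differentiable := by fun_prop
  even α := by ring
  bound B := by
    by_cases hB : 0 ≤ B
    · refine ⟨(1 + B) ^ 2, 2, by positivity, fun α hα => ?_⟩
      rw [norm_pow, ← mul_pow]
      gcongr
      exact norm_le_one_add hα
    · exact ⟨0, 0, le_rfl, fun α hα => absurd ((abs_nonneg _).trans hα) hB⟩

theorem sq_sub_sq (a : ℂ) : StripPoly fun α => a ^ 2 - α ^ 2 := by
  have := (const (a ^ 2)).add (sq.const_mul (-1))
  simpa only [neg_one_mul, ← sub_eq_add_neg] using this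

theorem poch_mul_poch (a : ℂ) (k : ℕ) : StripPoly fun α => poch (a + α) k * poch (a - α) k := by
  induction k with
  | zero => simpa using const 1
  | succ k ih =>
    have := ih.mul (sq_sub_sq (a + k))
    have e : (fun α => poch (a + α) (k + 1) * poch (a - α) (k + 1))
        = fun α => poch (a + α) k * poch (a - α) k * ((a + k) ^ 2 - α ^ 2) := by
      funext α
      rw [poch_succ, poch_succ]
      ring
    rw [e]
    exact this

theorem sum {ι : Type*} (s : Finset ι) {f : ι → ℂ → ℂ} (h : ∀ i ∈ s, StripPoly (f i)) :
    StripPoly fun α => ∑ i ∈ s, f i α := by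
  classical
  induction s using Finset.induction_on with
  | empty => simpa using const 0
  | insert i s hi ih =>
    simp only [Finset.sum_insert hi]
    exact (h i (by simp)).add (ih fun j hj => h j (by simp [hj]))

end StripPoly

variable {u v : ℝ}

/-- For `|Im α| ≥ 2B + 1` the real part of `(u+α)(u-α)` is at least `(|Im α|/2)²`, while its
imaginary part is at most `2B |Im α|` in absolute value. The rate in the energy estimate is then at
most `8B`. The remaining `α` lie in a disc, where the series bound applies. -/
theorem norm_th_le_of_good (hc : 1 / 2 ≤ u + v) (hu : 0 ≤ u) {t₀ : ℝ} (h0 : 0 ≤ t₀) (h1 : t₀ < 1)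
    (B : ℝ) : ∃ C : ℝ, ∀ t ∈ Set.Icc 0 t₀, ∀ α : ℂ, |α.re| ≤ B → ‖th u v t α‖ ≤ C := by
  have hcne : ∀ k : ℕ, u + v ≠ -k := fun k hk => by
    have : (0 : ℝ) ≤ k := k.cast_nonneg
    linarith
  obtain ⟨C, hC⟩ := norm_th_le_of_norm_le (u := u) (v := v) hcne h0 h1 (B + (2 * B + 1))
  set θ := Real.artanh √t₀ with hθ
  refine ⟨max C (Real.exp (8 * B * θ)), fun t ht α hα => ?_⟩
  have hB : 0 ≤ B := (abs_nonneg _).trans hα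
  rcases le_total |α.im| (2 * B + 1) with h | h
  · refine (hC t ht α ?_).trans (le_max_left _ _)
    exact (Complex.norm_le_abs_re_add_abs_im α).trans (add_le_add hα h)
  · refine le_trans ?_ (le_max_right _ _)
    have hre : ((u + α) * (u - α)).re = u ^ 2 - α.re ^ 2 + α.im ^ 2 := by
      simp only [mul_re, add_re, sub_re, add_im, sub_im, ofReal_re, ofReal_im]
      ring
    have him : ((u + α) * (u - α)).im = -(2 * α.re * α.im) := by
      simp only [mul_im, add_re, sub_re, add_im, sub_im, ofReal_re, ofReal_im]
      ring
    have hτ : 0 < |α.im| := by linarith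
    have hm : (|α.im| / 2) ^ 2 ≤ ((u + α) * (u - α)).re := by
      rw [hre, ← sq_abs α.re, ← sq_abs α.im]
      have : |α.re| ≤ |α.im| / 2 := by linarith
      nlinarith [sq_nonneg u, abs_nonneg α.re]
    have hmpos : 0 < ((u + α) * (u - α)).re := lt_of_lt_of_le (by positivity) hm
    have hsq : √t < 1 := by
      rw [Real.sqrt_lt' one_pos, one_pow]
      exact ht.2.trans_lt h1
    have hsq0 : √t₀ < 1 := by rwa [Real.sqrt_lt' one_pos, one_pow]
    have hx : 0 ≤ Real.artanh √t := Real.artanh_nonneg (Real.sqrt_nonneg _)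
    have hxθ : Real.artanh √t ≤ θ :=
      Real.artanh_le_artanh (by linarith [Real.sqrt_nonneg t]) hsq0 (Real.sqrt_le_sqrt ht.2)
    have key := norm_th_tanhSq_le hc hu hmpos hx
    have htan : (Real.sinh (Real.artanh √t) / Real.cosh (Real.artanh √t)) ^ 2 = t := by
      rw [← Real.tanh_eq_sinh_div_cosh, Real.tanh_artanh ⟨by linarith [Real.sqrt_nonneg t], hsq⟩,
        Real.sq_sqrt ht.1]
    rw [htan] at key
    have hκ : 2 * |((u + α) * (u - α)).im| / √(((u + α) * (u - α)).re) ≤ 8 * B := by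
      have hs : |α.im| / 2 ≤ √(((u + α) * (u - α)).re) := Real.le_sqrt_of_sq_le hm
      rw [div_le_iff₀ (Real.sqrt_pos.mpr hmpos), him, abs_neg, abs_mul, abs_mul, abs_two]
      nlinarith [mul_le_mul_of_nonneg_right hα hτ.le]
    have h3 : ‖th u v t α‖ ^ 2 ≤ Real.exp (8 * B * θ) := by
      refine key.trans (Real.exp_le_exp.mpr ?_)
      exact mul_le_mul hκ hxθ hx (by positivity)
    have h4 : 1 ≤ Real.exp (8 * B * θ) := by
      refine Real.one_le_exp ?_
      have := hx.trans hxθ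
      positivity
    nlinarith [norm_nonneg (th u v t α)]

/-- Integrating `hasDerivAt_th` from `t = 0`, where `th = 1`, bounds `th u v` by `th (u + 1) v` at
the cost of the factor `(u+α)(u-α)`, i.e. two powers of `1 + |Im α|`. -/
theorem norm_th_le_of_step (hcne : ∀ k : ℕ, u + v ≠ -k) {t₀ : ℝ} (h1 : t₀ < 1)
    (B : ℝ) (ih : ∃ (C : ℝ) (N : ℕ), 0 ≤ C ∧ ∀ t ∈ Set.Icc 0 t₀, ∀ α : ℂ, |α.re| ≤ B →
      ‖th (u + 1) v t α‖ ≤ C * (1 + |α.im|) ^ N) :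
    ∃ (C : ℝ) (N : ℕ), 0 ≤ C ∧ ∀ t ∈ Set.Icc 0 t₀, ∀ α : ℂ, |α.re| ≤ B →
      ‖th u v t α‖ ≤ C * (1 + |α.im|) ^ N := by
  obtain ⟨C, N, hC, h⟩ := ih
  have hc0 : 0 < ‖(u : ℂ) + v‖ := by
    rw [norm_pos_iff]
    have := hcne 0
    exact_mod_cast (by simpa using this)
  have ht0 : 0 < 1 - t₀ := by linarith
  set D := (|u| + (1 + |B|)) ^ 2 / ‖(u : ℂ) + v‖ * ((1 - t₀) ^ 2)⁻¹ * C with hD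
  have hD0 : 0 ≤ D := by positivity
  refine ⟨1 + D, N + 2, by positivity, fun t ht α hα => ?_⟩
  have hB : |B| = B := abs_of_nonneg ((abs_nonneg _).trans hα)
  have hαn := StripPoly.norm_le_one_add hα
  have hX : 1 ≤ 1 + |α.im| := by linarith [abs_nonneg α.im]
  have hfac : ∀ β : ℂ, ‖β‖ = ‖α‖ → ‖(u : ℂ) + β‖ ≤ (|u| + (1 + |B|)) * (1 + |α.im|) := by
    intro β hβ
    refine (norm_add_le _ _).trans ?_
    rw [Complex.norm_real, Real.norm_eq_abs, hβ, hB]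
    nlinarith [abs_nonneg u]
  have hder : ∀ s ∈ Set.Icc 0 t, ‖-((u + α) * (u - α) / (u + v)) * ((1 - (s : ℂ)) ^ 2)⁻¹ * th (u + 1) v s α‖
      ≤ D * (1 + |α.im|) ^ (N + 2) := by
    intro s hs
    have hs' : s ∈ Set.Icc 0 t₀ := ⟨hs.1, hs.2.trans ht.2⟩
    rw [norm_mul, norm_mul, norm_neg, norm_div, norm_mul, norm_inv, norm_pow]
    have n1 : ‖1 - (s : ℂ)‖ = 1 - s := by
      rw [← Complex.ofReal_one, ← Complex.ofReal_sub, Complex.norm_of_nonneg (by linarith [hs'.2])]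
    have n2 : ‖(u : ℂ) - α‖ ≤ (|u| + (1 + |B|)) * (1 + |α.im|) := by
      rw [sub_eq_add_neg]
      exact hfac _ (norm_neg _)
    have n3 := hfac α rfl
    rw [n1]
    calc _ ≤ ((|u| + (1 + |B|)) * (1 + |α.im|) * ((|u| + (1 + |B|)) * (1 + |α.im|)))
          / ‖(u : ℂ) + v‖ * ((1 - t₀) ^ 2)⁻¹ * (C * (1 + |α.im|) ^ N) := by
          have := hs'.2
          gcongr
          exact h s hs' α hα
      _ = _ := by rw [hD, pow_add]; ring
  have hmv := (convex_Icc (0 : ℝ) t).norm_image_sub_le_of_norm_hasDerivWithin_le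
    (f := fun t => th u v t α) (fun s hs => (hasDerivAt_th hcne hs.1
      ((hs.2.trans ht.2).trans_lt h1) α).hasDerivWithinAt) hder
    (Set.left_mem_Icc.mpr ht.1) (Set.right_mem_Icc.mpr ht.1)
  rw [th_zero, sub_zero, Real.norm_of_nonneg ht.1] at hmv
  have h2 : ‖th u v t α‖ ≤ 1 + ‖th u v t α - 1‖ := by
    have := norm_add_le 1 (th u v t α - 1)
    rw [add_sub_cancel, norm_one] at this
    exact this
  have ht1 : t ≤ 1 := (ht.2.trans_lt h1).le
  have hP := one_le_one_add_abs_pow α.im (N + 2)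
  nlinarith [mul_nonneg hD0 (zero_le_one.trans hP)]

theorem norm_th_le (hcne : ∀ k : ℕ, u + v ≠ -k) {t₀ : ℝ} (h0 : 0 ≤ t₀) (h1 : t₀ < 1) (B : ℝ) :
    ∃ (C : ℝ) (N : ℕ), 0 ≤ C ∧ ∀ t ∈ Set.Icc 0 t₀, ∀ α : ℂ, |α.re| ≤ B →
      ‖th u v t α‖ ≤ C * (1 + |α.im|) ^ N := by
  -- The number of steps by which `u` has to be raised until the energy estimate applies.
  obtain ⟨k, hk⟩ := exists_nat_ge (max (-u) (1 / 2 - (u + v)))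
  have hk1 := (le_max_left _ _).trans hk
  have hk2 := (le_max_right _ _).trans hk
  clear hk
  induction k generalizing u with
  | zero =>
    simp only [Nat.cast_zero] at hk1 hk2
    obtain ⟨C, hC⟩ := norm_th_le_of_good (u := u) (v := v) (by linarith) (by linarith) h0 h1 B
    exact ⟨max C 0, 0, le_max_right _ _, fun t ht α hα => by
      simpa using Or.inl (hC t ht α hα)⟩
  | succ k ih =>
    push_cast at hk1 hk2
    refine norm_th_le_of_step hcne h1 B (ih (fun k hk => hcne (k + 1) ?_) (by linarith) (by linarith))
    push_cast
    linarith

theorem stripPoly_th (hcne : ∀ k : ℕ, u + v ≠ -k) {t : ℝ} (h0 : 0 ≤ t) (h1 : t < 1) :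
    StripPoly (th u v t) where
  differentiable := differentiable_th hcne h0 h1
  even := th_neg hcne h0 h1
  bound B := by
    obtain ⟨C, N, hC, h⟩ := norm_th_le hcne h0 h1 B
    exact ⟨C, N, hC, fun α hα => h t ⟨h0, le_rfl⟩ α hα⟩

theorem continuousOn_th (hcne : ∀ k : ℕ, u + v ≠ -k) (α : ℂ) :
    ContinuousOn (fun t => th u v t α) (Set.Ico 0 1) := fun _ ht =>
  (hasDerivAt_th hcne ht.1 ht.2 α).continuousAt.continuousWithinAt

/-- Integrals of entire functions over a parameter are entire. -/
theorem differentiable_intervalIntegral {F : ℝ → ℂ → ℂ} {a b : ℝ} (hab : a ≤ b)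
    (hd : ∀ t ∈ Set.Icc a b, Differentiable ℂ (F t))
    (hc : ∀ α, ContinuousOn (fun t => F t α) (Set.Icc a b))
    (hb : ∀ R : ℝ, ∃ C : ℝ, ∀ t ∈ Set.Icc a b, ∀ α : ℂ, ‖α‖ ≤ R → ‖F t α‖ ≤ C) :
    Differentiable ℂ fun α => ∫ t in a..b, F t α := by
  intro α₀
  obtain ⟨C, hC⟩ := hb (‖α₀‖ + 2)
  have hsub : Set.uIoc a b ⊆ Set.Icc a b := by
    rw [Set.uIoc_of_le hab]
    exact Set.Ioc_subset_Icc_self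
  have hm : ∀ α, AEStronglyMeasurable (fun t => F t α) (volume.restrict (Set.uIoc a b)) := fun α =>
    ((hc α).mono hsub).aestronglyMeasurable measurableSet_uIoc
  have hdm : AEStronglyMeasurable (fun t => deriv (F t) α₀) (volume.restrict (Set.uIoc a b)) := by
    -- Measurability of the derivative in the parameter, as a pointwise limit of difference
    -- quotients.
    refine aestronglyMeasurable_of_tendsto_ae (u := atTop)
      (f := fun n : ℕ => fun t => ((1 / ((n : ℝ) + 1) : ℝ) : ℂ)⁻¹
        * (F t (α₀ + ((1 / ((n : ℝ) + 1) : ℝ) : ℂ)) - F t α₀)) (fun n => ?_) ?_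
    · exact ((hm _).sub (hm _)).const_mul _
    · refine (ae_restrict_iff' measurableSet_uIoc).mpr (Eventually.of_forall fun t ht => ?_)
      have h1 := (hasDerivAt_iff_tendsto_slope_zero.mp ((hd t (hsub ht)) α₀).hasDerivAt)
      refine h1.comp ?_
      rw [tendsto_nhdsWithin_iff]
      refine ⟨?_, Eventually.of_forall fun n => ?_⟩
      · have := (Complex.continuous_ofReal.tendsto 0).comp (tendsto_one_div_add_atTop_nhds_zero_nat (𝕜 := ℝ))
        simpa [Function.comp_def] using this
      · simp only [Set.mem_compl_iff, Set.mem_singleton_iff, Complex.ofReal_eq_zero]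
        positivity
  refine (intervalIntegral.hasDerivAt_integral_of_dominated_loc_of_deriv_le (𝕜 := ℂ)
    (F := fun α t => F t α) (F' := fun α t => deriv (F t) α) (bound := fun _ => C)
    (Metric.ball_mem_nhds α₀ one_pos) (Eventually.of_forall fun α => hm α)
    ?_ hdm ?_ intervalIntegrable_const ?_).2.differentiableAt
  · refine ContinuousOn.intervalIntegrable ?_
    rw [Set.uIcc_of_le hab]
    exact hc α₀
  · refine Eventually.of_forall fun t ht α hα => ?_
    -- Cauchy's estimate on unit circles dominates the derivative, so bounds on the functions
    -- themselves suffice.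
    have := Complex.norm_deriv_le_of_forall_mem_sphere_norm_le (c := α) (f := F t) one_pos
      (hd t (hsub ht)).diffContOnCl (C := C) fun z hz => hC t (hsub ht) z ?_
    · simpa using this
    · have h1 : ‖z - α‖ = 1 := by simpa using hz
      have h2 : ‖α - α₀‖ < 1 := by simpa [dist_eq_norm] using hα
      have e : z = (z - α) + (α - α₀) + α₀ := by ring
      rw [e]
      refine (norm_add₃_le).trans ?_
      linarith
  · exact Eventually.of_forall fun t ht α _ => ((hd t (hsub ht)) α).hasDerivAt

/-- Weighted integrals of the Jacobi function over its argument. -/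
theorem stripPoly_integral_th (hcne : ∀ k : ℕ, u + v ≠ -k) {t₀ : ℝ} (h0 : 0 ≤ t₀) (h1 : t₀ < 1)
    {κ : ℝ → ℂ} (hκ : ContinuousOn κ (Set.Icc 0 t₀)) :
    StripPoly fun α => ∫ t in (0 : ℝ)..t₀, κ t * th u v t α := by
  obtain ⟨M, hM⟩ := isCompact_Icc.exists_bound_of_continuousOn hκ
  have hM0 : 0 ≤ M := (norm_nonneg _).trans (hM 0 ⟨le_rfl, h0⟩)
  have hsub : Set.Icc 0 t₀ ⊆ Set.Ico 0 1 := fun t ht => ⟨ht.1, ht.2.trans_lt h1⟩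
  refine ⟨?_, ?_, ?_⟩
  · refine differentiable_intervalIntegral h0
      (fun t ht => (differentiable_th hcne ht.1 (hsub ht).2).const_mul _)
      (fun α => hκ.mul ((continuousOn_th hcne α).mono hsub)) fun R => ?_
    obtain ⟨C, hC⟩ := norm_th_le_of_norm_le hcne h0 h1 R
    refine ⟨M * C, fun t ht α hα => ?_⟩
    rw [norm_mul]
    exact mul_le_mul (hM t ht) (hC t ht α hα) (norm_nonneg _) hM0
  · intro α
    refine intervalIntegral.integral_congr fun t ht => ?_
    rw [Set.uIcc_of_le h0] at ht
    simp only [th_neg hcne ht.1 (hsub ht).2]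
  · intro B
    obtain ⟨C, N, hC, h⟩ := norm_th_le hcne h0 h1 B
    refine ⟨M * C * t₀, N, by positivity, fun α hα => ?_⟩
    have := intervalIntegral.norm_integral_le_of_norm_le_const (a := 0) (b := t₀)
      (f := fun t => κ t * th u v t α) (C := M * (C * (1 + |α.im|) ^ N)) fun t ht => by
        rw [Set.uIoc_of_le h0] at ht
        have ht' : t ∈ Set.Icc 0 t₀ := Set.Ioc_subset_Icc_self ht
        rw [norm_mul]
        exact mul_le_mul (hM t ht') (h t ht' α hα) (norm_nonneg _) hM0
    rw [sub_zero, abs_of_nonneg h0] at this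
    calc _ ≤ _ := this
      _ = _ := by ring

end StripBounds

/-! ### Decay of the Gamma factors and of the Mellin-Barnes kernel -/

section GammaBounds

theorem norm_sin_le (z : ℂ) : ‖sin z‖ ≤ Real.exp |z.im| := by
  rw [Complex.sin, norm_div, norm_mul, norm_I, Complex.norm_ofNat, mul_one, div_le_iff₀ two_pos]
  refine (norm_sub_le _ _).trans ?_
  rw [norm_exp, norm_exp]
  have h1 : Real.exp (-z * I).re ≤ Real.exp |z.im| := Real.exp_le_exp.mpr (by simp [le_abs_self])
  have h2 : Real.exp (z * I).re ≤ Real.exp |z.im| := Real.exp_le_exp.mpr (by simp [neg_le_abs])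
  linarith

theorem exp_le_norm_sin {z : ℂ} (h : 1 ≤ |z.im|) : Real.exp |z.im| / 4 ≤ ‖sin z‖ := by
  rw [Complex.sin, norm_div, norm_mul, norm_I, Complex.norm_ofNat, mul_one]
  have h1 : Real.exp (-|z.im|) ≤ Real.exp |z.im| / 2 := by
    rw [Real.exp_neg, inv_le_iff_one_le_mul₀ (Real.exp_pos _)]
    have := Real.add_one_le_exp |z.im|
    nlinarith
  have h2 : Real.exp |z.im| - Real.exp (-|z.im|) ≤ ‖cexp (-z * I) - cexp (z * I)‖ := by
    have e1 : ‖cexp (-z * I)‖ = Real.exp z.im := by rw [norm_exp]; simp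
    have e2 : ‖cexp (z * I)‖ = Real.exp (-z.im) := by rw [norm_exp]; simp
    rcases abs_cases z.im with ⟨h, _⟩ | ⟨h, _⟩
    · rw [h, ← e1, ← e2]
      exact norm_sub_norm_le _ _
    · rw [h, neg_neg, ← e1, ← e2, norm_sub_rev]
      exact norm_sub_norm_le _ _
  linarith

theorem Gamma_add_natCast_eq {z : ℂ} (h : ∀ k : ℕ, z ≠ -k) (n : ℕ) :
    Gamma (z + n) = poch z n * Gamma z := by
  induction n with
  | zero => simp
  | succ n ih =>
    rw [Nat.cast_succ, ← add_assoc, Gamma_add_one _ fun h0 => h n (eq_neg_of_add_eq_zero_left h0),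
      ih, poch_succ]
    ring

/-- The quotient `Γ(w) Γ(y) / Γ(w+y)` is a beta integral; since `Re w ≥ 1`, it is bounded by `∫
(1-x)^{y-1} = 1/y`. -/
theorem norm_Gamma_le_norm_Gamma_add {w : ℂ} (hw : 1 ≤ w.re) {y : ℝ} (hy : 0 < y) :
    ‖Gamma w‖ ≤ ‖Gamma (w + y)‖ / Real.Gamma (y + 1) := by
  have h := congrArg norm (Gamma_mul_Gamma_eq_betaIntegral (s := w) (t := y) (by linarith)
    (by simpa using hy))
  rw [norm_mul, norm_mul, Gamma_ofReal, norm_real, Real.norm_of_nonneg (Real.Gamma_pos_of_pos hy).le]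
    at h
  have hb : ‖w.betaIntegral y‖ ≤ 1 / y := by
    rw [betaIntegral]
    have hint : IntervalIntegrable (fun x : ℝ => (1 - x) ^ (y - 1)) volume 0 1 := by
      have := (intervalIntegral.intervalIntegrable_rpow' (a := 1) (b := 0) (r := y - 1)
        (by linarith)).comp_sub_left 1
      simpa using this
    refine (intervalIntegral.norm_integral_le_of_norm_le zero_le_one
      (g := fun x : ℝ => (1 - x) ^ (y - 1)) ?_ hint).trans_eq ?_
    · have : ∀ᵐ x : ℝ, x ≠ 1 := by simp [ae_iff]
      filter_upwards [this] with x hx1 hx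
      have h1 : 0 < 1 - x := by
        have := lt_of_le_of_ne hx.2 hx1
        linarith
      rw [norm_mul, norm_cpow_eq_rpow_re_of_pos hx.1, ← ofReal_one, ← ofReal_sub,
        norm_cpow_eq_rpow_re_of_pos h1]
      have : x ^ (w - (1 : ℝ)).re ≤ 1 := Real.rpow_le_one hx.1.le hx.2 (by simpa using hw)
      have e : ((y : ℂ) - (1 : ℝ)).re = y - 1 := by simp
      rw [e]
      exact mul_le_of_le_one_left (Real.rpow_nonneg h1.le _) this
    · rw [intervalIntegral.integral_comp_sub_left (fun x : ℝ => x ^ (y - 1)) 1, sub_self, sub_zero,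
        integral_rpow (Or.inl (by linarith))]
      rw [sub_add_cancel, Real.one_rpow, Real.zero_rpow hy.ne', sub_zero]
  rw [Real.Gamma_add_one hy.ne', le_div_iff₀ (mul_pos hy (Real.Gamma_pos_of_pos hy))]
  have h2 := mul_le_mul_of_nonneg_left hb (norm_nonneg (Gamma (w + y)))
  rw [← h] at h2
  have := mul_le_mul_of_nonneg_left h2 hy.le
  calc _ = y * (‖Gamma w‖ * Real.Gamma y) := by ring
    _ ≤ _ := this
    _ = _ := by field_simp

theorem one_le_norm_poch {z : ℂ} (hz : 1 ≤ |z.im|) (n : ℕ) : 1 ≤ ‖poch z n‖ := by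
  induction n with
  | zero => simp
  | succ n ih =>
    rw [poch_succ, norm_mul]
    have : 1 ≤ ‖z + n‖ := hz.trans (by simpa using Complex.abs_im_le_norm (z + n))
    nlinarith

theorem norm_poch_le_pow (z : ℂ) (n : ℕ) : ‖poch z n‖ ≤ (‖z‖ + n) ^ n := by
  induction n with
  | zero => simp
  | succ n ih =>
    rw [poch_succ, norm_mul, pow_succ]
    have h1 : ‖z + n‖ ≤ ‖z‖ + (n + 1 : ℕ) := by
      refine (norm_add_le _ _).trans ?_
      rw [norm_natCast]
      push_cast
      linarith
    refine mul_le_mul (ih.trans ?_) h1 (norm_nonneg _) (by positivity)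
    gcongr
    simp

theorem ne_neg_natCast_of_im {z : ℂ} (hz : 1 ≤ |z.im|) (k : ℕ) : z ≠ -k := by
  rintro rfl
  simp at hz
  linarith

/-- No Stirling formula is needed. By reflection `Γ(a-α) Γ(1-a+α) = π / sin π(a-α)` decays
exponentially, and `Γ(a+α) / Γ(1-a+α)` is polynomially bounded: the numerator is raised to real part
at least `1`, then compared with a further shift of the denominator. -/
theorem norm_gammaPM_le (a B : ℝ) : ∃ (C : ℝ) (N : ℕ), 0 ≤ C ∧ ∀ α : ℂ, |α.re| ≤ B → 1 ≤ |α.im| →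
    ‖gammaPM a α‖ ≤ C * (1 + |α.im|) ^ N * Real.exp (-(Real.pi * |α.im|)) := by
  obtain ⟨k, hk⟩ := exists_nat_ge (1 - a + B)
  obtain ⟨m, hm⟩ := exists_nat_gt (k + 2 * a - 1)
  -- Chosen so that `a + α + k + y = 1 - a + α + m`; the choice of `m` makes it positive.
  set y : ℝ := 1 - 2 * a + m - k with hy
  have hy0 : 0 < y := by linarith
  have hΓ := Real.Gamma_pos_of_pos (by linarith : 0 < y + 1)
  refine ⟨(Real.Gamma (y + 1))⁻¹ * (Real.pi * 4) * (|1 - a| + (1 + |B|) + m) ^ m, m, by positivity,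
    fun α hα hτ => ?_⟩
  have hB : |B| = B := abs_of_nonneg ((abs_nonneg _).trans hα)
  have h1 : 1 ≤ |((a : ℂ) + α).im| := by simpa using hτ
  have h2 : 1 ≤ |(1 - (a : ℂ) + α).im| := by simpa using hτ
  have e1 := Gamma_add_natCast_eq (ne_neg_natCast_of_im h1) k
  have e2 := Gamma_add_natCast_eq (ne_neg_natCast_of_im h2) m
  have e3 := Gamma_mul_Gamma_one_sub ((a : ℂ) - α)
  have e4 : (1 - (a - α) : ℂ) = 1 - a + α := by ring
  rw [e4] at e3
  have hw : 1 ≤ ((a : ℂ) + α + k).re := by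
    simp only [add_re, ofReal_re, natCast_re]
    have := neg_abs_le α.re
    linarith
  have hle := norm_Gamma_le_norm_Gamma_add hw hy0
  have e5 : (a : ℂ) + α + k + y = 1 - a + α + m := by rw [hy]; push_cast; ring
  rw [e5, e2, e1, norm_mul, norm_mul] at hle
  have hp1 := one_le_norm_poch h1 k
  have him : |((Real.pi : ℂ) * (a - α)).im| = Real.pi * |α.im| := by
    simp [abs_mul, abs_of_pos Real.pi_pos]
  have hs := exp_le_norm_sin (z := Real.pi * (a - α)) (by
    rw [him]; nlinarith [Real.pi_gt_three])
  rw [him] at hs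
  have hG : ‖Gamma (1 - (a : ℂ) + α)‖ ≠ 0 := norm_ne_zero_iff.mpr
    (Gamma_ne_zero (ne_neg_natCast_of_im h2))
  have e6 := congrArg norm e3
  rw [norm_mul, norm_div, norm_real, Real.norm_of_nonneg Real.pi_pos.le] at e6
  have hpo : ‖poch (1 - (a : ℂ) + α) m‖ ≤ (|1 - a| + (1 + |B|) + m) ^ m * (1 + |α.im|) ^ m := by
    refine (norm_poch_le_pow _ _).trans ?_
    rw [← mul_pow]
    gcongr
    have h3 := StripPoly.norm_le_one_add hα
    have h4 : ‖1 - (a : ℂ) + α‖ ≤ |1 - a| + ‖α‖ := by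
      refine (norm_add_le _ _).trans ?_
      rw [← ofReal_one, ← ofReal_sub, norm_real, Real.norm_eq_abs]
    rw [← hB] at h3
    nlinarith [abs_nonneg (1 - a), abs_nonneg α.im, (Nat.cast_nonneg m : (0 : ℝ) ≤ m)]
  have hE := Real.exp_pos (Real.pi * |α.im|)
  have h7 : ‖Gamma ((a : ℂ) - α)‖ * ‖Gamma (1 - (a : ℂ) + α)‖
      ≤ Real.pi * 4 * Real.exp (-(Real.pi * |α.im|)) := by
    rw [e6, Real.exp_neg, div_le_iff₀ (by linarith)]
    calc Real.pi = Real.pi * 4 * (Real.exp (Real.pi * |α.im|))⁻¹ * (Real.exp (Real.pi * |α.im|) / 4) := by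
          field_simp
      _ ≤ _ := by gcongr
  have h8 : ‖Gamma ((a : ℂ) + α)‖ ≤ ‖poch (1 - (a : ℂ) + α) m‖ * ‖Gamma (1 - (a : ℂ) + α)‖
      * (Real.Gamma (y + 1))⁻¹ := by
    rw [← div_eq_mul_inv]
    exact (le_mul_of_one_le_left (norm_nonneg _) hp1).trans hle
  rw [gammaPM, norm_mul]
  calc _ ≤ ‖poch (1 - (a : ℂ) + α) m‖ * ‖Gamma (1 - (a : ℂ) + α)‖
      * (Real.Gamma (y + 1))⁻¹ * ‖Gamma ((a : ℂ) - α)‖ := by gcongr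
    _ = ‖poch (1 - (a : ℂ) + α) m‖ * (Real.Gamma (y + 1))⁻¹ *
      (‖Gamma ((a : ℂ) - α)‖ * ‖Gamma (1 - (a : ℂ) + α)‖) := by ring
    _ ≤ ((|1 - a| + (1 + |B|) + m) ^ m * (1 + |α.im|) ^ m) * (Real.Gamma (y + 1))⁻¹ *
      (Real.pi * 4 * Real.exp (-(Real.pi * |α.im|))) := by gcongr
    _ = _ := by ring

/-- Polynomial boundedness on vertical strips. -/
def StripBound (F : ℂ → ℂ) : Prop :=
  ∀ B : ℝ, ∃ (C : ℝ) (N : ℕ), 0 ≤ C ∧ ∀ α : ℂ, |α.re| ≤ B → ‖F α‖ ≤ C * (1 + |α.im|) ^ N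

theorem StripPoly.stripBound {E : ℂ → ℂ} (h : StripPoly E) : StripBound E := h.bound

theorem StripBound.mul_self {E : ℂ → ℂ} (hE : StripBound E) (c : ℂ) :
    StripBound fun α => c * α * E α := fun B => by
  obtain ⟨C, N, hC, h⟩ := hE B
  refine ⟨‖c‖ * (1 + |B|) * C, N + 1, by positivity, fun α hα => ?_⟩
  have hB : |B| = B := abs_of_nonneg ((abs_nonneg _).trans hα)
  have h3 := StripPoly.norm_le_one_add hα
  rw [norm_mul, norm_mul, pow_succ]
  calc _ ≤ ‖c‖ * ((1 + |B|) * (1 + |α.im|)) * (C * (1 + |α.im|) ^ N) := by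
        rw [hB]
        have h0 := (norm_nonneg _).trans h3
        exact mul_le_mul (mul_le_mul_of_nonneg_left h3 (norm_nonneg _)) (h α hα) (norm_nonneg _)
          (by positivity)
    _ = _ := by ring

/-- The Mellin-Barnes kernel `Γ(a ± α) Γ(b ± α) Γ(c ± α) sin(2πα) F(α)`. -/
noncomputable def kern (a b c : ℝ) (F : ℂ → ℂ) (α : ℂ) : ℂ :=
  gammaPM a α * gammaPM b α * gammaPM c α * (sin (2 * Real.pi * α) * F α)

theorem pow_mul_exp_le (N : ℕ) {x : ℝ} (hx : 0 ≤ x) :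
    (1 + x) ^ N * Real.exp (-(Real.pi * x)) ≤ N.factorial * Real.exp 1 * Real.exp (-x) := by
  have h := Real.pow_div_factorial_le_exp (1 + x) (by linarith) N
  rw [div_le_iff₀ (by positivity)] at h
  have h2 : Real.exp (-(Real.pi * x)) ≤ Real.exp (-(2 * x)) :=
    Real.exp_le_exp.mpr (by nlinarith [Real.pi_gt_three])
  calc _ ≤ (Real.exp (1 + x) * N.factorial) * Real.exp (-(2 * x)) := by gcongr
    _ = N.factorial * (Real.exp (1 + x) * Real.exp (-(2 * x))) := by ring
    _ = N.factorial * (Real.exp 1 * Real.exp (-x)) := by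
      rw [← Real.exp_add, ← Real.exp_add]
      ring_nf
    _ = _ := by ring

/-- The three pairs of Gamma functions contribute `exp(-3π|Im α|)` and the sine `exp(2π|Im α|)`; the
remaining `exp(-π|Im α|)` beats every power with room for `exp(-|Im α|)`. -/
theorem norm_kern_le (a b c : ℝ) {F : ℂ → ℂ} (hF : StripBound F) (B : ℝ) :
    ∃ C : ℝ, 0 ≤ C ∧ ∀ α : ℂ, |α.re| ≤ B → 1 ≤ |α.im| →
      ‖kern a b c F α‖ ≤ C * Real.exp (-|α.im|) := by
  obtain ⟨C1, N1, hC1, h1⟩ := norm_gammaPM_le a B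
  obtain ⟨C2, N2, hC2, h2⟩ := norm_gammaPM_le b B
  obtain ⟨C3, N3, hC3, h3⟩ := norm_gammaPM_le c B
  obtain ⟨C4, N4, hC4, h4⟩ := hF B
  refine ⟨C1 * C2 * C3 * C4 * ((N1 + N2 + N3 + N4).factorial * Real.exp 1), by positivity,
    fun α hα hτ => ?_⟩
  have hs : ‖sin (2 * Real.pi * α)‖ ≤ Real.exp (2 * Real.pi * |α.im|) := by
    refine (norm_sin_le _).trans_eq ?_
    congr 1
    have : (2 * (Real.pi : ℂ) * α).im = 2 * Real.pi * α.im := by simp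
    rw [this, abs_mul, abs_of_pos Real.two_pi_pos]
  rw [kern, norm_mul, norm_mul, norm_mul, norm_mul]
  set X := 1 + |α.im|
  set e := Real.exp (-(Real.pi * |α.im|)) with he
  calc _ ≤ (C1 * X ^ N1 * e) * (C2 * X ^ N2 * e) * (C3 * X ^ N3 * e)
        * (Real.exp (2 * Real.pi * |α.im|) * (C4 * X ^ N4)) := by
        gcongr
        · exact h1 α hα hτ
        · exact h2 α hα hτ
        · exact h3 α hα hτ
        · exact h4 α hα
    _ = C1 * C2 * C3 * C4 * (X ^ (N1 + N2 + N3 + N4)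
        * (e * e * e * Real.exp (2 * Real.pi * |α.im|))) := by ring
    _ = C1 * C2 * C3 * C4 * (X ^ (N1 + N2 + N3 + N4) * e) := by
        congr 3
        rw [he, ← Real.exp_add, ← Real.exp_add, ← Real.exp_add]
        congr 1
        ring
    _ ≤ C1 * C2 * C3 * C4 * ((N1 + N2 + N3 + N4).factorial * Real.exp 1 * Real.exp (-|α.im|)) := by
        exact mul_le_mul_of_nonneg_left (pow_mul_exp_le _ (abs_nonneg _)) (by positivity)
    _ = _ := by ring

end GammaBounds

/-! ### Residues and principal parts -/

section Residues

variable {f g : ℂ → ℂ} {x c c' : ℂ}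

/-- All small circles around `x` give the residue `c`. -/
def HasResidue (f : ℂ → ℂ) (x c : ℂ) : Prop :=
  ∀ᶠ r in 𝓝[>] (0 : ℝ), CircleIntegrable f x r ∧ (2 * Real.pi * I)⁻¹ * (∮ z in C(x, r), f z) = c

namespace HasResidue

theorem residue_eq (h : HasResidue f x c) : residue f x = c :=
  (tendsto_nhds_of_eventually_eq (h.mono fun _ hr => hr.2)).limUnder_eq

theorem congr (h : HasResidue f x c) (hfg : f =ᶠ[𝓝[≠] x] g) : HasResidue g x c := by
  obtain ⟨ε, hε, hball⟩ := Metric.mem_nhdsWithin_iff.mp hfg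
  filter_upwards [h, Ioo_mem_nhdsGT hε] with r hr hrε
  have hsph : Set.EqOn f g (Metric.sphere x r) := fun z hz => by
    refine hball ⟨Metric.sphere_subset_closedBall.trans (Metric.closedBall_subset_ball hrε.2) hz, ?_⟩
    rintro rfl
    simp [hrε.1.ne] at hz
  refine ⟨?_, ?_⟩
  · refine hr.1.congr ?_
    intro θ _
    exact hsph (circleMap_mem_sphere _ hrε.1.le _)
  · rw [← circleIntegral.integral_congr hrε.1.le hsph]
    exact hr.2

theorem add (hf : HasResidue f x c) (hg : HasResidue g x c') :
    HasResidue (fun z => f z + g z) x (c + c') := by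
  filter_upwards [hf, hg] with r h1 h2
  refine ⟨h1.1.add h2.1, ?_⟩
  rw [circleIntegral.integral_add h1.1 h2.1, mul_add, h1.2, h2.2]

theorem const_mul (a : ℂ) (hf : HasResidue f x c) : HasResidue (fun z => a * f z) x (a * c) := by
  filter_upwards [hf] with r h1
  refine ⟨h1.1.const_smul (a := a), ?_⟩
  rw [circleIntegral.integral_const_mul, mul_left_comm, h1.2]

theorem sub (hf : HasResidue f x c) (hg : HasResidue g x c') :
    HasResidue (fun z => f z - g z) x (c - c') := by
  simpa [sub_eq_add_neg] using hf.add (hg.const_mul (-1))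

theorem sum {ι : Type*} (s : Finset ι) {f : ι → ℂ → ℂ} {c : ι → ℂ}
    (h : ∀ i ∈ s, HasResidue (f i) x (c i)) :
    HasResidue (fun z => ∑ i ∈ s, f i z) x (∑ i ∈ s, c i) := by
  classical
  induction s using Finset.induction_on with
  | empty =>
    refine Eventually.of_forall fun r => ⟨?_, ?_⟩
    · simp
    · simp [circleIntegral]
  | insert i s hi ih =>
    simp only [Finset.sum_insert hi]
    exact (h i (by simp)).add (ih fun j hj => h j (by simp [hj]))

theorem of_analyticAt (h : AnalyticAt ℂ f x) : HasResidue f x 0 := by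
  obtain ⟨ε, hε, hball⟩ := Metric.eventually_nhds_iff_ball.mp h.eventually_analyticAt
  filter_upwards [Ioo_mem_nhdsGT hε] with r hr
  have hd : DifferentiableOn ℂ f (Metric.closedBall x r) := fun z hz =>
    (hball z (Metric.closedBall_subset_ball hr.2 hz)).differentiableAt.differentiableWithinAt
  refine ⟨(hd.continuousOn.mono Metric.sphere_subset_closedBall).circleIntegrable hr.1.le, ?_⟩
  have hdc : DiffContOnCl ℂ f (Metric.ball x r) := by
    refine DifferentiableOn.diffContOnCl ?_
    rwa [closure_ball _ hr.1.ne']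
  rw [hdc.circleIntegral_eq_zero hr.1.le, mul_zero]

theorem comp_add_const {h : ℂ} (hf : HasResidue f (x + h) c) :
    HasResidue (fun z => f (z + h)) x c := by
  have e : ∀ r θ, circleMap x r θ + h = circleMap (x + h) r θ := fun r θ => by
    simp only [circleMap]
    ring
  filter_upwards [hf] with r hr
  refine ⟨?_, ?_⟩
  · simpa only [CircleIntegrable, e] using hr.1
  · rw [← hr.2]
    simp only [circleIntegral, e, deriv_circleMap]

end HasResidue

/-- A principal part at `x`. -/
noncomputable def principalPart (x : ℂ) (n : ℕ) (c : ℕ → ℂ) (z : ℂ) : ℂ :=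
  ∑ k ∈ Finset.range (n + 1), c k * ((z - x) ^ (k + 1))⁻¹

theorem hasResidue_inv_pow (x y : ℂ) (k : ℕ) :
    HasResidue (fun z => ((z - x) ^ (k + 1))⁻¹) y (if y = x ∧ k = 0 then 1 else 0) := by
  by_cases hy : y = x
  · subst hy
    filter_upwards [self_mem_nhdsWithin] with r hr
    have hr : 0 < r := hr
    have e : (fun z : ℂ => ((z - y) ^ (k + 1))⁻¹) = fun z => (z - y) ^ (-((k : ℤ) + 1)) := by
      funext z
      rw [zpow_neg]
      norm_cast
    refine ⟨?_, ?_⟩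
    · rw [e, circleIntegrable_sub_zpow_iff]
      refine Or.inr (Or.inr ?_)
      simpa using (abs_pos.mpr hr.ne').ne
    · by_cases hk : k = 0
      · subst hk
        simp only [zero_add, pow_one, and_self, if_true]
        rw [circleIntegral.integral_sub_inv_of_mem_ball (Metric.mem_ball_self hr)]
        exact inv_mul_cancel₀ Complex.two_pi_I_ne_zero
      · simp only [hk, and_false, if_false]
        rw [e, circleIntegral.integral_sub_zpow_of_ne (by omega), mul_zero]
  · simp only [hy, false_and, if_false]
    refine HasResidue.of_analyticAt ?_
    exact ((analyticAt_id.sub analyticAt_const).pow _).inv (pow_ne_zero _ (sub_ne_zero.mpr hy))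

theorem hasResidue_principalPart (x y : ℂ) (n : ℕ) (c : ℕ → ℂ) :
    HasResidue (principalPart x n c) y (if y = x then c 0 else 0) := by
  have h := HasResidue.sum (Finset.range (n + 1)) fun k _ => (hasResidue_inv_pow x y k).const_mul (c k)
  have e : (∑ k ∈ Finset.range (n + 1), c k * if y = x ∧ k = 0 then 1 else 0)
      = if y = x then c 0 else 0 := by
    rw [Finset.sum_range_succ']
    by_cases hy : y = x <;> simp [hy]
  rwa [e] at h

/-- Each step splits off the value at `x` and divides the rest by `z - x` through `dslope`, so
Laurent coefficients appear one at a time. -/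
theorem exists_div_pow_eq (n : ℕ) : ∀ {g : ℂ → ℂ}, AnalyticAt ℂ g x → ∃ (c : ℕ → ℂ) (h : ℂ → ℂ),
    AnalyticAt ℂ h x ∧ ∀ z ≠ x, g z / (z - x) ^ n
      = ∑ k ∈ Finset.range n, c k * ((z - x) ^ (k + 1))⁻¹ + h z := by
  induction n with
  | zero => exact fun {g} hg => ⟨0, g, hg, fun z _ => by simp⟩
  | succ n ih =>
    intro g hg
    have hd : AnalyticAt ℂ (dslope g x) x := by
      obtain ⟨p, hp⟩ := hg
      exact hp.has_fpower_series_dslope_fslope.analyticAt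
    obtain ⟨c, h, hh, H⟩ := ih hd
    refine ⟨fun k => if k = n then g x else c k, h, hh, fun z hz => ?_⟩
    have hz' : z - x ≠ 0 := sub_ne_zero.mpr hz
    have e := H z hz
    have e3 : ∑ k ∈ Finset.range n, (if k = n then g x else c k) * ((z - x) ^ (k + 1))⁻¹
        = ∑ k ∈ Finset.range n, c k * ((z - x) ^ (k + 1))⁻¹ :=
      Finset.sum_congr rfl fun k hk => by rw [if_neg (Finset.mem_range.mp hk).ne]
    rw [Finset.sum_range_succ, e3]
    simp only [if_true]
    have e2 : g z = (z - x) * dslope g x z + g x := by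
      have := sub_smul_dslope g x z
      rw [smul_eq_mul] at this
      rw [this]
      ring
    rw [e2, add_div, pow_succ, mul_comm ((z - x) ^ n), mul_div_mul_left _ _ hz', e]
    ring

theorem MeromorphicAt.exists_principalPart (hf : MeromorphicAt f x) :
    ∃ (n : ℕ) (c : ℕ → ℂ) (h : ℂ → ℂ), AnalyticAt ℂ h x ∧
      f =ᶠ[𝓝[≠] x] fun z => principalPart x n c z + h z := by
  obtain ⟨n, hn⟩ := hf
  -- `principalPart x n` has order `n + 1`, hence one additional factor `z - x`.
  have hn' : AnalyticAt ℂ (fun z => (z - x) * ((z - x) ^ n • f z)) x :=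
    (analyticAt_id.sub analyticAt_const).mul hn
  obtain ⟨c, h, hh, H⟩ := exists_div_pow_eq (n + 1) hn'
  refine ⟨n, c, h, hh, ?_⟩
  filter_upwards [self_mem_nhdsWithin] with z hz
  have hz' : z - x ≠ 0 := sub_ne_zero.mpr hz
  rw [principalPart, ← H z hz, smul_eq_mul, pow_succ]
  field_simp

theorem hasResidue_of_eventuallyEq {n : ℕ} {c : ℕ → ℂ} {h : ℂ → ℂ} (hh : AnalyticAt ℂ h x)
    (hf : f =ᶠ[𝓝[≠] x] fun z => principalPart x n c z + h z) : HasResidue f x (c 0) := by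
  have := ((hasResidue_principalPart x x n c).add (HasResidue.of_analyticAt hh)).congr hf.symm
  simpa using this

/-- Subtracting the principal part shows that the circle integrals are constant for small radii, so
the limit in `residue` is a genuine value on which algebraic rules can be used. -/
theorem MeromorphicAt.hasResidue (hf : MeromorphicAt f x) : HasResidue f x (residue f x) := by
  obtain ⟨n, c, h, hh, hfe⟩ := hf.exists_principalPart
  have := hasResidue_of_eventuallyEq hh hfe
  rwa [this.residue_eq]

theorem tendsto_neg_nhdsNE (x : ℂ) : Tendsto (fun z : ℂ => -z) (𝓝[≠] x) (𝓝[≠] (-x)) := by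
  refine tendsto_nhdsWithin_iff.mpr ⟨(continuous_neg.tendsto x).mono_left nhdsWithin_le_nhds, ?_⟩
  filter_upwards [self_mem_nhdsWithin] with z hz
  simpa using hz

theorem residue_comp_neg (hf : MeromorphicAt f (-x)) :
    residue (fun z => f (-z)) x = -residue f (-x) := by
  obtain ⟨n, c, h, hh, hfe⟩ := hf.exists_principalPart
  rw [(hasResidue_of_eventuallyEq hh hfe).residue_eq]
  have h1 : (fun z => f (-z)) =ᶠ[𝓝[≠] x]
      fun z => principalPart x n (fun k => (-1) ^ (k + 1) * c k) z + h (-z) := by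
    filter_upwards [(tendsto_neg_nhdsNE x).eventually hfe] with z hz
    rw [hz, principalPart, principalPart]
    congr 1
    refine Finset.sum_congr rfl fun k _ => ?_
    have e : -z - -x = (-1) * (z - x) := by ring
    have e1 : ((-1 : ℂ) ^ (k + 1))⁻¹ = (-1) ^ (k + 1) := by
      rw [← inv_pow]; norm_num
    rw [e, mul_pow, mul_inv, e1]
    ring
  have h2 : AnalyticAt ℂ (fun z => h (-z)) x := hh.fun_comp analyticAt_id.neg
  rw [(hasResidue_of_eventuallyEq h2 h1).residue_eq]
  simp

end Residues

/-! ### The residue theorem for a vertical strip -/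

section Strip

theorem continuous_vertical (β : ℝ) : Continuous fun t : ℝ => (β : ℂ) + t * I := by fun_prop

theorem integrable_of_norm_le_exp_neg_abs {g : ℝ → ℂ} (hg : Continuous g) {C : ℝ}
    (h : ∀ t, 1 ≤ |t| → ‖g t‖ ≤ C * Real.exp (-|t|)) : Integrable g := by
  have h1 : g =O[atTop] fun t : ℝ => Real.exp (-1 * t) := by
    refine Asymptotics.IsBigO.of_bound C ?_
    filter_upwards [eventually_ge_atTop 1] with t ht
    have := h t (ht.trans (le_abs_self t))
    rw [abs_of_nonneg (zero_le_one.trans ht)] at this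
    simpa [Real.norm_of_nonneg (Real.exp_pos _).le] using this
  have h2 : g =O[atBot] fun t : ℝ => Real.exp (1 * t) := by
    refine Asymptotics.IsBigO.of_bound C ?_
    filter_upwards [eventually_le_atBot (-1)] with t ht
    have ht0 : t ≤ 0 := by linarith
    have := h t (by rw [abs_of_nonpos ht0]; linarith)
    rw [abs_of_nonpos ht0] at this
    simpa [Real.norm_of_nonneg (Real.exp_pos _).le] using this
  refine hg.locallyIntegrable.integrable_of_isBigO_atBot_atTop h2 ?_ h1 ?_
  · exact ⟨Set.Iic 0, Iic_mem_atBot 0, integrableOn_exp_mul_Iic one_pos 0⟩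
  · exact ⟨Set.Ioi 0, Ioi_mem_atTop 0, exp_neg_integrableOn_Ioi 0 one_pos⟩

theorem vertical_ne_zero {β : ℝ} (hβ : β ≠ 0) (t : ℝ) : (β : ℂ) + t * I ≠ 0 := fun h => by
  apply hβ
  simpa using congrArg Complex.re h

theorem hasDerivAt_vertical (β t : ℝ) : HasDerivAt (fun t : ℝ => (β : ℂ) + t * I) I t := by
  have := ((hasDerivAt_id t).ofReal_comp.mul_const I).const_add (β : ℂ)
  simpa using this

theorem integral_vertical_inv {β : ℝ} (hβ : β ≠ 0) (T : ℝ) :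
    ∫ t in (-T)..T, ((β : ℂ) + t * I)⁻¹ = ((2 * Real.arctan (T / β) : ℝ) : ℂ) := by
  have hpos : ∀ t : ℝ, 0 < β ^ 2 + t ^ 2 := fun t => by positivity
  -- Real and imaginary part of a primitive; the logarithm is even in `t` and drops out of the
  -- symmetric integral.
  have hd : ∀ t : ℝ, HasDerivAt (fun t : ℝ => ((Real.arctan (t / β) : ℝ) : ℂ)
      - ((1 / 2 * Real.log (β ^ 2 + t ^ 2) : ℝ) : ℂ) * I) (((β : ℂ) + t * I)⁻¹) t := fun t => by
    have h1 : HasDerivAt (fun t : ℝ => Real.arctan (t / β)) (1 / (1 + (t / β) ^ 2) * (1 / β)) t :=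
      ((hasDerivAt_id t).div_const β).arctan
    have h2 : HasDerivAt (fun t : ℝ => 1 / 2 * Real.log (β ^ 2 + t ^ 2))
        (1 / 2 * ((2 * t) / (β ^ 2 + t ^ 2))) t := by
      have := ((((hasDerivAt_id t).pow 2).const_add (β ^ 2)).log (hpos t).ne').const_mul (1 / 2)
      simpa using this
    refine HasDerivAt.congr_deriv (h1.ofReal_comp.sub (h2.ofReal_comp.mul_const I)) ?_
    have e1 : 1 / (1 + (t / β) ^ 2) * (1 / β) = β / (β ^ 2 + t ^ 2) := by
      have := hpos t
      field_simp
    have e2 : 1 / 2 * ((2 * t) / (β ^ 2 + t ^ 2)) = t / (β ^ 2 + t ^ 2) := by ring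
    rw [e1, e2]
    have h3 : ((β : ℂ) ^ 2 + t ^ 2) ≠ 0 := by exact_mod_cast (hpos t).ne'
    have h4 := vertical_ne_zero hβ t
    push_cast
    rw [div_mul_eq_mul_div, ← sub_div, ← one_div, div_eq_div_iff h3 h4]
    linear_combination -(t : ℂ) ^ 2 * I_sq
  rw [intervalIntegral.integral_eq_sub_of_hasDerivAt (fun t _ => hd t)]
  · rw [neg_div, Real.arctan_neg]
    push_cast
    rw [neg_sq]
    ring
  · exact ((continuous_vertical β).inv₀ (vertical_ne_zero hβ)).intervalIntegrable _ _

theorem norm_vertical_ge (β t : ℝ) : |t| ≤ ‖(β : ℂ) + t * I‖ := by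
  simpa using Complex.abs_im_le_norm ((β : ℂ) + t * I)

theorem tendsto_vertical_inv_pow (β : ℝ) {s : ℝ} (hs : s ≠ 0) (k : ℕ) :
    Tendsto (fun T : ℝ => (((β : ℂ) + ((s * T : ℝ) : ℂ) * I) ^ (k + 1))⁻¹) atTop (𝓝 0) := by
  rw [tendsto_zero_iff_norm_tendsto_zero]
  have h : Tendsto (fun T : ℝ => (|s| * T)⁻¹ ^ (k + 1)) atTop (𝓝 0) := by
    have := (tendsto_inv_atTop_zero.comp
      (tendsto_id.const_mul_atTop (abs_pos.mpr hs))).pow (k + 1)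
    simpa using this
  refine squeeze_zero' (Eventually.of_forall fun _ => norm_nonneg _) ?_ h
  filter_upwards [eventually_gt_atTop 0] with T hT
  rw [norm_inv, norm_pow, ← inv_pow]
  have := norm_vertical_ge β (s * T)
  rw [abs_mul, abs_of_pos hT] at this
  have h0 : 0 < |s| * T := mul_pos (abs_pos.mpr hs) hT
  gcongr

/-- For a higher pole the primitive vanishes at both ends. For a simple pole the arctangent leaves
`π` with the sign of the side on which the line passes. The simple pole is not absolutely
integrable, so symmetric truncations are used up to `integral_strip`. -/
theorem tendsto_integral_vertical_inv_pow {β : ℝ} (hβ : β ≠ 0) (k : ℕ) :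
    Tendsto (fun T : ℝ => ∫ t in (-T)..T, (((β : ℂ) + t * I) ^ (k + 1))⁻¹) atTop
      (𝓝 (if k = 0 then (if 0 < β then Real.pi else -Real.pi : ℝ) else 0 : ℂ)) := by
  by_cases hk : k = 0
  · subst hk
    simp only [zero_add, pow_one, if_true, integral_vertical_inv hβ]
    refine (Complex.continuous_ofReal.tendsto _).comp ?_
    rcases lt_or_gt_of_ne hβ with h | h
    · have := (Real.tendsto_arctan_atBot.mono_right nhdsWithin_le_nhds).comp
        (tendsto_id.atTop_div_const_of_neg h)
      have e : (if 0 < β then Real.pi else -Real.pi) = 2 * -(Real.pi / 2) := by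
        rw [if_neg h.not_gt]
        ring
      rw [e]
      exact this.const_mul 2
    · have := (Real.tendsto_arctan_atTop.mono_right nhdsWithin_le_nhds).comp
        (tendsto_id.atTop_div_const h)
      have e : (if 0 < β then Real.pi else -Real.pi) = 2 * (Real.pi / 2) := by
        rw [if_pos h]
        ring
      rw [e]
      exact this.const_mul 2
  · obtain ⟨j, rfl⟩ := Nat.exists_eq_succ_of_ne_zero hk
    simp only [hk, if_false]
    have hj : ((j : ℂ) + 1) ≠ 0 := by exact_mod_cast j.succ_ne_zero
    have hd : ∀ t : ℝ, HasDerivAt (fun t : ℝ => I / (j + 1) * (((β : ℂ) + t * I) ^ (j + 1))⁻¹)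
        ((((β : ℂ) + t * I) ^ (j.succ + 1))⁻¹) t := fun t => by
      have h0 := vertical_ne_zero hβ t
      have := (((hasDerivAt_vertical β t).pow (j + 1)).inv (pow_ne_zero _ h0)).const_mul (I / (j + 1))
      refine this.congr_deriv ?_
      rw [Nat.add_sub_cancel, Pi.pow_apply]
      push_cast
      rw [neg_mul_eq_mul_neg, div_eq_mul_inv, ← pow_mul]
      have e3 : (((β : ℂ) + t * I) ^ ((j + 1) * 2))⁻¹ * ((β : ℂ) + t * I) ^ j
          = (((β : ℂ) + t * I) ^ (j.succ + 1))⁻¹ := by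
        rw [inv_mul_eq_iff_eq_mul₀ (pow_ne_zero _ h0), eq_mul_inv_iff_mul_eq₀ (pow_ne_zero _ h0),
          ← pow_add]
        congr 1
        rw [Nat.succ_eq_add_one]
        ring
      rw [← e3]
      field_simp
      rw [I_sq]
      ring
    have e : (fun T : ℝ => ∫ t in (-T)..T, (((β : ℂ) + t * I) ^ (j.succ + 1))⁻¹)
        = fun T : ℝ => I / (j + 1) * (((β : ℂ) + ((1 * T : ℝ) : ℂ) * I) ^ (j + 1))⁻¹
          - I / (j + 1) * (((β : ℂ) + ((-1 * T : ℝ) : ℂ) * I) ^ (j + 1))⁻¹ := by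
      funext T
      rw [intervalIntegral.integral_eq_sub_of_hasDerivAt (fun t _ => hd t)]
      · simp
      · exact (((continuous_vertical β).pow _).inv₀ fun t =>
          pow_ne_zero _ (vertical_ne_zero hβ t)).intervalIntegrable _ _
    rw [e]
    simpa using ((tendsto_vertical_inv_pow β one_ne_zero j).const_mul (I / (j + 1))).sub
      ((tendsto_vertical_inv_pow β (neg_ne_zero.mpr one_ne_zero) j).const_mul (I / (j + 1)))

theorem tendsto_integral_vertical_principalPart {β x : ℝ} (hβ : β ≠ x) (n : ℕ) (c : ℕ → ℂ) :
    Tendsto (fun T : ℝ => ∫ t in (-T)..T, principalPart x n c (β + t * I)) atTop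
      (𝓝 (c 0 * (if 0 < β - x then Real.pi else -Real.pi : ℝ))) := by
  have hβ' := sub_ne_zero.mpr hβ
  have e : ∀ t : ℝ, (β : ℂ) + t * I - x = ((β - x : ℝ) : ℂ) + t * I := fun t => by
    push_cast; ring
  have h := tendsto_finsetSum (Finset.range (n + 1)) fun k _ =>
    (tendsto_integral_vertical_inv_pow hβ' k).const_mul (c k)
  have e2 : (∑ k ∈ Finset.range (n + 1), c k * (if k = 0 then
      ((if 0 < β - x then Real.pi else -Real.pi : ℝ) : ℂ) else 0))
      = c 0 * (if 0 < β - x then Real.pi else -Real.pi : ℝ) := by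
    rw [Finset.sum_range_succ']
    simp
  rw [e2] at h
  refine h.congr fun T => ?_
  simp only [principalPart, e]
  rw [intervalIntegral.integral_finsetSum]
  · exact Finset.sum_congr rfl fun k _ => (intervalIntegral.integral_const_mul _ _).symm
  · intro k _
    exact (continuous_const.mul (((continuous_vertical _).pow _).inv₀ fun t =>
      pow_ne_zero _ (vertical_ne_zero hβ' t))).intervalIntegrable _ _

/-- Uniform decay at the ends of the strip `a ≤ Re z ≤ b`. -/
def StripDecay (a b : ℝ) (f : ℂ → ℂ) : Prop :=
  ∀ ε > 0, ∀ᶠ T in atTop, ∀ z : ℂ, z.re ∈ Set.Icc a b → |z.im| = T → ‖f z‖ ≤ ε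

theorem stripDecay_of_exp {a b C : ℝ} {f : ℂ → ℂ}
    (h : ∀ z : ℂ, z.re ∈ Set.Icc a b → 1 ≤ |z.im| → ‖f z‖ ≤ C * Real.exp (-|z.im|)) :
    StripDecay a b f := fun ε hε => by
  have ht : Tendsto (fun T : ℝ => C * Real.exp (-T)) atTop (𝓝 0) := by
    simpa using (Real.tendsto_exp_atBot.comp tendsto_neg_atTop_atBot).const_mul C
  filter_upwards [ht.eventually (gt_mem_nhds hε), eventually_ge_atTop 1] with T h1 h2 z hz hT
  subst hT
  exact (h z hz h2).trans h1.le

theorem stripDecay_principalPart (a b x : ℝ) (n : ℕ) (c : ℕ → ℂ) :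
    StripDecay a b (principalPart x n c) := fun ε hε => by
  have ht : Tendsto (fun T : ℝ => ∑ k ∈ Finset.range (n + 1), ‖c k‖ * T⁻¹ ^ (k + 1)) atTop (𝓝 0) := by
    have := tendsto_finsetSum (Finset.range (n + 1)) fun k _ =>
      ((tendsto_inv_atTop_zero (𝕜 := ℝ)).pow (k + 1)).const_mul ‖c k‖
    simpa using this
  filter_upwards [ht.eventually (gt_mem_nhds hε), eventually_gt_atTop 0] with T h1 h2 z _ hT
  refine (norm_sum_le _ _).trans ((Finset.sum_le_sum fun k _ => ?_).trans h1.le)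
  rw [norm_mul, norm_inv, norm_pow, ← inv_pow]
  have : T ≤ ‖z - x‖ := by
    rw [← hT]
    simpa using Complex.abs_im_le_norm (z - x)
  gcongr

/-- Cauchy's theorem on the rectangle of height `2T`; the decay kills the horizontal sides. -/
theorem tendsto_strip_of_differentiable {a b : ℝ} (hab : a < b) {f : ℂ → ℂ}
    (hf : ∀ z : ℂ, z.re ∈ Set.Icc a b → DifferentiableAt ℂ f z) (hdec : StripDecay a b f) :
    Tendsto (fun T : ℝ => (∫ t in (-T)..T, f (b + t * I)) - ∫ t in (-T)..T, f (a + t * I)) atTop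
      (𝓝 0) := by
  rw [Metric.tendsto_nhds]
  intro ε hε
  have hba : 0 < b - a := sub_pos.mpr hab
  filter_upwards [hdec (ε / (4 * (b - a))) (by positivity), eventually_gt_atTop 0] with T hT hT0
  have hr := Complex.integral_boundary_rect_eq_zero_of_differentiableOn f
    (⟨a, -T⟩ : ℂ) (⟨b, T⟩ : ℂ) (fun z hz => (hf z (by
      have := hz.1
      rwa [Set.mem_preimage, Set.uIcc_of_le hab.le] at this)).differentiableWithinAt)
  simp only [smul_eq_mul] at hr
  have hb : ∀ s : ℝ, |s| = T → ‖∫ x in a..b, f (x + s * I)‖ ≤ ε / 4 := fun s hs => by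
    have := intervalIntegral.norm_integral_le_of_norm_le_const (a := a) (b := b)
      (f := fun x : ℝ => f (x + s * I)) (C := ε / (4 * (b - a))) fun x hx => by
        rw [Set.uIoc_of_le hab.le] at hx
        exact hT _ (by simpa using Set.Ioc_subset_Icc_self hx) (by simpa using hs)
    rw [abs_of_pos hba] at this
    refine this.trans_eq ?_
    field_simp
  have h1 := hb T (abs_of_pos hT0)
  have h2 := hb (-T) (by rw [abs_neg, abs_of_pos hT0])
  have e : I * ((∫ t in (-T)..T, f (b + t * I)) - ∫ t in (-T)..T, f (a + t * I))
      = (∫ x in a..b, f (x + T * I)) - ∫ x in a..b, f (x + (-T : ℝ) * I) := by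
    linear_combination hr
  rw [dist_zero_right]
  calc _ = ‖I * ((∫ t in (-T)..T, f (b + t * I)) - ∫ t in (-T)..T, f (a + t * I))‖ := by
        rw [norm_mul, norm_I, one_mul]
    _ ≤ ε / 4 + ε / 4 := by
        rw [e]
        exact (norm_sub_le _ _).trans (add_le_add h1 h2)
    _ < ε := by linarith

/-- Induction on the number of poles: one principal part is subtracted and the removable singularity
filled in. Principal parts decay at the ends of the strip too, and their line integrals are
explicit, so no small circles have to be joined to the boundary. -/
theorem tendsto_strip {a b : ℝ} (hab : a < b) (P : Finset ℝ) : ∀ {f : ℂ → ℂ},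
    (∀ x ∈ P, x ∈ Set.Ioo a b) →
    (∀ z : ℂ, z.re ∈ Set.Icc a b → (∀ x ∈ P, z ≠ x) → DifferentiableAt ℂ f z) →
    (∀ x ∈ P, MeromorphicAt f x) → StripDecay a b f →
    Tendsto (fun T : ℝ => (∫ t in (-T)..T, f (b + t * I)) - ∫ t in (-T)..T, f (a + t * I)) atTop
      (𝓝 (2 * Real.pi * ∑ x ∈ P, residue f x)) := by
  classical
  induction P using Finset.induction_on with
  | empty =>
    intro f _ hf _ hdec
    simpa using tendsto_strip_of_differentiable hab (fun z hz => hf z hz (by simp)) hdec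
  | insert x P hx ih =>
    intro f hP hf hm hdec
    obtain ⟨n, c, h, hh, hfe⟩ := (hm x (by simp)).exists_principalPart
    have hxI := hP x (by simp)
    set g : ℂ → ℂ := Function.update (fun z => f z - principalPart x n c z) x (h x) with hg
    have hg_ne : ∀ z : ℂ, z ≠ x → g z = f z - principalPart x n c z := fun z hz => by
      rw [hg, Function.update_of_ne hz]
    have hg_ev : ∀ z : ℂ, z ≠ x → g =ᶠ[𝓝 z] fun z => f z - principalPart x n c z := fun z hz => by
      filter_upwards [isOpen_ne.mem_nhds hz] with w hw using hg_ne w hw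
    have hg_x : g =ᶠ[𝓝 (x : ℂ)] h := by
      rw [Filter.EventuallyEq, ← nhdsNE_sup_pure, eventually_sup, eventually_pure]
      refine ⟨?_, by rw [hg, Function.update_self]⟩
      filter_upwards [hfe, self_mem_nhdsWithin] with z hz hzx
      rw [hg_ne z hzx, hz, add_sub_cancel_left]
    have hppd : ∀ z : ℂ, z ≠ x → AnalyticAt ℂ (principalPart x n c) z := fun z hz => by
      refine Finset.analyticAt_fun_sum _ fun k _ => analyticAt_const.mul ?_
      exact ((analyticAt_id.sub analyticAt_const).pow _).inv (pow_ne_zero _ (sub_ne_zero.mpr hz))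
    have hres : ∀ y ∈ P, MeromorphicAt g y ∧ residue g y = residue f y := fun y hy => by
      have hyx : (y : ℂ) ≠ x := fun h => hx (ofReal_injective h ▸ hy)
      have h1 := (hg_ev y hyx).filter_mono (nhdsWithin_le_nhds (s := {(y : ℂ)}ᶜ))
      have hmy := hm y (by simp [hy])
      refine ⟨(hmy.sub (hppd y hyx).meromorphicAt).congr h1.symm, ?_⟩
      have h2 := (hmy.hasResidue.sub (hasResidue_principalPart x y n c)).congr h1.symm
      rw [h2.residue_eq, if_neg hyx, sub_zero]
    have hgd : ∀ z : ℂ, z.re ∈ Set.Icc a b → (∀ x ∈ P, z ≠ x) → DifferentiableAt ℂ g z := by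
      intro z hz hzP
      by_cases hzx : z = x
      · rw [hzx]
        exact hg_x.differentiableAt_iff.mpr hh.differentiableAt
      · refine (hg_ev z hzx).differentiableAt_iff.mpr ((hf z hz ?_).sub (hppd z hzx).differentiableAt)
        intro y hy
        rcases Finset.mem_insert.mp hy with rfl | hy
        · exact hzx
        · exact hzP y hy
    have hgdec : StripDecay a b g := fun ε hε => by
      filter_upwards [hdec (ε / 2) (half_pos hε), stripDecay_principalPart a b x n c (ε / 2) (half_pos hε),
        eventually_gt_atTop 0] with T h1 h2 h3 z hz hT
      have hzx : z ≠ x := by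
        rintro rfl
        simp at hT
        exact h3.ne hT
      rw [hg_ne z hzx]
      exact (norm_sub_le _ _).trans (by linarith [h1 z hz hT, h2 z hz hT])
    have key := ih (fun y hy => hP y (by simp [hy])) hgd (fun y hy => (hres y hy).1) hgdec
    have hline : ∀ β ∈ ({a, b} : Set ℝ), β ≠ x ∧ (∀ y ∈ P, β ≠ y) ∧ β ∈ Set.Icc a b := by
      intro β hβ
      have : ∀ y ∈ Set.Ioo a b, β ≠ y := fun y hy => by
        rcases hβ with rfl | rfl
        · exact hy.1.ne
        · exact hy.2.ne'
      refine ⟨this x hxI, fun y hy => this y (hP y (by simp [hy])), ?_⟩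
      rcases hβ with rfl | rfl
      · exact Set.left_mem_Icc.mpr hab.le
      · exact Set.right_mem_Icc.mpr hab.le
    have hne : ∀ (β y t : ℝ), β ≠ y → (β : ℂ) + t * I ≠ y := fun β y t h h0 => h (by
      simpa using congrArg Complex.re h0)
    have hsplit : ∀ β ∈ ({a, b} : Set ℝ), ∀ T : ℝ, ∫ t in (-T)..T, f (β + t * I)
        = (∫ t in (-T)..T, g (β + t * I)) + ∫ t in (-T)..T, principalPart x n c (β + t * I) := by
      intro β hβ T
      obtain ⟨h1, h2, h3⟩ := hline β hβ
      rw [← intervalIntegral.integral_add]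
      · refine intervalIntegral.integral_congr fun t _ => ?_
        simp only [hg_ne _ (hne β x t h1), sub_add_cancel]
      · refine Continuous.intervalIntegrable (continuous_iff_continuousAt.mpr fun t => ?_) _ _
        exact ContinuousAt.comp (f := fun t : ℝ => (β : ℂ) + t * I) (hgd _ (by simpa using h3)
          fun y hy => hne β y t (h2 y hy)).continuousAt (continuous_vertical β).continuousAt
      · refine Continuous.intervalIntegrable (continuous_iff_continuousAt.mpr fun t => ?_) _ _
        exact ContinuousAt.comp (f := fun t : ℝ => (β : ℂ) + t * I)
          (hppd _ (hne β x t h1)).continuousAt (continuous_vertical β).continuousAt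
    -- The line on the right of `x` contributes `π c 0`, the one on the left `-π c 0`.
    have hpp := (tendsto_integral_vertical_principalPart hxI.2.ne' n c).sub
      (tendsto_integral_vertical_principalPart hxI.1.ne n c)
    have e : (fun T : ℝ => (∫ t in (-T)..T, f (b + t * I)) - ∫ t in (-T)..T, f (a + t * I))
        = fun T : ℝ => ((∫ t in (-T)..T, g (b + t * I)) - ∫ t in (-T)..T, g (a + t * I))
          + ((∫ t in (-T)..T, principalPart x n c (b + t * I))
            - ∫ t in (-T)..T, principalPart x n c (a + t * I)) := by
      funext T
      rw [hsplit b (by simp), hsplit a (by simp)]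
      ring
    rw [e]
    convert key.add hpp using 2
    rw [Finset.sum_insert hx, (hasResidue_of_eventuallyEq hh hfe).residue_eq,
      Finset.sum_congr rfl fun y hy => (hres y hy).2, if_pos (sub_pos.mpr hxI.2),
      if_neg (sub_neg.mpr hxI.1).not_gt]
    push_cast
    ring

/-- The residue theorem for a vertical strip. -/
theorem integral_strip {a b : ℝ} (hab : a < b) (P : Finset ℝ) {f : ℂ → ℂ}
    (hP : ∀ x ∈ P, x ∈ Set.Ioo a b)
    (hf : ∀ z : ℂ, z.re ∈ Set.Icc a b → (∀ x ∈ P, z ≠ x) → DifferentiableAt ℂ f z)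
    (hm : ∀ x ∈ P, MeromorphicAt f x) {C : ℝ}
    (hdec : ∀ z : ℂ, z.re ∈ Set.Icc a b → 1 ≤ |z.im| → ‖f z‖ ≤ C * Real.exp (-|z.im|)) :
    (∫ t : ℝ, f (b + t * I)) - ∫ t : ℝ, f (a + t * I) = 2 * Real.pi * ∑ x ∈ P, residue f x := by
  have hint : ∀ β ∈ ({a, b} : Set ℝ), Integrable fun t : ℝ => f (β + t * I) := by
    intro β hβ
    have h3 : β ∈ Set.Icc a b := by
      rcases hβ with rfl | rfl
      · exact Set.left_mem_Icc.mpr hab.le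
      · exact Set.right_mem_Icc.mpr hab.le
    refine integrable_of_norm_le_exp_neg_abs (C := C) (continuous_iff_continuousAt.mpr fun t => ?_)
      fun t ht => ?_
    · refine ContinuousAt.comp (f := fun t : ℝ => (β : ℂ) + t * I) (hf _ (by simpa using h3) ?_).continuousAt
        (continuous_vertical β).continuousAt
      intro y hy h0
      have h1 := hP y hy
      have h2 : β = y := by simpa using congrArg Complex.re h0
      subst h2
      rcases hβ with rfl | rfl
      · exact h1.1.ne rfl
      · exact h1.2.ne rfl
    · simpa using hdec (β + t * I) (by simpa using h3) (by simpa using ht)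
  refine tendsto_nhds_unique ?_ (tendsto_strip hab P hP hf hm (stripDecay_of_exp hdec))
  exact (intervalIntegral_tendsto_integral (hint b (by simp)) tendsto_neg_atTop_atBot tendsto_id).sub
    (intervalIntegral_tendsto_integral (hint a (by simp)) tendsto_neg_atTop_atBot tendsto_id)

end Strip

/-! ### Poles of the Mellin-Barnes kernel -/

section Kernel

variable {a b c : ℝ} {F G : ℂ → ℂ}

theorem analyticAt_Gamma {z : ℂ} (h : ∀ k : ℕ, z ≠ -k) : AnalyticAt ℂ Gamma z := by
  have h1 : AnalyticAt ℂ (fun z => (Gamma z)⁻¹) z := differentiable_one_div_Gamma.analyticAt z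
  have h2 := h1.inv (inv_ne_zero (Gamma_ne_zero h))
  have e : (fun z => (Gamma z)⁻¹)⁻¹ = Gamma := by
    funext z
    simp
  rwa [e] at h2

theorem analyticAt_Gamma_add {a : ℝ} {z : ℂ} (h : ∀ k : ℕ, (a : ℂ) + z ≠ -k) :
    AnalyticAt ℂ (fun z => Gamma (a + z)) z :=
  (analyticAt_Gamma h).fun_comp (analyticAt_const.add analyticAt_id)

theorem analyticAt_Gamma_sub {a : ℝ} {z : ℂ} (h : ∀ k : ℕ, (a : ℂ) - z ≠ -k) :
    AnalyticAt ℂ (fun z => Gamma (a - z)) z :=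
  (analyticAt_Gamma h).fun_comp (analyticAt_const.sub analyticAt_id)

theorem analyticAt_gammaPM {a : ℝ} {z : ℂ} (h1 : ∀ k : ℕ, (a : ℂ) + z ≠ -k)
    (h2 : ∀ k : ℕ, (a : ℂ) - z ≠ -k) : AnalyticAt ℂ (gammaPM a) z :=
  (analyticAt_Gamma_add h1).mul (analyticAt_Gamma_sub h2)

theorem meromorphicAt_gammaPM (a : ℝ) (z : ℂ) : MeromorphicAt (gammaPM a) z := by
  refine MeromorphicAt.mul ?_ ?_
  · exact (Meromorphic.Gamma _).comp_analyticAt (analyticAt_const.add analyticAt_id)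
  · exact (Meromorphic.Gamma _).comp_analyticAt (analyticAt_const.sub analyticAt_id)

theorem analyticAt_sin_two_pi_mul (hF : Differentiable ℂ F) (z : ℂ) :
    AnalyticAt ℂ (fun α => sin (2 * Real.pi * α) * F α) z :=
  Differentiable.analyticAt (by fun_prop) z

theorem meromorphicAt_kern (a b c : ℝ) (hF : Differentiable ℂ F) (z : ℂ) :
    MeromorphicAt (kern a b c F) z :=
  (((meromorphicAt_gammaPM a z).mul (meromorphicAt_gammaPM b z)).mul
    (meromorphicAt_gammaPM c z)).mul (analyticAt_sin_two_pi_mul hF z).meromorphicAt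

theorem gammaPM_neg (a : ℝ) (α : ℂ) : gammaPM a (-α) = gammaPM a α := by
  rw [gammaPM, gammaPM, sub_neg_eq_add, ← sub_eq_add_neg, mul_comm]

theorem kern_neg (a b c : ℝ) (F : ℂ → ℂ) (α : ℂ) :
    kern a b c F (-α) = -kern a b c (fun β => F (-β)) α := by
  simp only [kern, gammaPM_neg, mul_neg, Complex.sin_neg, neg_mul]

theorem kern_swap_one_two (a b c : ℝ) (F : ℂ → ℂ) : kern a b c F = kern b a c F := by
  funext α
  simp only [kern]
  ring

theorem kern_swap_one_three (a b c : ℝ) (F : ℂ → ℂ) : kern a b c F = kern c b a F := by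
  funext α
  simp only [kern]
  ring

theorem triple_swap_one_two (a b c : ℝ) : ({a, b, c} : Set ℝ) = {b, a, c} := Set.insert_comm _ _ _

theorem triple_swap_one_three (a b c : ℝ) : ({a, b, c} : Set ℝ) = {c, b, a} := by
  ext x
  simp only [Set.mem_insert_iff, Set.mem_singleton_iff]
  tauto

theorem neg_mem_leftPoles {A : Set ℝ} {x : ℝ} : -x ∈ leftPoles A ↔ x ∈ rightPoles A := by
  refine exists_congr fun a => and_congr_right fun _ => exists_congr fun k => ?_
  constructor <;> intro h <;> linarith

theorem neg_mem_rightPoles {A : Set ℝ} {x : ℝ} : -x ∈ rightPoles A ↔ x ∈ leftPoles A := by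
  rw [← neg_mem_leftPoles, neg_neg]

theorem add_ne_neg_of_notMem {A : Set ℝ} {a : ℝ} (ha : a ∈ A) {z : ℂ}
    (hz : ∀ x ∈ leftPoles A, z ≠ x) (k : ℕ) : (a : ℂ) + z ≠ -k := fun h =>
  hz (-a - k) ⟨a, ha, k, rfl⟩ (by push_cast; linear_combination h)

theorem sub_ne_neg_of_notMem {A : Set ℝ} {a : ℝ} (ha : a ∈ A) {z : ℂ}
    (hz : ∀ x ∈ rightPoles A, z ≠ x) (k : ℕ) : (a : ℂ) - z ≠ -k := fun h =>
  hz (a + k) ⟨a, ha, k, rfl⟩ (by push_cast; linear_combination -h)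

theorem analyticAt_kern (hF : Differentiable ℂ F) {z : ℂ}
    (hL : ∀ x ∈ leftPoles {a, b, c}, z ≠ x) (hR : ∀ x ∈ rightPoles {a, b, c}, z ≠ x) :
    AnalyticAt ℂ (kern a b c F) z := by
  have h : ∀ a' ∈ ({a, b, c} : Set ℝ), AnalyticAt ℂ (gammaPM a') z := fun a' ha' =>
    analyticAt_gammaPM (add_ne_neg_of_notMem ha' hL) (sub_ne_neg_of_notMem ha' hR)
  exact (((h a (by simp)).mul (h b (by simp))).mul (h c (by simp))).mul
    (analyticAt_sin_two_pi_mul hF z)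

/-- When `2a` is an integer, `sin 2πα` equals `sin 2π(a-α)` up to sign, and the double-angle formula
supplies the factor `sin π(a-α)` that cancels the poles in the reflection formula. -/
theorem Gamma_sub_mul_sin {a : ℝ} {m : ℤ} (hm : 2 * a = m) {α : ℂ}
    (h : sin (Real.pi * (a - α)) ≠ 0) : Gamma (a - α) * sin (2 * Real.pi * α)
      = -(cos (m * Real.pi) * (2 * Real.pi * cos (Real.pi * (a - α)) * (Gamma (1 - (a - α)))⁻¹)) := by
  have h1 := Gamma_mul_Gamma_one_sub ((a : ℂ) - α)
  have h2 : Gamma (1 - (a - α)) ≠ 0 := fun h0 => by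
    rw [h0, mul_zero, eq_comm, div_eq_zero_iff] at h1
    rcases h1 with h1 | h1
    · exact Real.pi_ne_zero (by exact_mod_cast h1)
    · exact h h1
  have h3 : sin (2 * Real.pi * α)
      = -(cos (m * Real.pi) * (2 * sin (Real.pi * (a - α)) * cos (Real.pi * (a - α)))) := by
    have hm' : (2 : ℂ) * a = m := by exact_mod_cast hm
    have e : 2 * (Real.pi : ℂ) * α = m * Real.pi - 2 * (Real.pi * (a - α)) := by
      linear_combination (Real.pi : ℂ) * hm'
    rw [e, Complex.sin_sub, Complex.sin_int_mul_pi, Complex.sin_two_mul]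
    ring
  have h4 : Gamma (a - α) = Real.pi / sin (Real.pi * (a - α)) * (Gamma (1 - (a - α)))⁻¹ := by
    rw [← h1, mul_inv_cancel_right₀ h2]
  rw [h3, h4]
  field_simp

theorem eventually_sin_ne_zero (a : ℝ) (y : ℂ) : ∀ᶠ α in 𝓝[≠] y, sin (Real.pi * (a - α)) ≠ 0 := by
  have hd : Differentiable ℂ fun α : ℂ => sin (Real.pi * (a - α)) := by fun_prop
  have han : AnalyticOnNhd ℂ (fun α : ℂ => sin (Real.pi * (a - α))) Set.univ := fun z _ =>
    hd.analyticAt z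
  rcases (han y trivial).eventually_eq_zero_or_eventually_ne_zero with h | h
  · exfalso
    -- At `α = a - 1/2` the sine equals `1`, which contradicts the identity theorem.
    have h0 := han.eqOn_zero_of_preconnected_of_eventuallyEq_zero isPreconnected_univ
      (Set.mem_univ y) h (Set.mem_univ ((a : ℂ) - 1 / 2))
    simp only [Pi.zero_apply, sub_sub_cancel] at h0
    rw [mul_one_div, Complex.sin_pi_div_two] at h0
    exact one_ne_zero h0
  · exact h

/-- `Γ(a - α) sin(2πα)` has no singularities if `2a` is an integer. -/
theorem exists_analyticAt_Gamma_sub_mul_sin {a : ℝ} {m : ℤ} (hm : 2 * a = m) (y : ℂ) :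
    ∃ h : ℂ → ℂ, AnalyticAt ℂ h y ∧
      (fun α => Gamma (a - α) * sin (2 * Real.pi * α)) =ᶠ[𝓝[≠] y] h := by
  refine ⟨fun α => -(cos (m * Real.pi) * (2 * Real.pi * cos (Real.pi * (a - α))
    * (Gamma (1 - (a - α)))⁻¹)), ?_, ?_⟩
  · have h1 : Differentiable ℂ fun α : ℂ => (Gamma (1 - (a - α)))⁻¹ :=
      differentiable_one_div_Gamma.comp (f := fun α : ℂ => 1 - (a - α)) (by fun_prop)
    exact Differentiable.analyticAt (by fun_prop) y
  · filter_upwards [eventually_sin_ne_zero a y] with α hα using Gamma_sub_mul_sin hm hα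

/-- The point `1 - a` is the left pole that disappears when `a - 1` is raised to `a`. There `Γ(b-α)`
and `Γ(c-α)` are regular by hypothesis, and so are the factors `Γ(· + α)` because it is no left
pole. If `Γ(a-α)` is singular, then `2a` is an integer and the sine cancels its pole. -/
theorem residue_kern_one_sub (hF : Differentiable ℂ F) (hab : ∀ k : ℕ, b + a - 1 ≠ -k)
    (hac : ∀ k : ℕ, c + a - 1 ≠ -k) (hL : 1 - a ∉ leftPoles {a, b, c}) :
    residue (kern a b c F) ((1 - a : ℝ) : ℂ) = 0 := by
  set y : ℂ := ((1 - a : ℝ) : ℂ) with hy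
  have hL' : ∀ x ∈ leftPoles {a, b, c}, y ≠ x := fun x hx h => hL (ofReal_injective h ▸ hx)
  have h1 : ∀ a' ∈ ({a, b, c} : Set ℝ), AnalyticAt ℂ (fun z => Gamma (a' + z)) y := fun a' ha' =>
    analyticAt_Gamma_add (add_ne_neg_of_notMem ha' hL')
  have h2 : ∀ b' : ℝ, (∀ k : ℕ, b' + a - 1 ≠ -k) → AnalyticAt ℂ (fun z => Gamma (b' - z)) y :=
    fun b' hb' => analyticAt_Gamma_sub fun k h => hb' k (by
      have : ((b' + a - 1 : ℝ) : ℂ) = ((-k : ℝ) : ℂ) := by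
        rw [hy] at h
        push_cast at h ⊢
        linear_combination h
      exact ofReal_injective this)
  have h3 : ∃ h : ℂ → ℂ, AnalyticAt ℂ h y ∧
      (fun α => Gamma (a - α) * sin (2 * Real.pi * α)) =ᶠ[𝓝[≠] y] h := by
    by_cases ha : ∀ k : ℕ, a + a - 1 ≠ -k
    · exact ⟨_, (h2 a ha).mul (Differentiable.analyticAt (by fun_prop) y), EventuallyEq.rfl⟩
    · push Not at ha
      obtain ⟨k, hk⟩ := ha
      exact exists_analyticAt_Gamma_sub_mul_sin (m := 1 - k) (by push_cast; linarith) y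
  obtain ⟨h, hh, he⟩ := h3
  have hkern : (fun α => Gamma (a + α) * (Gamma (b + α) * Gamma (b - α)) *
      (Gamma (c + α) * Gamma (c - α)) * (h α * F α)) =ᶠ[𝓝[≠] y] kern a b c F := by
    filter_upwards [he] with α hα
    rw [← hα, kern, gammaPM, gammaPM, gammaPM]
    ring
  refine (HasResidue.congr (HasResidue.of_analyticAt ?_) hkern).residue_eq
  exact (((h1 a (by simp)).mul ((h1 b (by simp)).mul (h2 b hab))).mul
    ((h1 c (by simp)).mul (h2 c hac))).mul (hh.mul (hF.analyticAt y))

/-- `Γ(-m ± α)` has a double pole at the origin. One pole is cancelled by the sine; the other by the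
factor `α`, since `α Γ(-m+α) = Γ(α+1) / (-m+α)_m`. -/
theorem exists_analyticAt_mul_gammaPM_mul_sin (m : ℕ) : ∃ h : ℂ → ℂ, AnalyticAt ℂ h 0 ∧
    (fun α => α * (gammaPM (-m) α * sin (2 * Real.pi * α))) =ᶠ[𝓝[≠] 0] h := by
  obtain ⟨h, hh, he⟩ := exists_analyticAt_Gamma_sub_mul_sin (a := -m) (m := -(2 * m))
    (by push_cast; ring) 0
  have hp : poch (((-m : ℝ) : ℂ) + 0) m ≠ 0 := by
    rw [add_zero]
    push_cast
    rw [poch_neg_natCast le_rfl, Nat.sub_self, Nat.factorial_zero, Nat.cast_one, div_one]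
    exact mul_ne_zero (pow_ne_zero _ (by norm_num)) (by exact_mod_cast m.factorial_ne_zero)
  refine ⟨fun α => Gamma (α + 1) / poch (((-m : ℝ) : ℂ) + α) m * h α, ?_, ?_⟩
  · refine (AnalyticAt.div ?_ ((differentiable_poch_add _ m).analyticAt 0) hp).mul hh
    refine (analyticAt_Gamma fun k hk => ?_).fun_comp (analyticAt_id.add analyticAt_const)
    have : ((k + 1 : ℕ) : ℂ) = 0 := by
      push_cast
      linear_combination hk
    exact k.succ_ne_zero (by exact_mod_cast this)
  · have hne : ∀ᶠ α : ℂ in 𝓝[≠] 0, poch (((-m : ℝ) : ℂ) + α) m ≠ 0 :=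
      (((differentiable_poch_add _ m).continuous.tendsto 0).eventually_ne hp).filter_mono
        nhdsWithin_le_nhds
    have hball : ∀ᶠ α : ℂ in 𝓝[≠] 0, ‖α‖ < 1 := by
      have := Metric.ball_mem_nhds (0 : ℂ) one_pos
      filter_upwards [nhdsWithin_le_nhds this] with α hα
      simpa using hα
    filter_upwards [he, hne, hball, self_mem_nhdsWithin] with α hα hpα hα1 hα0
    have hα0 : α ≠ 0 := hα0
    rw [← hα, gammaPM]
    have hz : ∀ k : ℕ, ((-m : ℝ) : ℂ) + α ≠ -k := fun k hk => by
      have e : α = ((m - k : ℤ) : ℂ) := by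
        push_cast at hk ⊢
        linear_combination hk
      rw [e, norm_intCast] at hα1
      have h0 : (m : ℤ) - k = 0 := by
        rw [← Int.abs_lt_one_iff]
        exact_mod_cast hα1
      rw [h0] at e
      exact hα0 (by simpa using e)
    have e1 := Gamma_add_natCast_eq hz m
    have e2 : ((-m : ℝ) : ℂ) + α + m = α := by push_cast; ring
    rw [e2] at e1
    rw [Gamma_add_one _ hα0, e1]
    field_simp

end Kernel

/-! ### The functional `mbInt` for admissible parameters -/

section Functional

variable {a b c : ℝ} {E G : ℂ → ℂ}

/-- No left pole of one Gamma factor coincides with a right pole of another one. -/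
structure Admissible (a b c : ℝ) : Prop where
  ab : ∀ k : ℕ, a + b ≠ -k
  ac : ∀ k : ℕ, a + c ≠ -k
  bc : ∀ k : ℕ, b + c ≠ -k

namespace Admissible

theorem swap_one_two (h : Admissible a b c) : Admissible b a c where
  ab k := by rw [add_comm]; exact h.ab k
  ac := h.bc
  bc := h.ac

theorem swap_one_three (h : Admissible a b c) : Admissible c b a where
  ab k := by rw [add_comm]; exact h.bc k
  ac k := by rw [add_comm]; exact h.ac k
  bc k := by rw [add_comm]; exact h.ab k

theorem add_one (h : Admissible a b c) : Admissible (a + 1) b c where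
  ab k hk := h.ab (k + 1) (by push_cast; linarith)
  ac k hk := h.ac (k + 1) (by push_cast; linarith)
  bc := h.bc

theorem add_natCast (h : Admissible a b c) (n : ℕ) : Admissible (a + n) b c := by
  induction n with
  | zero => simpa using h
  | succ n ih =>
    have := ih.add_one
    rwa [add_assoc, ← Nat.cast_succ] at this

theorem add_half (h : Admissible a b c) : Admissible (a + 1 / 2) (b + 1 / 2) (c + 1 / 2) where
  ab k hk := h.ab (k + 1) (by push_cast; linarith)
  ac k hk := h.ac (k + 1) (by push_cast; linarith)
  bc k hk := h.bc (k + 1) (by push_cast; linarith)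

/-- Admissibility excludes collisions between two different Gamma factors, so a common pole of both
families comes from a single parameter value. -/
theorem eq_of_mem (h : Admissible a b c) {x y : ℝ} (hx : x ∈ ({a, b, c} : Set ℝ))
    (hy : y ∈ ({a, b, c} : Set ℝ)) {k : ℕ} (hk : x + y = -k) : x = y := by
  have h1 := h.ab k
  have h2 := h.ac k
  have h3 := h.bc k
  rcases hx with rfl | rfl | rfl <;> rcases hy with rfl | rfl | rfl <;>
    first | rfl | exact absurd hk ‹_› | exact absurd ((add_comm _ _).trans hk) ‹_›

theorem exists_int (h : Admissible a b c) {x : ℝ} (hL : x ∈ leftPoles {a, b, c})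
    (hR : x ∈ rightPoles {a, b, c}) : ∃ m : ℤ, 2 * x = m := by
  obtain ⟨p, hp, j, hj⟩ := hL
  obtain ⟨q, hq, k, hk⟩ := hR
  have := h.eq_of_mem hp hq (k := j + k) (by push_cast; linarith)
  exact ⟨k - j, by push_cast; linarith⟩

/-- A collision of a parameter `p` with itself forces `2x` to be an integer. Conversely `x = -p - j`
and `2x = m ≥ 0` give `x = p + (m + j)`. Thus the weight of a nonnegative left pole depends on `x`
only and not on the parameters, which makes it invariant under the shifts below. -/
theorem mem_inter_iff (h : Admissible a b c) {x : ℝ} (hL : x ∈ leftPoles {a, b, c}) (hx : 0 ≤ x) :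
    x ∈ rightPoles {a, b, c} ∩ leftPoles {a, b, c} ↔ ∃ m : ℤ, 2 * x = m := by
  refine ⟨fun hx => h.exists_int hx.2 hx.1, fun ⟨m, hm⟩ => ⟨?_, hL⟩⟩
  obtain ⟨p, hp, j, hj⟩ := hL
  have hm0 : 0 ≤ m := by
    have : (0 : ℝ) ≤ m := by linarith
    exact_mod_cast this
  lift m to ℕ using hm0
  exact ⟨p, hp, m + j, by push_cast at hm ⊢; linarith⟩

end Admissible

theorem finite_leftPoles (a b c x₀ : ℝ) : {x | x ∈ leftPoles {a, b, c} ∧ x₀ < x}.Finite := by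
  obtain ⟨N, hN⟩ := exists_nat_ge (max (-a - x₀) (max (-b - x₀) (-c - x₀)))
  have h1 := (le_max_left _ _).trans hN
  have h2 := ((le_max_left _ _).trans (le_max_right _ _)).trans hN
  have h3 := ((le_max_right _ _).trans (le_max_right _ _)).trans hN
  refine ((Set.toFinite ({a, b, c} : Set ℝ)).prod (Set.finite_Iio N)).image
    (fun p : ℝ × ℕ => -p.1 - p.2) |>.subset ?_
  rintro x ⟨⟨p, hp, k, rfl⟩, hx⟩
  refine ⟨(p, k), ⟨hp, ?_⟩, rfl⟩
  have : (k : ℝ) < N := by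
    rcases hp with rfl | rfl | rfl <;> linarith
  exact_mod_cast this

/-- The left poles to the right of `x₀`. -/
noncomputable def leftPolesGT (a b c x₀ : ℝ) : Finset ℝ := (finite_leftPoles a b c x₀).toFinset

theorem mem_leftPolesGT {x₀ x : ℝ} : x ∈ leftPolesGT a b c x₀ ↔ x ∈ leftPoles {a, b, c} ∧ x₀ < x := by
  simp [leftPolesGT]

open Classical in
/-- The weight of a pole for admissible parameters. -/
noncomputable def halfWeight (x : ℝ) : ℂ := if ∃ m : ℤ, 2 * x = m then 1 / 2 else 1

theorem halfWeight_add_half (x : ℝ) : halfWeight (x + 1 / 2) = halfWeight x := by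
  have : (∃ m : ℤ, 2 * (x + 1 / 2) = m) ↔ ∃ m : ℤ, 2 * x = m := by
    constructor
    · rintro ⟨m, hm⟩
      exact ⟨m - 1, by push_cast; linarith⟩
    · rintro ⟨m, hm⟩
      exact ⟨m + 1, by push_cast; linarith⟩
  classical exact if_congr this rfl rfl

theorem Admissible.poleWeight_eq (h : Admissible a b c) {x : ℝ} (hL : x ∈ leftPoles {a, b, c})
    (hx : 0 ≤ x) : poleWeight {a, b, c} x = halfWeight x := by
  classical exact if_congr (h.mem_inter_iff hL hx) rfl rfl

/-- The Mellin-Barnes integral of `Γ(a ± α) Γ(b ± α) Γ(c ± α) α sin(2πα) E(α)`. -/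
noncomputable def mbInt (a b c : ℝ) (E : ℂ → ℂ) : ℂ :=
  mellinBarnes {a, b, c} (kern a b c fun α => α * E α)

theorem StripPoly.differentiable_mul_self (hE : StripPoly E) : Differentiable ℂ fun α => α * E α :=
  differentiable_id.mul hE.differentiable

theorem StripPoly.stripBound_mul_self (hE : StripPoly E) : StripBound fun α => α * E α := by
  simpa using hE.stripBound.mul_self 1

theorem kern_mul_self_neg (hE : StripPoly E) (α : ℂ) :
    kern a b c (fun α => α * E α) (-α) = kern a b c (fun α => α * E α) α := by
  rw [kern_neg]
  simp only [hE.even]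
  simp only [kern]
  ring

/-- The kernel is even, so its residues at `x` and `-x` are opposite, and the right poles in the
left half plane contribute as much as the left poles in the right half plane. -/
theorem mbInt_eq (h : Admissible a b c) (hE : StripPoly E) :
    mbInt a b c E = 1 / (2 * Real.pi) * (∫ t : ℝ, kern a b c (fun α => α * E α) (t * I))
      + 2 * ∑ x ∈ leftPolesGT a b c 0, halfWeight x * residue (kern a b c fun α => α * E α) x := by
  set f := kern a b c fun α => α * E α with hf
  have hm : ∀ z, MeromorphicAt f z := meromorphicAt_kern a b c hE.differentiable_mul_self
  have heven : (fun α => f (-α)) = f := funext fun α => kern_mul_self_neg hE α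
  have hres : ∀ x : ℂ, residue f (-x) = -residue f x := fun x => by
    have := residue_comp_neg (f := f) (x := x) (hm _)
    rw [heven] at this
    rw [this, neg_neg]
  have hw : ∀ x : ℝ, poleWeight {a, b, c} (-x) = poleWeight {a, b, c} x := fun x => by
    classical refine if_congr ?_ rfl rfl
    simp only [Set.mem_inter_iff, neg_mem_leftPoles, neg_mem_rightPoles, and_comm]
  have h1 : (∑ᶠ x ∈ {x : ℝ | x ∈ leftPoles {a, b, c} ∧ 0 < x},
      poleWeight {a, b, c} x * residue f x)
      = ∑ x ∈ leftPolesGT a b c 0, halfWeight x * residue f x := by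
    rw [finsum_mem_eq_finite_toFinset_sum _ (finite_leftPoles a b c 0)]
    refine Finset.sum_congr rfl fun x hx => ?_
    have hx := mem_leftPolesGT.mp hx
    rw [h.poleWeight_eq hx.1 hx.2.le]
  have h2 : (∑ᶠ x ∈ {x : ℝ | x ∈ rightPoles {a, b, c} ∧ x < 0},
      poleWeight {a, b, c} x * residue f x)
      = ∑ᶠ x ∈ {x : ℝ | x ∈ leftPoles {a, b, c} ∧ 0 < x},
        -(poleWeight {a, b, c} x * residue f x) := by
    refine (finsum_mem_eq_of_bijOn (fun x => -x) ⟨?_, neg_injective.injOn, ?_⟩ fun x _ => ?_).symm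
    · rintro x ⟨hx, hx0⟩
      exact ⟨by rwa [← neg_mem_leftPoles, neg_neg], by linarith⟩
    · rintro x ⟨hx, hx0⟩
      exact ⟨-x, ⟨neg_mem_leftPoles.mpr hx, by linarith⟩, neg_neg x⟩
    · rw [hw, ofReal_neg, hres]
      ring
  rw [mbInt, mellinBarnes, ← hf, h2, finsum_mem_neg_distrib _ (finite_leftPoles a b c 0), h1]
  ring

/-- If one parameter is a nonpositive integer, admissibility prevents the other two from being one.
Hence at most a double pole meets the origin, and `α sin(2πα)` removes it. -/
theorem exists_regular_kern (h : Admissible a b c) (hE : Differentiable ℂ E) :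
    ∃ g : ℂ → ℂ, AnalyticAt ℂ g 0 ∧ kern a b c (fun α => α * E α) =ᶠ[𝓝[≠] 0] g := by
  have hd : Differentiable ℂ fun α => α * E α := differentiable_id.mul hE
  have main : ∀ {a b c : ℝ}, Admissible a b c → (∃ m : ℕ, a = -m) →
      ∃ g : ℂ → ℂ, AnalyticAt ℂ g 0 ∧ kern a b c (fun α => α * E α) =ᶠ[𝓝[≠] 0] g := by
    rintro a b c h ⟨m, rfl⟩
    obtain ⟨g, hg, he⟩ := exists_analyticAt_mul_gammaPM_mul_sin m
    have hreg : ∀ b : ℝ, (∀ k : ℕ, -m + b ≠ -k) → AnalyticAt ℂ (gammaPM b) 0 := by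
      intro b hb
      have : ∀ k : ℕ, (b : ℂ) ≠ -k := fun k hk => hb (m + k) (by
        have : b = -(k : ℝ) := by exact_mod_cast hk
        rw [this]
        push_cast
        ring)
      exact analyticAt_gammaPM (by simpa using this) (by simpa using this)
    refine ⟨fun α => g α * (gammaPM b α * gammaPM c α * E α),
      hg.mul (((hreg b h.ab).mul (hreg c h.ac)).mul (hE.analyticAt 0)), ?_⟩
    filter_upwards [he] with α hα
    rw [← hα, kern]
    ring
  by_cases ha : ∃ m : ℕ, a = -m
  · exact main h ha
  by_cases hb : ∃ m : ℕ, b = -m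
  · rw [kern_swap_one_two]
    exact main h.swap_one_two hb
  by_cases hc : ∃ m : ℕ, c = -m
  · rw [kern_swap_one_three]
    exact main h.swap_one_three hc
  · push Not at ha hb hc
    have hall : ∀ p ∈ ({a, b, c} : Set ℝ), ∀ k : ℕ, p ≠ -k := by
      rintro p (rfl | rfl | rfl) <;> assumption
    refine ⟨_, analyticAt_kern hd ?_ ?_, EventuallyEq.rfl⟩
    · rintro x ⟨p, hp, k, rfl⟩ h0
      refine hall p hp k ?_
      have : (0 : ℝ) = -p - k := by exact_mod_cast h0
      linarith
    · rintro x ⟨p, hp, k, rfl⟩ h0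
      refine hall p hp k ?_
      have : (0 : ℝ) = p + k := by exact_mod_cast h0
      linarith

/-- Kernels on the imaginary axis, with the value at the origin corrected. -/
theorem exists_differentiable_kern (h : Admissible a b c) (hE : Differentiable ℂ E) :
    ∃ g : ℂ → ℂ, (∀ z : ℂ, z ≠ 0 → g z = kern a b c (fun α => α * E α) z) ∧
      DifferentiableAt ℂ g 0 ∧ ∀ z : ℂ, z ≠ 0 → (∀ x ∈ leftPoles {a, b, c}, z ≠ x) →
        (∀ x ∈ rightPoles {a, b, c}, z ≠ x) → DifferentiableAt ℂ g z := by
  obtain ⟨g, hg, he⟩ := exists_regular_kern h hE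
  have h1 : ∀ z : ℂ, z ≠ 0 →
      Function.update (kern a b c fun α => α * E α) 0 (g 0) z = kern a b c (fun α => α * E α) z :=
    fun z hz => Function.update_of_ne hz _ _
  refine ⟨Function.update (kern a b c fun α => α * E α) 0 (g 0), h1, ?_, fun z hz hL hR => ?_⟩
  · refine DifferentiableAt.congr_of_eventuallyEq hg.differentiableAt ?_
    rw [Filter.EventuallyEq, ← nhdsNE_sup_pure, eventually_sup, eventually_pure]
    refine ⟨?_, Function.update_self _ _ _⟩
    filter_upwards [he, self_mem_nhdsWithin] with z hz hz0
    rw [h1 z hz0, hz]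
  · refine (analyticAt_kern (differentiable_id.mul hE) hL hR).differentiableAt.congr_of_eventuallyEq ?_
    filter_upwards [isOpen_ne.mem_nhds hz] with w hw using h1 w hw

theorem mul_I_ne_ofReal {t x : ℝ} (ht : t ≠ 0) : (t : ℂ) * I ≠ x := fun h => ht (by
  simpa using congrArg Complex.im h)

theorem ae_ne_zero : ∀ᵐ t : ℝ, t ≠ 0 := by simp [ae_iff]

theorem integrable_kern (h : Admissible a b c) (hE : StripPoly E) :
    Integrable fun t : ℝ => kern a b c (fun α => α * E α) (t * I) := by
  obtain ⟨g, hg, hg0, hgd⟩ := exists_differentiable_kern h hE.differentiable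
  obtain ⟨C, _, hC⟩ := norm_kern_le a b c hE.stripBound_mul_self 0
  have hint : Integrable fun t : ℝ => g (t * I) := by
    refine integrable_of_norm_le_exp_neg_abs (C := C) (continuous_iff_continuousAt.mpr fun t => ?_)
      fun t ht => ?_
    · refine ContinuousAt.comp (f := fun t : ℝ => (t : ℂ) * I) ?_ (by fun_prop)
      by_cases ht : t = 0
      · subst ht
        simpa using hg0.continuousAt
      · exact (hgd _ (by simpa using ht) (fun x _ => mul_I_ne_ofReal ht)
          fun x _ => mul_I_ne_ofReal ht).continuousAt
    · have ht0 : t ≠ 0 := by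
        rintro rfl
        simp at ht
        linarith
      rw [hg _ (by simpa using ht0)]
      simpa using hC (t * I) (by simp) (by simpa using ht)
  refine hint.congr ?_
  filter_upwards [ae_ne_zero] with t ht
  exact hg _ (by simpa using ht)

theorem kern_add (a b c : ℝ) (F G : ℂ → ℂ) (z : ℂ) :
    kern a b c (fun α => F α + G α) z = kern a b c F z + kern a b c G z := by
  simp only [kern]
  ring

theorem kern_const_mul (a b c : ℝ) (κ : ℂ) (F : ℂ → ℂ) (z : ℂ) :
    kern a b c (fun α => κ * F α) z = κ * kern a b c F z := by
  simp only [kern]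
  ring

theorem mbInt_add (h : Admissible a b c) (hE : StripPoly E) (hG : StripPoly G) :
    mbInt a b c (fun α => E α + G α) = mbInt a b c E + mbInt a b c G := by
  have e : kern a b c (fun α => α * (E α + G α))
      = fun z => kern a b c (fun α => α * E α) z + kern a b c (fun α => α * G α) z := by
    funext z
    rw [← kern_add]
    simp only [mul_add]
  have hr : ∀ x : ℂ, residue (kern a b c fun α => α * (E α + G α)) x
      = residue (kern a b c fun α => α * E α) x + residue (kern a b c fun α => α * G α) x := by
    intro x
    rw [e]
    exact ((meromorphicAt_kern a b c hE.differentiable_mul_self x).hasResidue.add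
      (meromorphicAt_kern a b c hG.differentiable_mul_self x).hasResidue).residue_eq
  rw [mbInt_eq h (hE.add hG), mbInt_eq h hE, mbInt_eq h hG]
  have hs : ∑ x ∈ leftPolesGT a b c 0,
      halfWeight x * residue (kern a b c fun α => α * (E α + G α)) x
      = ∑ x ∈ leftPolesGT a b c 0, halfWeight x * residue (kern a b c fun α => α * E α) x
        + ∑ x ∈ leftPolesGT a b c 0, halfWeight x * residue (kern a b c fun α => α * G α) x := by
    rw [← Finset.sum_add_distrib]
    exact Finset.sum_congr rfl fun x _ => by rw [hr, mul_add]
  rw [hs, e, integral_add (integrable_kern h hE) (integrable_kern h hG)]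
  ring

theorem mbInt_const_mul (h : Admissible a b c) (κ : ℂ) (hE : StripPoly E) :
    mbInt a b c (fun α => κ * E α) = κ * mbInt a b c E := by
  have e : kern a b c (fun α => α * (κ * E α))
      = fun z => κ * kern a b c (fun α => α * E α) z := by
    funext z
    rw [← kern_const_mul]
    congr 1
    funext α
    ring
  have hr : ∀ x : ℂ, residue (kern a b c fun α => α * (κ * E α)) x
      = κ * residue (kern a b c fun α => α * E α) x := by
    intro x
    rw [e]
    exact ((meromorphicAt_kern a b c hE.differentiable_mul_self x).hasResidue.const_mul κ).residue_eq
  rw [mbInt_eq h (hE.const_mul κ), mbInt_eq h hE]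
  have hs : ∑ x ∈ leftPolesGT a b c 0,
      halfWeight x * residue (kern a b c fun α => α * (κ * E α)) x
      = κ * ∑ x ∈ leftPolesGT a b c 0, halfWeight x * residue (kern a b c fun α => α * E α) x := by
    rw [Finset.mul_sum]
    exact Finset.sum_congr rfl fun x _ => by rw [hr]; ring
  rw [hs, e, integral_const_mul]
  ring

theorem mbInt_sum (h : Admissible a b c) {ι : Type*} (s : Finset ι) {f : ι → ℂ → ℂ}
    (hf : ∀ i ∈ s, StripPoly (f i)) :
    mbInt a b c (fun α => ∑ i ∈ s, f i α) = ∑ i ∈ s, mbInt a b c (f i) := by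
  classical
  induction s using Finset.induction_on with
  | empty => simpa using mbInt_const_mul h 0 (StripPoly.const 0)
  | insert i s hi ih =>
    simp only [Finset.sum_insert hi]
    rw [mbInt_add h (hf i (by simp)) (StripPoly.sum s fun j hj => hf j (by simp [hj])),
      ih fun j hj => hf j (by simp [hj])]

theorem mbInt_swap_one_two (a b c : ℝ) (E : ℂ → ℂ) : mbInt a b c E = mbInt b a c E := by
  rw [mbInt, mbInt, kern_swap_one_two, triple_swap_one_two]

theorem mbInt_swap_one_three (a b c : ℝ) (E : ℂ → ℂ) : mbInt a b c E = mbInt c b a E := by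
  rw [mbInt, mbInt, kern_swap_one_three, triple_swap_one_three]

theorem gammaPM_add_one {a : ℝ} {α : ℂ} (h1 : α ≠ a) (h2 : α ≠ -a) :
    gammaPM (a + 1) α = (a ^ 2 - α ^ 2) * gammaPM a α := by
  have e1 : ((a + 1 : ℝ) : ℂ) + α = (a + α) + 1 := by push_cast; ring
  have e2 : ((a + 1 : ℝ) : ℂ) - α = (a - α) + 1 := by push_cast; ring
  rw [gammaPM, gammaPM, e1, e2, Gamma_add_one _ fun h => h2 (by linear_combination h),
    Gamma_add_one _ fun h => h1 (by linear_combination -h)]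
  ring

theorem eventually_ne_nhdsNE (x w : ℂ) : ∀ᶠ α in 𝓝[≠] x, α ≠ w := by
  by_cases h : x = w
  · subst h
    exact self_mem_nhdsWithin
  · exact nhdsWithin_le_nhds (isOpen_ne.mem_nhds h)

theorem kern_add_one (E : ℂ → ℂ) {α : ℂ} (h1 : α ≠ a) (h2 : α ≠ -a) :
    kern (a + 1) b c (fun α => α * E α) α
      = kern a b c (fun α => α * (((a : ℂ) ^ 2 - α ^ 2) * E α)) α := by
  simp only [kern]
  rw [gammaPM_add_one h1 h2]
  ring

/-- Since `Γ(a+1 ± α) = (a² - α²) Γ(a ± α)`, both integrands agree off `±a`. What has to be compared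
are the lists of poles: raising `a` loses at most the left pole `-a`, and if it is really lost its
residue vanishes by `residue_kern_one_sub`. -/
theorem mbInt_add_one (h : Admissible a b c) (hE : StripPoly E) :
    mbInt (a + 1) b c E = mbInt a b c fun α => ((a : ℂ) ^ 2 - α ^ 2) * E α := by
  have hE' := (StripPoly.sq_sub_sq (a : ℂ)).mul hE
  have hres : ∀ x : ℂ, residue (kern a b c (fun α => α * (((a : ℂ) ^ 2 - α ^ 2) * E α))) x
      = residue (kern (a + 1) b c (fun α => α * E α)) x := fun x => by
    refine ((meromorphicAt_kern (a + 1) b c hE.differentiable_mul_self x).hasResidue.congr ?_).residue_eq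
    filter_upwards [eventually_ne_nhdsNE x a, eventually_ne_nhdsNE x (-a)] with α h1 h2
    exact kern_add_one E h1 h2
  have hi : ∫ t : ℝ, kern (a + 1) b c (fun α => α * E α) (t * I)
      = ∫ t : ℝ, kern a b c (fun α => α * (((a : ℂ) ^ 2 - α ^ 2) * E α)) (t * I) := by
    refine integral_congr_ae ?_
    filter_upwards [ae_ne_zero] with t ht
    refine kern_add_one E (mul_I_ne_ofReal ht) ?_
    rw [← ofReal_neg]
    exact mul_I_ne_ofReal ht
  have hs : ∑ x ∈ leftPolesGT (a + 1) b c 0, halfWeight x * residue (kern (a + 1) b c fun α => α * E α) x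
      = ∑ x ∈ leftPolesGT a b c 0,
        halfWeight x * residue (kern a b c fun α => α * (((a : ℂ) ^ 2 - α ^ 2) * E α)) x := by
    simp only [hres]
    refine Finset.sum_subset ?_ ?_
    · intro x hx
      obtain ⟨⟨p, hp, k, rfl⟩, hx0⟩ := mem_leftPolesGT.mp hx
      refine mem_leftPolesGT.mpr ⟨?_, hx0⟩
      rcases hp with rfl | hp
      · exact ⟨a, by simp, k + 1, by push_cast; ring⟩
      · exact ⟨p, Or.inr hp, k, rfl⟩
    · intro x hx hx'
      obtain ⟨⟨p, hp, k, rfl⟩, hx0⟩ := mem_leftPolesGT.mp hx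
      have hpa : p = a ∧ k = 0 := by
        by_contra hne
        refine hx' (mem_leftPolesGT.mpr ⟨?_, hx0⟩)
        rcases hp with rfl | hp
        · obtain ⟨j, rfl⟩ := Nat.exists_eq_succ_of_ne_zero fun h0 => hne ⟨rfl, h0⟩
          exact ⟨p + 1, by simp, j, by push_cast; ring⟩
        · exact ⟨p, Or.inr hp, k, rfl⟩
      obtain ⟨rfl, rfl⟩ := hpa
      have e : -p - ((0 : ℕ) : ℝ) = 1 - (p + 1) := by simp
      rw [e] at hx' hx0 ⊢
      rw [residue_kern_one_sub hE.differentiable_mul_self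
        (fun k hk => h.ab k (by linarith)) (fun k hk => h.ac k (by linarith)), mul_zero]
      exact fun hL => hx' (mem_leftPolesGT.mpr ⟨hL, hx0⟩)
  rw [mbInt_eq h.add_one hE, mbInt_eq h hE', hi, hs]

end Functional

/-! ### Contour shift: `mbInt` vanishes on differences -/

section Shift

variable {a b c : ℝ} {E G : ℂ → ℂ}

/-- Shifting parameter and argument by `1/2` together raises one Gamma argument by one and fixes the
other. This is where the linear factors of the difference operator come from. -/
theorem gammaPM_half_add {a : ℝ} {α : ℂ} (h : α ≠ -a) :
    gammaPM (a + 1 / 2) (α + 1 / 2) = (a + α) * gammaPM a α := by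
  have e1 : ((a + 1 / 2 : ℝ) : ℂ) + (α + 1 / 2) = (a + α) + 1 := by push_cast; ring
  have e2 : ((a + 1 / 2 : ℝ) : ℂ) - (α + 1 / 2) = a - α := by push_cast; ring
  rw [gammaPM, gammaPM, e1, e2, Gamma_add_one _ fun h0 => h (by linear_combination h0)]
  ring

theorem gammaPM_half_sub {a : ℝ} {α : ℂ} (h : α ≠ a) :
    gammaPM (a + 1 / 2) (α - 1 / 2) = (a - α) * gammaPM a α := by
  have := gammaPM_half_add (a := a) (α := -α) fun h0 => h (by linear_combination -h0)
  rw [gammaPM_neg, ← sub_eq_add_neg] at this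
  rw [← this, ← gammaPM_neg]
  congr 1
  ring

/-- The difference of two shifted kernels. -/
theorem kern_half_sub_kern_half (hG : ∀ α : ℂ, 2 * α * G α = (a + α) * (b + α) * (c + α) * E (α + 1 / 2)
      - (a - α) * (b - α) * (c - α) * E (α - 1 / 2)) {α : ℂ}
    (h : ∀ p ∈ ({a, b, c} : Set ℝ), α ≠ p ∧ α ≠ -p) :
    kern (a + 1 / 2) (b + 1 / 2) (c + 1 / 2) E (α + 1 / 2)
        - kern (a + 1 / 2) (b + 1 / 2) (c + 1 / 2) E (α - 1 / 2)
      = -2 * kern a b c (fun α => α * G α) α := by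
  have ha := h a (by simp)
  have hb := h b (by simp)
  have hc := h c (by simp)
  have s1 : sin (2 * Real.pi * (α + 1 / 2)) = -sin (2 * Real.pi * α) := by
    rw [← Complex.sin_add_pi]
    congr 1
    ring
  have s2 : sin (2 * Real.pi * (α - 1 / 2)) = -sin (2 * Real.pi * α) := by
    rw [← Complex.sin_sub_pi]
    congr 1
    ring
  simp only [kern]
  rw [gammaPM_half_add ha.2, gammaPM_half_add hb.2, gammaPM_half_add hc.2, gammaPM_half_sub ha.1,
    gammaPM_half_sub hb.1, gammaPM_half_sub hc.1, s1, s2]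
  linear_combination gammaPM a α * gammaPM b α * gammaPM c α * sin (2 * Real.pi * α) * hG α

theorem mem_leftPoles_half {x : ℝ} :
    x ∈ leftPoles {a + 1 / 2, b + 1 / 2, c + 1 / 2} ↔ x + 1 / 2 ∈ leftPoles {a, b, c} := by
  constructor
  · rintro ⟨p, hp, k, rfl⟩
    refine ⟨p - 1 / 2, ?_, k, by ring⟩
    rcases hp with rfl | rfl | rfl <;> simp
  · rintro ⟨p, hp, k, hk⟩
    refine ⟨p + 1 / 2, ?_, k, by linarith⟩
    rcases hp with rfl | rfl | rfl <;> simp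

theorem mem_rightPoles_half {x : ℝ} :
    x ∈ rightPoles {a + 1 / 2, b + 1 / 2, c + 1 / 2} ↔ x - 1 / 2 ∈ rightPoles {a, b, c} := by
  rw [← neg_mem_leftPoles, mem_leftPoles_half, ← neg_mem_leftPoles]
  ring_nf

theorem sub_natCast_mem_leftPoles {A : Set ℝ} {x : ℝ} (h : x ∈ leftPoles A) (n : ℕ) :
    x - n ∈ leftPoles A := by
  obtain ⟨p, hp, k, rfl⟩ := h
  exact ⟨p, hp, k + n, by push_cast; ring⟩

theorem add_natCast_mem_rightPoles {A : Set ℝ} {x : ℝ} (h : x ∈ rightPoles A) (n : ℕ) :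
    x + n ∈ rightPoles A := by
  obtain ⟨p, hp, k, rfl⟩ := h
  exact ⟨p, hp, k + n, by push_cast; ring⟩

theorem finite_poles (a b c x₀ x₁ : ℝ) :
    {x | (x ∈ leftPoles {a, b, c} ∨ x ∈ rightPoles {a, b, c}) ∧ x₀ < x ∧ x < x₁}.Finite := by
  refine ((finite_leftPoles a b c x₀).union
    ((finite_leftPoles a b c (-x₁)).image fun x => -x)).subset ?_
  rintro x ⟨hL | hR, h0, h1⟩
  · exact Or.inl ⟨hL, h0⟩
  · exact Or.inr ⟨-x, ⟨neg_mem_leftPoles.mpr hR, by linarith⟩, neg_neg x⟩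

theorem exists_pole_free (a b c : ℝ) : ∃ δ : ℝ, 0 < δ ∧ δ < 1 / 2 ∧ ∀ x, 0 < x → x ≤ δ →
    x ∉ leftPoles {a, b, c} ∧ x ∉ rightPoles {a, b, c} := by
  have hev : ∀ᶠ δ in 𝓝[>] (0 : ℝ), ∀ x ∈ {x | (x ∈ leftPoles {a, b, c} ∨ x ∈ rightPoles {a, b, c})
      ∧ 0 < x ∧ x < 1}, δ < x :=
    (eventually_all_finite (finite_poles a b c 0 1)).mpr fun x hx =>
      nhdsWithin_le_nhds (Iio_mem_nhds hx.2.1)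
  obtain ⟨δ, h1, h2⟩ := (hev.and (Ioo_mem_nhdsGT (by norm_num : (0 : ℝ) < 1 / 2))).exists
  refine ⟨δ, h2.1, h2.2, fun x hx0 hxδ => ⟨fun h => ?_, fun h => ?_⟩⟩
  · exact (h1 x ⟨Or.inl h, hx0, by linarith [h2.2]⟩).not_ge hxδ
  · exact (h1 x ⟨Or.inr h, hx0, by linarith [h2.2]⟩).not_ge hxδ

/-- The sum of the residues of an odd kernel in a period strip. -/
theorem sum_residue_period (h : Admissible (a + 1 / 2) (b + 1 / 2) (c + 1 / 2)) {ρ : ℝ → ℂ}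
    (hρ : ∀ x, ρ (-x) = ρ x)
    (hρ0 : 1 / 2 ∈ rightPoles {a + 1 / 2, b + 1 / 2, c + 1 / 2} →
      1 / 2 ∉ leftPoles {a + 1 / 2, b + 1 / 2, c + 1 / 2} → ρ (1 / 2) = 0)
    {P Q : Finset ℝ}
    (hP : ∀ x, x ∈ P ↔ (x ∈ leftPoles {a + 1 / 2, b + 1 / 2, c + 1 / 2} ∨
      x ∈ rightPoles {a + 1 / 2, b + 1 / 2, c + 1 / 2}) ∧ -(1 / 2) < x ∧ x ≤ 1 / 2)
    (hQ : ∀ x, x ∈ Q ↔ x ∈ leftPoles {a + 1 / 2, b + 1 / 2, c + 1 / 2} ∧ -(1 / 2) < x ∧ x ≤ 1 / 2) :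
    ∑ x ∈ P, ρ x = 2 * ∑ x ∈ Q, halfWeight x * ρ x := by
  classical
  set p : ℝ → Prop := fun x => ∃ m : ℤ, 2 * x = m with hp
  rw [← Finset.sum_filter_add_sum_filter_not P p, ← Finset.sum_filter_add_sum_filter_not Q p,
    mul_add]
  congr 1
  -- Half-integral points: the weight `1/2` cancels the factor `2`. Only `0` and `1/2` lie in the
  -- window; at `0` left and right poles coincide by symmetry, and a right pole at `1/2` that is no
  -- left pole has residue zero by `hρ0`.
  · rw [Finset.mul_sum]
    have e : ∑ x ∈ Q with p x, 2 * (halfWeight x * ρ x) = ∑ x ∈ Q with p x, ρ x := by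
      refine Finset.sum_congr rfl fun x hx => ?_
      have : halfWeight x = 1 / 2 := if_pos (Finset.mem_filter.mp hx).2
      rw [this]
      ring
    rw [e]
    refine (Finset.sum_subset ?_ ?_).symm
    · intro x hx
      obtain ⟨hx1, hx2⟩ := Finset.mem_filter.mp hx
      have := (hQ x).mp hx1
      exact Finset.mem_filter.mpr ⟨(hP x).mpr ⟨Or.inl this.1, this.2⟩, hx2⟩
    · intro x hx hxQ
      obtain ⟨hx1, ⟨m, hm⟩⟩ := Finset.mem_filter.mp hx
      obtain ⟨hLR, h1, h2⟩ := (hP x).mp hx1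
      have hL : x ∉ leftPoles {a + 1 / 2, b + 1 / 2, c + 1 / 2} := fun hL =>
        hxQ (Finset.mem_filter.mpr ⟨(hQ x).mpr ⟨hL, h1, h2⟩, ⟨m, hm⟩⟩)
      have hR := hLR.resolve_left hL
      have hm1 : -1 < m := by
        have : (-1 : ℝ) < m := by linarith
        exact_mod_cast this
      have hm2 : m ≤ 1 := by
        have : (m : ℝ) ≤ 1 := by linarith
        exact_mod_cast this
      have hcase : m = 0 ∨ m = 1 := by omega
      rcases hcase with rfl | rfl
      · have hx0 : x = 0 := by simpa using hm
        subst hx0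
        rw [← neg_mem_leftPoles, neg_zero] at hR
        exact absurd hR hL
      · have hx0 : x = 1 / 2 := by
          push_cast at hm
          linarith
        subst hx0
        exact hρ0 hR hL
  · set Q' := Q.filter fun x => ¬p x
    have hQ' : ∀ x ∈ Q', x ∈ leftPoles {a + 1 / 2, b + 1 / 2, c + 1 / 2} ∧ -(1 / 2) < x ∧
        x < 1 / 2 ∧ ¬p x := fun x hx => by
      obtain ⟨hx1, hx2⟩ := Finset.mem_filter.mp hx
      obtain ⟨h1, h2, h3⟩ := (hQ x).mp hx1
      refine ⟨h1, h2, lt_of_le_of_ne h3 fun h0 => hx2 ⟨1, ?_⟩, hx2⟩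
      rw [h0]
      norm_num
    have hpneg : ∀ x, p (-x) → p x := fun x ⟨m, hm⟩ => ⟨-m, by push_cast; linarith⟩
    -- Away from half-integers the poles in the window are the left poles and their reflections. The
    -- two sets are disjoint, since a common pole would be half-integral.
    have hPeq : P.filter (fun x => ¬p x) = Q' ∪ Q'.image fun x => -x := by
      ext x
      rw [Finset.mem_union, Finset.mem_image, Finset.mem_filter, hP]
      constructor
      · rintro ⟨⟨hL | hR, h1, h2⟩, h3⟩
        · exact Or.inl (Finset.mem_filter.mpr ⟨(hQ x).mpr ⟨hL, h1, h2⟩, h3⟩)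
        · refine Or.inr ⟨-x, Finset.mem_filter.mpr ⟨(hQ _).mpr
            ⟨neg_mem_leftPoles.mpr hR, ?_, by linarith⟩, fun h0 => h3 (hpneg x h0)⟩, neg_neg x⟩
          refine neg_lt_neg (lt_of_le_of_ne h2 fun h0 => h3 ⟨1, ?_⟩)
          rw [h0]
          norm_num
      · rintro (hx | ⟨y, hy, rfl⟩)
        · obtain ⟨h1, h2, h3, h4⟩ := hQ' x hx
          exact ⟨⟨Or.inl h1, h2, h3.le⟩, h4⟩
        · obtain ⟨h1, h2, h3, h4⟩ := hQ' y hy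
          exact ⟨⟨Or.inr (neg_mem_rightPoles.mpr h1), by linarith, by linarith⟩,
            fun h0 => h4 (hpneg y h0)⟩
    have hdisj : Disjoint Q' (Q'.image fun x => -x) := by
      rw [Finset.disjoint_left]
      intro x hx hx'
      obtain ⟨y, hy, rfl⟩ := Finset.mem_image.mp hx'
      exact (hQ' _ hx).2.2.2 (h.exists_int (hQ' _ hx).1 (neg_mem_rightPoles.mpr (hQ' y hy).1))
    rw [hPeq, Finset.sum_union hdisj, Finset.sum_image neg_injective.injOn]
    simp only [hρ]
    rw [← two_mul]
    congr 1
    refine Finset.sum_congr rfl fun x hx => ?_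
    have : halfWeight x = 1 := if_neg (hQ' x hx).2.2.2
    rw [this, one_mul]

/-- Telescoping of the residues of the shifted kernels. -/
theorem sum_residue_telescope {ρ : ℝ → ℂ}
    (hρ : ∀ p ∈ ({a, b, c} : Set ℝ), 1 / 2 - p ∉ leftPoles {a + 1 / 2, b + 1 / 2, c + 1 / 2} →
      ρ (1 / 2 - p) = 0) {Q : Finset ℝ}
    (hQ : ∀ x, x ∈ Q ↔ x ∈ leftPoles {a + 1 / 2, b + 1 / 2, c + 1 / 2} ∧ -(1 / 2) < x ∧ x ≤ 1 / 2) :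
    ∑ x ∈ leftPolesGT a b c 0, halfWeight x * (ρ (x + 1 / 2) - ρ (x - 1 / 2))
      = -∑ x ∈ Q, halfWeight x * ρ x := by
  classical
  set S := leftPolesGT (a + 1 / 2) (b + 1 / 2) (c + 1 / 2) (-(1 / 2)) with hS
  have hw : ∀ x, halfWeight (x - 1 / 2) = halfWeight x := fun x => by
    rw [← halfWeight_add_half, sub_add_cancel]
  -- Moving down by `1/2` maps the left poles in `(0, ∞)` onto those of the shifted kernel in
  -- `(-1/2, ∞)`.
  have h1 : ∑ x ∈ leftPolesGT a b c 0, halfWeight x * ρ (x - 1 / 2) = ∑ y ∈ S, halfWeight y * ρ y := by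
    have e : S = (leftPolesGT a b c 0).image fun x => x - 1 / 2 := by
      ext y
      rw [hS, mem_leftPolesGT, mem_leftPoles_half, Finset.mem_image]
      constructor
      · rintro ⟨h1, h2⟩
        exact ⟨y + 1 / 2, mem_leftPolesGT.mpr ⟨h1, by linarith⟩, by ring⟩
      · rintro ⟨x, hx, rfl⟩
        obtain ⟨h1, h2⟩ := mem_leftPolesGT.mp hx
        rw [sub_add_cancel]
        exact ⟨h1, by linarith⟩
    rw [e, Finset.sum_image (sub_left_injective.injOn)]
    simp only [hw]
  -- Moving up by `1/2` covers the left poles of the shifted kernel in `(1/2, ∞)`. Any additional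
  -- point is some `1/2 - p`, where the residue vanishes by `hρ`. The two sums differ by the window
  -- `Q`.
  have h2 : ∑ x ∈ leftPolesGT a b c 0, halfWeight x * ρ (x + 1 / 2)
      = ∑ y ∈ S with 1 / 2 < y, halfWeight y * ρ y := by
    have e : ∑ x ∈ leftPolesGT a b c 0, halfWeight x * ρ (x + 1 / 2)
        = ∑ y ∈ (leftPolesGT a b c 0).image (fun x => x + 1 / 2), halfWeight y * ρ y := by
      rw [Finset.sum_image (add_left_injective _).injOn]
      simp only [halfWeight_add_half]
    rw [e]
    refine (Finset.sum_subset ?_ ?_).symm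
    · intro y hy
      obtain ⟨hy1, hy2⟩ := Finset.mem_filter.mp hy
      rw [hS, mem_leftPolesGT, mem_leftPoles_half] at hy1
      refine Finset.mem_image.mpr ⟨y - 1 / 2, mem_leftPolesGT.mpr ⟨?_, by linarith⟩, by ring⟩
      have := sub_natCast_mem_leftPoles hy1.1 1
      convert this using 1
      push_cast
      ring
    · intro y hy hyS
      obtain ⟨x, hx, rfl⟩ := Finset.mem_image.mp hy
      obtain ⟨⟨p, hp, k, hk⟩, hx0⟩ := mem_leftPolesGT.mp hx
      have hL : x + 1 / 2 ∉ leftPoles {a + 1 / 2, b + 1 / 2, c + 1 / 2} := fun hL =>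
        hyS (Finset.mem_filter.mpr ⟨mem_leftPolesGT.mpr ⟨hL, by linarith⟩, by linarith⟩)
      have hk0 : k = 0 := by
        by_contra hne
        obtain ⟨j, rfl⟩ := Nat.exists_eq_succ_of_ne_zero hne
        refine hL (mem_leftPoles_half.mpr ⟨p, hp, j, ?_⟩)
        push_cast at hk
        linarith
      subst hk0
      have e : x + 1 / 2 = 1 / 2 - p := by
        rw [hk]
        push_cast
        ring
      rw [e] at hL ⊢
      rw [hρ p hp hL, mul_zero]
  have h3 : ∑ y ∈ S, halfWeight y * ρ y
      = ∑ y ∈ S with 1 / 2 < y, halfWeight y * ρ y + ∑ y ∈ Q, halfWeight y * ρ y := by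
    rw [← Finset.sum_filter_add_sum_filter_not S fun y => 1 / 2 < y]
    congr 2
    ext y
    rw [Finset.mem_filter, hS, mem_leftPolesGT, hQ, not_lt, and_assoc]
  simp only [mul_sub, Finset.sum_sub_distrib]
  rw [h1, h2, h3]
  ring

/-- The integral of a regularised even kernel may be moved off the imaginary axis. -/
theorem integral_kern_shift (h : Admissible a b c) (hE : StripPoly E) {δ : ℝ} (hδ : 0 < δ)
    (hfree : ∀ x, 0 < x → x ≤ δ → x ∉ leftPoles {a, b, c} ∧ x ∉ rightPoles {a, b, c}) :
    ∫ t : ℝ, kern a b c (fun α => α * E α) (t * I)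
      = ∫ t : ℝ, kern a b c (fun α => α * E α) (δ + t * I) := by
  obtain ⟨g, hg, hg0, hgd⟩ := exists_differentiable_kern h hE.differentiable
  obtain ⟨C, _, hC⟩ := norm_kern_le a b c hE.stripBound_mul_self δ
  have key := integral_strip hδ ∅ (f := g) (by simp) (C := C) ?_ (by simp) ?_
  · rw [Finset.sum_empty, mul_zero, sub_eq_zero] at key
    have e1 : ∫ t : ℝ, g (((0 : ℝ) : ℂ) + t * I) = ∫ t : ℝ, kern a b c (fun α => α * E α) (t * I) := by
      refine integral_congr_ae ?_
      filter_upwards [ae_ne_zero] with t ht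
      rw [ofReal_zero, zero_add]
      exact hg _ (by simpa using ht)
    rw [← e1, ← key]
    refine integral_congr_ae (Eventually.of_forall fun t => (hg _ fun h0 => hδ.ne' ?_))
    simpa using congrArg Complex.re h0
  · intro z hz _
    by_cases hz0 : z = 0
    · rw [hz0]
      exact hg0
    · have hreal : ∀ x : ℝ, z = x → 0 < x ∧ x ≤ δ := fun x hx => by
        rw [hx] at hz hz0
        exact ⟨lt_of_le_of_ne hz.1 fun h0 => hz0 (by rw [ofReal_eq_zero]; simpa using h0.symm), hz.2⟩
      exact hgd z hz0 (fun x hx h0 => (hfree x (hreal x h0).1 (hreal x h0).2).1 hx)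
        fun x hx h0 => (hfree x (hreal x h0).1 (hreal x h0).2).2 hx
  · intro z hz hz1
    have hz0 : z ≠ 0 := by
      rintro rfl
      simp at hz1
      linarith
    rw [hg z hz0]
    exact hC z (by rw [abs_of_nonneg hz.1]; exact hz.2) hz1

/-- The integrand `f` satisfies `-2 f(α) = K(α+1/2) - K(α-1/2)`, where `K` has all parameters raised
by `1/2`. So its line integral is a difference of line integrals of `K` at distance one, i.e. the
residues of `K` in a strip of width one. The residues of `f` at the crossed poles telescope to the
same window. The oddness of `K` and the half weights make both contributions cancel. -/
theorem mbInt_eq_zero (h : Admissible a b c) (hE : StripPoly E) (hG : StripPoly G)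
    (hEG : ∀ α : ℂ, 2 * α * G α = (a + α) * (b + α) * (c + α) * E (α + 1 / 2)
      - (a - α) * (b - α) * (c - α) * E (α - 1 / 2)) :
    mbInt a b c G = 0 := by
  set K := kern (a + 1 / 2) (b + 1 / 2) (c + 1 / 2) E with hK
  set f := kern a b c fun α => α * G α with hf
  have hKm : ∀ z, MeromorphicAt K z := meromorphicAt_kern _ _ _ hE.differentiable
  have hfK : ∀ α : ℂ, (∀ p ∈ ({a, b, c} : Set ℝ), α ≠ p ∧ α ≠ -p) →
      K (α + 1 / 2) - K (α - 1 / 2) = -2 * f α := fun α hα => kern_half_sub_kern_half hEG hα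
  set ρ : ℝ → ℂ := fun x => residue K x with hρ
  have hρneg : ∀ x, ρ (-x) = ρ x := fun x => by
    have h1 := residue_comp_neg (f := K) (x := x) (hKm _)
    have h2 : (fun z => K (-z)) = fun z => (-1) * K z := by
      funext z
      rw [hK, kern_neg, neg_one_mul]
      simp only [hE.even]
    rw [h2, ((hKm x).hasResidue.const_mul (-1)).residue_eq] at h1
    simp only [hρ, ofReal_neg]
    linear_combination h1
  have hρ0 : ∀ p ∈ ({a, b, c} : Set ℝ), 1 / 2 - p ∉ leftPoles {a + 1 / 2, b + 1 / 2, c + 1 / 2} →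
      ρ (1 / 2 - p) = 0 := by
    have main : ∀ {a b c : ℝ}, Admissible a b c →
        1 / 2 - a ∉ leftPoles {a + 1 / 2, b + 1 / 2, c + 1 / 2} →
        residue (kern (a + 1 / 2) (b + 1 / 2) (c + 1 / 2) E) ((1 / 2 - a : ℝ) : ℂ) = 0 := by
      intro a b c h hL
      have e : 1 / 2 - a = 1 - (a + 1 / 2) := by ring
      rw [e] at hL ⊢
      exact residue_kern_one_sub hE.differentiable (fun k hk => h.ab k (by linarith))
        (fun k hk => h.ac k (by linarith)) hL
    rintro p (rfl | rfl | rfl) hL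
    · exact main h hL
    · rw [triple_swap_one_two] at hL
      simp only [hρ, hK]
      rw [kern_swap_one_two]
      exact main h.swap_one_two hL
    · rw [triple_swap_one_three] at hL
      simp only [hρ, hK]
      rw [kern_swap_one_three]
      exact main h.swap_one_three hL
  -- The lines `Re z = ±1/2` may carry poles of `K`. Moving everything to the right by a small `δ`
  -- avoids them, and the shifted strip contains exactly the poles in `(-1/2, 1/2]`.
  obtain ⟨δ, hδ0, hδ1, hfree⟩ := exists_pole_free a b c
  have hhalf := h.add_half
  have hfinP : {x | (x ∈ leftPoles {a + 1 / 2, b + 1 / 2, c + 1 / 2} ∨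
      x ∈ rightPoles {a + 1 / 2, b + 1 / 2, c + 1 / 2}) ∧ -(1 / 2) < x ∧ x ≤ 1 / 2}.Finite :=
    (finite_poles (a + 1 / 2) (b + 1 / 2) (c + 1 / 2) (-(1 / 2)) 1).subset fun x hx =>
      ⟨hx.1, hx.2.1, by linarith [hx.2.2]⟩
  have hfinQ : {x | x ∈ leftPoles {a + 1 / 2, b + 1 / 2, c + 1 / 2} ∧ -(1 / 2) < x ∧
      x ≤ 1 / 2}.Finite := hfinP.subset fun x hx => ⟨Or.inl hx.1, hx.2⟩
  set P := hfinP.toFinset with hPdef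
  set Q := hfinQ.toFinset with hQdef
  have hP : ∀ x, x ∈ P ↔ _ := fun x => hfinP.mem_toFinset
  have hQ : ∀ x, x ∈ Q ↔ _ := fun x => hfinQ.mem_toFinset
  have hsum := sum_residue_period hhalf hρneg (fun hR hL => by
    obtain ⟨p, hp, k, hk⟩ := hR
    have hq : p - 1 / 2 ∈ ({a, b, c} : Set ℝ) := by
      rcases hp with rfl | rfl | rfl <;> simp
    rcases k with _ | k
    -- A right pole at `1/2` with `k = 0` means that one of the parameters `a`, `b`, `c` is `0`, and
    -- `hρ0` applies; for larger `k` the point `1/2` would be a left pole as well.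
    · have hq0 : p - 1 / 2 = 0 := by
        push_cast at hk
        linarith
      rw [hq0] at hq
      have := hρ0 0 hq (by rwa [sub_zero])
      rwa [sub_zero] at this
    · exact absurd ⟨p, hp, k, by push_cast at hk; linarith⟩ hL) hP hQ
  have htel := sum_residue_telescope hρ0 hQ
  have hres : ∀ x : ℝ, ρ (x + 1 / 2) - ρ (x - 1 / 2) = -2 * residue f x := by
    intro x
    have h1 : HasResidue (fun z => K (z + 1 / 2)) x (ρ (x + 1 / 2)) := by
      refine HasResidue.comp_add_const ?_
      have := (hKm ((x + 1 / 2 : ℝ) : ℂ)).hasResidue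
      simpa [hρ] using this
    have h2 : HasResidue (fun z => K (z - 1 / 2)) x (ρ (x - 1 / 2)) := by
      have : HasResidue (fun z => K (z + -(1 / 2))) x (ρ (x - 1 / 2)) := by
        refine HasResidue.comp_add_const ?_
        have := (hKm ((x - 1 / 2 : ℝ) : ℂ)).hasResidue
        simpa [hρ, sub_eq_add_neg] using this
      simpa [sub_eq_add_neg] using this
    have h3 := (meromorphicAt_kern a b c hG.differentiable_mul_self (x : ℂ)).hasResidue.const_mul (-2)
    refine ((h1.sub h2).congr ?_).residue_eq.symm.trans h3.residue_eq
    have hev : ∀ p : ℝ, ∀ᶠ α : ℂ in 𝓝[≠] (x : ℂ), α ≠ p ∧ α ≠ -p := fun p =>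
      (eventually_ne_nhdsNE _ _).and (eventually_ne_nhdsNE _ _)
    filter_upwards [hev a, hev b, hev c] with α ha hb hc
    refine hfK α ?_
    rintro p (rfl | rfl | rfl) <;> assumption
  have hline : ∀ t : ℝ, K (((1 / 2 + δ : ℝ) : ℂ) + t * I) - K (((-(1 / 2) + δ : ℝ) : ℂ) + t * I)
      = -2 * f (δ + t * I) := by
    intro t
    rw [← hfK (δ + t * I)]
    · congr 2 <;> push_cast <;> ring
    · intro p hp
      refine ⟨fun h0 => ?_, fun h0 => ?_⟩
      · have h1 : δ = p := by simpa using congrArg Complex.re h0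
        exact (hfree δ hδ0 le_rfl).2 ⟨p, hp, 0, by simp [h1]⟩
      · have h1 : δ = -p := by simpa using congrArg Complex.re h0
        exact (hfree δ hδ0 le_rfl).1 ⟨p, hp, 0, by simp [h1]⟩
  have hpole : ∀ x, (x ∈ leftPoles {a + 1 / 2, b + 1 / 2, c + 1 / 2} ∨
      x ∈ rightPoles {a + 1 / 2, b + 1 / 2, c + 1 / 2}) →
      (x ∉ Set.Ioc (1 / 2) (1 / 2 + δ)) ∧ (x ∉ Set.Ioc (-(1 / 2)) (-(1 / 2) + δ)) := by
    intro x hx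
    rw [mem_leftPoles_half, mem_rightPoles_half] at hx
    constructor
    · rintro ⟨h1, h2⟩
      have := hfree (x - 1 / 2) (by linarith) (by linarith)
      rcases hx with hx | hx
      · have h3 := sub_natCast_mem_leftPoles hx 1
        rw [Nat.cast_one] at h3
        exact this.1 (by convert h3 using 1; ring)
      · exact this.2 hx
    · rintro ⟨h1, h2⟩
      have := hfree (x + 1 / 2) (by linarith) (by linarith)
      rcases hx with hx | hx
      · exact this.1 hx
      · have h3 := add_natCast_mem_rightPoles hx 1
        rw [Nat.cast_one] at h3
        exact this.2 (by convert h3 using 1; ring)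
  obtain ⟨C, _, hC⟩ := norm_kern_le (a + 1 / 2) (b + 1 / 2) (c + 1 / 2) hE.stripBound 1
  have hKdiff : ∀ z : ℂ, z.re ∈ Set.Icc (-(1 / 2) + δ) (1 / 2 + δ) → (∀ x ∈ P, z ≠ x) →
      DifferentiableAt ℂ K z := by
    intro z hz hzP
    have hno : ∀ x, (x ∈ leftPoles {a + 1 / 2, b + 1 / 2, c + 1 / 2} ∨
        x ∈ rightPoles {a + 1 / 2, b + 1 / 2, c + 1 / 2}) → z ≠ x := by
      intro x hx h0
      rw [h0, ofReal_re] at hz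
      refine hzP x ((hP x).mpr ⟨hx, by linarith [hz.1], ?_⟩) h0
      by_contra hlt
      exact (hpole x hx).1 ⟨not_le.mp hlt, hz.2⟩
    exact (analyticAt_kern hE.differentiable (fun x hx => hno x (Or.inl hx))
      fun x hx => hno x (Or.inr hx)).differentiableAt
  have hdec : ∀ z : ℂ, z.re ∈ Set.Icc (-(1 / 2) + δ) (1 / 2 + δ) → 1 ≤ |z.im| →
      ‖K z‖ ≤ C * Real.exp (-|z.im|) := fun z hz hz1 =>
    hC z (abs_le.mpr ⟨by linarith [hz.1], by linarith [hz.2]⟩) hz1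
  have hPin : ∀ x ∈ P, x ∈ Set.Ioo (-(1 / 2) + δ) (1 / 2 + δ) := by
    intro x hx
    obtain ⟨h1, h2, h3⟩ := (hP x).mp hx
    refine ⟨?_, by linarith⟩
    by_contra hlt
    exact (hpole x h1).2 ⟨h2, not_lt.mp hlt⟩
  have hstrip := integral_strip (by linarith : -(1 / 2) + δ < 1 / 2 + δ) P hPin hKdiff
    (fun x _ => hKm x) hdec
  have hintK : ∀ β : ℝ, β = -(1 / 2) + δ ∨ β = 1 / 2 + δ → Integrable fun t : ℝ => K (β + t * I) := by
    intro β hβ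
    have hβI : β ∈ Set.Icc (-(1 / 2) + δ) (1 / 2 + δ) := by
      rcases hβ with rfl | rfl <;> constructor <;> linarith
    refine integrable_of_norm_le_exp_neg_abs (C := C) (continuous_iff_continuousAt.mpr fun t => ?_)
      fun t ht => ?_
    · refine ContinuousAt.comp (f := fun t : ℝ => (β : ℂ) + t * I)
        (hKdiff _ (by simpa using hβI) fun x hx h0 => ?_).continuousAt
        (continuous_vertical β).continuousAt
      have h1 : β = x := by simpa using congrArg Complex.re h0
      subst h1
      have := hPin β hx
      rcases hβ with rfl | rfl
      · exact this.1.ne rfl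
      · exact this.2.ne rfl
    · simpa using hdec (β + t * I) (by simpa using hβI) (by simpa using ht)
  rw [← integral_sub (hintK _ (Or.inr rfl)) (hintK _ (Or.inl rfl))] at hstrip
  simp only [hline] at hstrip
  rw [integral_const_mul, ← integral_kern_shift h hG hδ0 hfree] at hstrip
  simp only [hres] at htel
  have htel' : -2 * ∑ x ∈ leftPolesGT a b c 0, halfWeight x * residue f x
      = -∑ x ∈ Q, halfWeight x * ρ x := by
    rw [← htel, Finset.mul_sum]
    exact Finset.sum_congr rfl fun x _ => by ring
  have hpi : (Real.pi : ℂ) ≠ 0 := ofReal_ne_zero.mpr Real.pi_ne_zero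
  rw [mbInt_eq h hG, ← hf]
  have h5 : ∫ t : ℝ, f (t * I) = -(Real.pi * ∑ x ∈ P, ρ x) := by
    linear_combination (-1 / 2 : ℂ) * hstrip
  rw [h5, hsum]
  field_simp
  linear_combination -htel'

end Shift

/-! ### The Jacobi function as a difference; recurrence in the parameters -/

section JacobiShift

variable {u v s : ℝ}

theorem one_sub_cpow_mul_th {t : ℝ} (h1 : t < 1) (s : ℝ) (α : ℂ) :
    (1 - (t : ℂ)) ^ (-((s : ℂ) + u)) * th u v t α
      = (1 - (t : ℂ)) ^ (α - s) * hF (u + α) (v + α) (u + v) t := by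
  rw [th, ← mul_assoc, ← Complex.cpow_add _ _ (one_sub_ofReal_ne_zero h1)]
  ring_nf

/-- The derivative of the hypergeometric function has two expressions, through `F(a+1, b+1; c+1)`
and through `F(a, b; c)` and `F(a, b; c+1)`. Eliminating `F(a, b; c)` leaves Jacobi functions with
parameters raised by `1/2` at `α ± 1/2`, multiplied by exactly the cubic coefficients of the
difference operator with third parameter `s`. -/
theorem hasDerivAt_one_sub_cpow_mul_hF (hc : ∀ k : ℕ, u + v ≠ -k) (s : ℝ) {t : ℝ} (h0 : 0 ≤ t)
    (h1 : t < 1) (α : ℂ) :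
    HasDerivAt (fun t : ℝ => 2 * α * ((1 - (t : ℂ)) ^ (α - s) * hF (u + α) (v + α) (u + v) t))
      ((u + α) * (v + α) * (s + α)
          * (((u + v : ℂ)⁻¹ * (1 - (t : ℂ)) ^ (-((s : ℂ) + u) - 1))
            * th (u + 1 / 2) (v + 1 / 2) t (α + 1 / 2))
        - (u - α) * (v - α) * (s - α)
          * (((u + v : ℂ)⁻¹ * (1 - (t : ℂ)) ^ (-((s : ℂ) + u) - 1))
            * th (u + 1 / 2) (v + 1 / 2) t (α - 1 / 2))) t := by
  have hc' : ∀ k : ℕ, (u : ℂ) + v ≠ -k := fun k hk => hc k (by exact_mod_cast hk)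
  have ht := norm_ofReal_lt_one h0 h1
  have hne := one_sub_ofReal_ne_zero h1
  have hc0 : (u : ℂ) + v ≠ 0 := by simpa using hc' 0
  have h := ((hasDerivAt_one_sub_cpow (α - s) h1).mul
    (hasDerivAt_hF (a := u + α) (b := v + α) hc' ht).comp_ofReal).const_mul (2 * α)
  refine HasDerivAt.congr_deriv h ?_
  have hd1 := one_sub_mul_deriv_hF (a := u + α) (b := v + α) hc' ht
  have hd2 := deriv_hF (a := u + α) (b := v + α) hc' ht
  have e1 : ((u + 1 / 2 : ℝ) : ℂ) + (α + 1 / 2) = u + α + 1 := by push_cast; ring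
  have e2 : ((v + 1 / 2 : ℝ) : ℂ) + (α + 1 / 2) = v + α + 1 := by push_cast; ring
  have e3 : ((u + 1 / 2 : ℝ) : ℂ) + ((v + 1 / 2 : ℝ) : ℂ) = u + v + 1 := by push_cast; ring
  have e4 : ((u + 1 / 2 : ℝ) : ℂ) + (α - 1 / 2) = u + α := by push_cast; ring
  have e5 : ((v + 1 / 2 : ℝ) : ℂ) + (α - 1 / 2) = v + α := by push_cast; ring
  rw [th, th, e1, e2, e3, e4, e5]
  have p1 : (1 - (t : ℂ)) ^ (-((s : ℂ) + u) - 1) * (1 - (t : ℂ)) ^ ((u : ℂ) + α + 1)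
      = (1 - (t : ℂ)) ^ (α - s - 1) * (1 - t) := by
    nth_rw 4 [← Complex.cpow_one (1 - (t : ℂ))]
    rw [← Complex.cpow_add _ _ hne, ← Complex.cpow_add _ _ hne]
    ring_nf
  have p2 : (1 - (t : ℂ)) ^ (-((s : ℂ) + u) - 1) * (1 - (t : ℂ)) ^ ((u : ℂ) + α)
      = (1 - (t : ℂ)) ^ (α - s - 1) := by
    rw [← Complex.cpow_add _ _ hne]
    ring_nf
  have p3 : (1 - (t : ℂ)) ^ (α - s) = (1 - (t : ℂ)) ^ (α - s - 1) * (1 - t) := by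
    nth_rw 3 [← Complex.cpow_one (1 - (t : ℂ))]
    rw [← Complex.cpow_add _ _ hne]
    ring_nf
  rw [p3]
  generalize (1 - (t : ℂ)) ^ (α - s - 1) = P at *
  generalize (1 - (t : ℂ)) ^ (-((s : ℂ) + u) - 1) = R at *
  generalize (1 - (t : ℂ)) ^ ((u : ℂ) + α + 1) = S at *
  generalize (1 - (t : ℂ)) ^ ((u : ℂ) + α) = T at *
  generalize hF (u + α + 1) (v + α + 1) (u + v + 1) t = H at *
  generalize hF (u + α) (v + α) (u + v + 1) t = J at *
  rw [hd2] at hd1 ⊢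
  generalize hF (u + α) (v + α) (u + v) t = F at *
  have q1 : R * (S * H) = P * (1 - t) * H := by rw [← mul_assoc, p1]
  have q2 : R * (T * J) = P * J := by rw [← mul_assoc, p2]
  have hd1' : (1 - (t : ℂ)) * ((u + α) * (v + α) * H)
      = 2 * α * (u + v) * F + (v - α) * (u - α) * J := by
    field_simp at hd1
    linear_combination hd1
  calc _ = 2 * α * P * (s - α) * F + 2 * α * P * (u + v : ℂ)⁻¹ * ((1 - t) * ((u + α) * (v + α) * H)) := by
        field_simp
        ring
    _ = (u + v : ℂ)⁻¹ * ((s + α) * (P * ((1 - t) * ((u + α) * (v + α) * H)))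
        - (u - α) * (v - α) * (s - α) * (P * J)) := by
        rw [hd1']
        field_simp
        ring
    _ = (u + v : ℂ)⁻¹ * ((u + α) * (v + α) * (s + α) * (P * (1 - t) * H)
        - (u - α) * (v - α) * (s - α) * (P * J)) := by ring
    _ = _ := by
        rw [← q1, ← q2]
        ring

theorem continuousOn_one_sub_cpow (a : ℂ) : ContinuousOn (fun t : ℝ => (1 - (t : ℂ)) ^ a) (Set.Iio 1) :=
  fun _ ht => (hasDerivAt_one_sub_cpow a ht).continuousAt.continuousWithinAt

/-- The Mellin-Barnes integral of the Jacobi function, up to a constant. -/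
theorem mbInt_th (h : Admissible u v s) {t : ℝ} (h0 : 0 ≤ t) (h1 : t < 1) :
    mbInt u v s (th u v t) = (1 - (t : ℂ)) ^ ((s : ℂ) + u) * mbInt u v s fun _ => 1 := by
  have hne := one_sub_ofReal_ne_zero h1
  have hc := h.ab
  have hchalf : ∀ k : ℕ, u + 1 / 2 + (v + 1 / 2) ≠ -k := h.add_half.ab
  -- The factor in front of the two Jacobi functions in the derivative is independent of `α`.
  -- Integrated over `[0, t]`, the derivative formula exhibits `w * th - 1` as the difference
  -- operator applied to `E(α) = ∫ κ th`.
  set κ : ℝ → ℂ := fun τ => (u + v : ℂ)⁻¹ * (1 - (τ : ℂ)) ^ (-((s : ℂ) + u) - 1) with hκ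
  have hsub : Set.Icc 0 t ⊆ Set.Ico 0 1 := fun τ hτ => ⟨hτ.1, hτ.2.trans_lt h1⟩
  have hκc : ContinuousOn κ (Set.Icc 0 t) :=
    ((continuousOn_one_sub_cpow _).mono fun τ hτ => (hsub hτ).2).const_mul _
  have hE := stripPoly_integral_th hchalf h0 h1 hκc
  have hth := stripPoly_th hc h0 h1
  set w : ℂ := (1 - (t : ℂ)) ^ (-((s : ℂ) + u)) with hw
  have hG : StripPoly fun α => w * th u v t α + -1 := (hth.const_mul w).add (StripPoly.const (-1))
  have key := mbInt_eq_zero h hE hG fun α => by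
    have hint : ∀ β : ℂ, IntervalIntegrable (fun τ => κ τ * th (u + 1 / 2) (v + 1 / 2) τ β) volume 0 t :=
      fun β => by
        refine ContinuousOn.intervalIntegrable ?_
        rw [Set.uIcc_of_le h0]
        exact hκc.mul ((continuousOn_th hchalf β).mono hsub)
    have hftc := intervalIntegral.integral_eq_sub_of_hasDerivAt
      (fun τ hτ => by
        rw [Set.uIcc_of_le h0] at hτ
        exact hasDerivAt_one_sub_cpow_mul_hF hc s hτ.1 (hsub hτ).2 α)
      (((hint (α + 1 / 2)).const_mul _).sub ((hint (α - 1 / 2)).const_mul _))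
    rw [intervalIntegral.integral_sub ((hint _).const_mul _) ((hint _).const_mul _),
      intervalIntegral.integral_const_mul, intervalIntegral.integral_const_mul] at hftc
    rw [hftc, hw, one_sub_cpow_mul_th h1]
    simp [hF_zero]
    ring
  rw [mbInt_add h (hth.const_mul w) (StripPoly.const (-1)), mbInt_const_mul h w hth] at key
  have hneg : mbInt u v s (fun _ => (-1 : ℂ)) = -mbInt u v s fun _ => 1 := by
    have := mbInt_const_mul h (-1) (StripPoly.const 1)
    simpa using this
  rw [hneg] at key
  have hw2 : (1 - (t : ℂ)) ^ ((s : ℂ) + u) * w = 1 := by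
    rw [hw, ← Complex.cpow_add _ _ hne, add_neg_cancel, Complex.cpow_zero]
  linear_combination (1 - (t : ℂ)) ^ ((s : ℂ) + u) * key - mbInt u v s (th u v t) * hw2

/-- The difference operator maps `1` to `α² + uv + us + vs`, so under `mbInt` the function `u² - α²`
acts as the constant `(u+v)(u+s)`. -/
theorem mbInt_one_add_one (h : Admissible u v s) :
    mbInt (u + 1) v s (fun _ => 1) = (u + v) * (u + s) * mbInt u v s fun _ => 1 := by
  have h1 := mbInt_add_one h (StripPoly.const 1)
  have h2 := mbInt_eq_zero h (StripPoly.const 1)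
    (StripPoly.sq.add (StripPoly.const ((u : ℂ) * v + u * s + v * s))) fun α => by ring
  rw [mbInt_add h StripPoly.sq (StripPoly.const _)] at h2
  have h3 := mbInt_const_mul h ((u : ℂ) * v + u * s + v * s) (StripPoly.const 1)
  have h4 := mbInt_const_mul h ((u : ℂ) ^ 2) (StripPoly.const 1)
  have h5 := mbInt_const_mul h (-1) StripPoly.sq
  have e : (fun α : ℂ => ((u : ℂ) ^ 2 - α ^ 2) * 1) = fun α => (u : ℂ) ^ 2 * 1 + -1 * α ^ 2 := by
    funext α
    ring
  rw [e, mbInt_add h ((StripPoly.const 1).const_mul _) (StripPoly.sq.const_mul (-1)), h4, h5] at h1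
  simp only [mul_one] at h3
  rw [h3] at h2
  linear_combination h1 - h2

end JacobiShift

/-! ### Gauss's summation formula -/

section GaussSum

variable {a b c : ℂ}

theorem poch_eq_prod (a : ℂ) (n : ℕ) : poch a n = ∏ j ∈ Finset.range n, (a + j) := by
  induction n with
  | zero => simp
  | succ n ih => rw [poch_succ, Finset.prod_range_succ, ih]

theorem poch_eq_zero_of_lt {k n : ℕ} (h : k < n) : poch (-(k : ℂ)) n = 0 := by
  rw [poch_eq_prod]
  exact Finset.prod_eq_zero (Finset.mem_range.mpr h) (neg_add_cancel _)

/-- Gauss's product for `1/Γ`. It includes the nonpositive integers, where the symbol is eventually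
zero and `Gamma` has the default value `0`. -/
theorem tendsto_poch_div (a : ℂ) :
    Tendsto (fun m : ℕ => poch a (m + 1) / ((m : ℂ) ^ a * m.factorial)) atTop (𝓝 (Gamma a)⁻¹) := by
  by_cases ha : ∀ k : ℕ, a ≠ -k
  · refine ((GammaSeq_tendsto_Gamma a).inv₀ (Gamma_ne_zero ha)).congr fun m => ?_
    rw [GammaSeq, inv_div, poch_eq_prod]
  · push Not at ha
    obtain ⟨k, rfl⟩ := ha
    rw [Complex.Gamma_neg_nat_eq_zero, inv_zero]
    refine tendsto_const_nhds.congr' ?_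
    filter_upwards [eventually_ge_atTop k] with m hm
    rw [poch_eq_zero_of_lt (by omega), zero_div]

theorem exists_norm_hcoef_le (a b : ℂ) (hc : ∀ k : ℕ, c ≠ -k) : ∃ K : ℝ, 0 ≤ K ∧
    ∀ᶠ m : ℕ in atTop, ‖hcoef a b c (m + 1)‖ ≤ K * (m : ℝ) ^ ((a + b - c).re - 1) := by
  have h := ((tendsto_poch_div a).mul (tendsto_poch_div b)).div (tendsto_poch_div c)
    (inv_ne_zero (Gamma_ne_zero hc))
  set L := (Gamma a)⁻¹ * (Gamma b)⁻¹ / (Gamma c)⁻¹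
  refine ⟨‖L‖ + 1, by positivity, ?_⟩
  filter_upwards [h.norm.eventually (gt_mem_nhds (lt_add_one ‖L‖)), eventually_gt_atTop 0] with m h1 hm
  have hm' : (m : ℂ) ≠ 0 := by exact_mod_cast hm.ne'
  have hmr : (0 : ℝ) < m := by exact_mod_cast hm
  have hf : (m.factorial : ℂ) ≠ 0 := by exact_mod_cast m.factorial_ne_zero
  have hm1 : (m : ℂ) + 1 ≠ 0 := by exact_mod_cast m.succ_ne_zero
  have hpc : poch c (m + 1) ≠ 0 := poch_ne_zero_of_field hc
  have hpow : (m : ℂ) ^ c ≠ 0 := by simp [Complex.cpow_eq_zero_iff, hm']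
  have e : hcoef a b c (m + 1) = (poch a (m + 1) / ((m : ℂ) ^ a * m.factorial)
      * (poch b (m + 1) / ((m : ℂ) ^ b * m.factorial)) / (poch c (m + 1) / ((m : ℂ) ^ c * m.factorial)))
      * ((m : ℂ) ^ (a + b - c) / (m + 1)) := by
    have hpa : (m : ℂ) ^ a ≠ 0 := by simp [Complex.cpow_eq_zero_iff, hm']
    have hpb : (m : ℂ) ^ b ≠ 0 := by simp [Complex.cpow_eq_zero_iff, hm']
    rw [hcoef, Complex.cpow_sub _ _ hm', Complex.cpow_add _ _ hm', Nat.factorial_succ]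
    push_cast
    field_simp
  rw [e, norm_mul]
  refine mul_le_mul h1.le ?_ (norm_nonneg _) (by positivity)
  rw [norm_div, Complex.norm_natCast_cpow_of_pos hm, Real.rpow_sub hmr, Real.rpow_one]
  have h2 : (m : ℝ) ≤ ‖(m : ℂ) + 1‖ := by
    have : ((m : ℂ) + 1) = ((m + 1 : ℝ) : ℂ) := by push_cast; rfl
    rw [this, Complex.norm_of_nonneg (by positivity)]
    linarith
  gcongr

theorem summable_norm_hcoef_one (hc : ∀ k : ℕ, c ≠ -k) (h : (a + b - c).re < 0) :
    Summable fun m => ‖hcoef a b c m‖ := by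
  obtain ⟨K, hK, hev⟩ := exists_norm_hcoef_le a b hc
  rw [← summable_nat_add_iff 1]
  refine Summable.of_norm_bounded_eventually_nat
    ((Real.summable_nat_rpow.mpr (by linarith : (a + b - c).re - 1 < -1)).mul_left K) ?_
  filter_upwards [hev] with m hm
  rwa [norm_norm]

theorem tendsto_mul_hcoef (hc : ∀ k : ℕ, c ≠ -k) (h : (a + b - c).re < 0) :
    Tendsto (fun m : ℕ => (m : ℂ) * hcoef a b c m) atTop (𝓝 0) := by
  obtain ⟨K, hK, hev⟩ := exists_norm_hcoef_le a b hc
  rw [← tendsto_add_atTop_iff_nat 1, tendsto_zero_iff_norm_tendsto_zero]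
  have ht : Tendsto (fun m : ℕ => 2 * K * (m : ℝ) ^ (a + b - c).re) atTop (𝓝 0) := by
    have := (tendsto_rpow_neg_atTop (y := -(a + b - c).re) (by linarith)).comp
      tendsto_natCast_atTop_atTop
    rw [neg_neg] at this
    simpa using this.const_mul (2 * K)
  refine squeeze_zero' (Eventually.of_forall fun _ => norm_nonneg _) ?_ ht
  filter_upwards [hev, eventually_gt_atTop 0] with m hm hm0
  have hmr : (0 : ℝ) < m := by exact_mod_cast hm0
  have hm1 : (1 : ℝ) ≤ m := by exact_mod_cast hm0
  rw [norm_mul, Complex.norm_natCast]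
  calc _ ≤ (2 * m) * (K * (m : ℝ) ^ ((a + b - c).re - 1)) := by
        gcongr
        push_cast
        linarith
    _ = _ := by
        rw [Real.rpow_sub hmr, Real.rpow_one]
        field_simp

/-- The difference of the two sides telescopes with boundary term `c m hcoef a b c m`, which tends
to zero under the convergence condition. -/
theorem tsum_hcoef_succ (hc : ∀ k : ℕ, c ≠ -k) (h : (a + b - c).re < 0) :
    c * (c - a - b) * ∑' m, hcoef a b c m
      = (c - a) * (c - b) * ∑' m, hcoef a b (c + 1) m := by
  have hc0 : c ≠ 0 := by simpa using hc 0
  have h' : (a + b - (c + 1)).re < 0 := by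
    have : (a + b - (c + 1)).re = (a + b - c).re - 1 := by simp; ring
    linarith
  have s1 := (summable_norm_hcoef_one hc h).of_norm.hasSum.mul_left (c * (c - a - b))
  have s2 := (summable_norm_hcoef_one (add_one_ne_neg hc) h').of_norm.hasSum.mul_left
    ((c - a) * (c - b))
  have s3 := s2.sub s1
  have e : ∀ m : ℕ, (c - a) * (c - b) * hcoef a b (c + 1) m - c * (c - a - b) * hcoef a b c m
      = c * (((m + 1 : ℕ) : ℂ) * hcoef a b c (m + 1)) - c * ((m : ℂ) * hcoef a b c m) := by
    intro m
    have hcm : c + m ≠ 0 := fun h => hc m (eq_neg_of_add_eq_zero_left h)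
    have h7 : hcoef a b (c + 1) m = hcoef a b c m * c / (c + m) := by
      rw [eq_div_iff hcm, hcoef_c_add_one hc]
    have h8 : (m : ℂ) + 1 ≠ 0 := by exact_mod_cast m.succ_ne_zero
    rw [h7, hcoef_succ hc]
    push_cast
    field_simp
    ring
  have s4 := s3.tendsto_sum_nat
  simp only [e] at s4
  have e2 : ∀ n : ℕ, ∑ m ∈ Finset.range n, (c * (((m + 1 : ℕ) : ℂ) * hcoef a b c (m + 1))
      - c * ((m : ℂ) * hcoef a b c m)) = c * ((n : ℂ) * hcoef a b c n) := fun n => by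
    rw [Finset.sum_range_sub fun m : ℕ => c * ((m : ℂ) * hcoef a b c m)]
    simp
  simp only [e2] at s4
  have := tendsto_nhds_unique s4 ((tendsto_mul_hcoef hc h).const_mul c)
  rw [mul_zero] at this
  exact (sub_eq_zero.mp this).symm

theorem tsum_hcoef_add_natCast (hc : ∀ k : ℕ, c ≠ -k) (h : (a + b - c).re < 0) (n : ℕ) :
    poch c n * poch (c - a - b) n * ∑' m, hcoef a b c m
      = poch (c - a) n * poch (c - b) n * ∑' m, hcoef a b (c + n) m := by
  induction n with
  | zero => simp
  | succ n ih =>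
    have hcn : ∀ k : ℕ, c + n ≠ -k := fun k hk => hc (k + n) (by
      push_cast; linear_combination hk)
    have hn : (a + b - (c + n)).re < 0 := by
      have : (a + b - (c + n)).re = (a + b - c).re - n := by simp; ring
      have : (0 : ℝ) ≤ n := n.cast_nonneg
      linarith
    have := tsum_hcoef_succ hcn hn
    simp only [poch_succ]
    push_cast
    rw [← add_assoc]
    linear_combination (c + n) * (c - a - b + n) * ih + poch (c - a) n * poch (c - b) n * this

/-- Every coefficient but the first tends to zero; the convergent series with parameters `‖a‖`,
`‖b‖` and `‖a‖ + ‖b‖ + 1` dominates. -/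
theorem tendsto_tsum_hcoef (a b c : ℂ) :
    Tendsto (fun n : ℕ => ∑' m, hcoef a b (c + n) m) atTop (𝓝 1) := by
  set X : ℝ := ‖a‖ + ‖b‖ + 1 with hX
  have hXc : ∀ k : ℕ, (X : ℂ) ≠ -k := fun k hk => by
    have : X = -(k : ℝ) := by exact_mod_cast hk
    have : (0 : ℝ) ≤ k := k.cast_nonneg
    have := norm_nonneg a
    have := norm_nonneg b
    linarith
  have hs := summable_norm_hcoef_one (a := (‖a‖ : ℂ)) (b := (‖b‖ : ℂ)) hXc (by
    rw [hX]; simp)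
  obtain ⟨N, hN⟩ := exists_nat_ge (X - c.re)
  have key := tendsto_tsum_of_dominated_convergence (𝓕 := atTop)
    (f := fun (n : ℕ) m => hcoef a b (c + n) m) (g := fun m : ℕ => if m = 0 then 1 else 0) hs ?_ ?_
  · rwa [tsum_ite_eq] at key
  · intro m
    rcases m with _ | m
    · simp
    · simp only [Nat.succ_ne_zero, if_false]
      have h1 : Tendsto (fun n : ℕ => ‖c + n‖) atTop atTop := by
        refine tendsto_atTop_mono (fun n => ?_) (tendsto_atTop_add_const_left _ c.re
          tendsto_natCast_atTop_atTop)
        simpa using Complex.re_le_norm (c + n)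
      have h2 : Tendsto (fun n : ℕ => ‖poch (c + n) (m + 1)‖) atTop atTop := by
        refine tendsto_atTop_mono' _ ?_ h1
        have hge : ∀ᶠ n : ℕ in atTop, 1 ≤ (c + n).re := by
          obtain ⟨M, hM⟩ := exists_nat_ge (1 - c.re)
          filter_upwards [eventually_ge_atTop M] with n hn
          have : (M : ℝ) ≤ n := by exact_mod_cast hn
          simp only [add_re, natCast_re]
          linarith
        filter_upwards [hge] with n hn
        have : ∀ k : ℕ, ‖c + n‖ ≤ ‖poch (c + n) (k + 1)‖ := fun k => by
          induction k with
          | zero => simp [poch_one]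
          | succ k ih =>
            rw [poch_succ, norm_mul]
            refine ih.trans (le_mul_of_one_le_right (norm_nonneg _) ?_)
            refine le_trans ?_ (Complex.re_le_norm _)
            have : (0 : ℝ) ≤ k := k.cast_nonneg
            simp only [add_re, natCast_re] at hn ⊢
            push_cast
            linarith
        exact this m
      rw [tendsto_zero_iff_norm_tendsto_zero]
      have h3 := (h2.inv_tendsto_atTop).const_mul
        (‖poch a (m + 1) * poch b (m + 1)‖ / ((m + 1).factorial : ℝ))
      rw [mul_zero] at h3
      refine h3.congr fun n => ?_
      rw [hcoef, norm_div, norm_mul (poch (c + n) _), Complex.norm_natCast, Pi.inv_apply]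
      field_simp
  · filter_upwards [eventually_ge_atTop N] with n hn m
    have hge : X ≤ (c + n).re := by
      have : (N : ℝ) ≤ n := by exact_mod_cast hn
      simp only [add_re, natCast_re]
      linarith
    have hX0 : 0 < X := by positivity
    have hp : ∀ k : ℕ, 0 < ‖poch (X : ℂ) k‖ ∧ ‖poch (X : ℂ) k‖ ≤ ‖poch (c + n) k‖ := fun k => by
      induction k with
      | zero => simp
      | succ k ih =>
        rw [poch_succ, poch_succ, norm_mul, norm_mul]
        have e : (X : ℂ) + k = ((X + k : ℝ) : ℂ) := by push_cast; rfl
        have hXk : 0 < X + k := by positivity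
        rw [e, Complex.norm_of_nonneg hXk.le]
        refine ⟨mul_pos ih.1 hXk, mul_le_mul ih.2 ?_ hXk.le (norm_nonneg _)⟩
        refine le_trans ?_ (Complex.re_le_norm _)
        simp only [add_re, natCast_re] at hge ⊢
        linarith
    have hp2 : ∀ (z : ℂ) (k : ℕ), ‖poch z k‖ ≤ ‖poch (‖z‖ : ℂ) k‖ := fun z k => by
      induction k with
      | zero => simp
      | succ k ih =>
        rw [poch_succ, poch_succ, norm_mul, norm_mul]
        refine mul_le_mul ih ?_ (norm_nonneg _) (norm_nonneg _)
        have e : (‖z‖ : ℂ) + k = ((‖z‖ + k : ℝ) : ℂ) := by push_cast; rfl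
        rw [e, Complex.norm_of_nonneg (by positivity)]
        exact (norm_add_le _ _).trans (by rw [Complex.norm_natCast])
    have hfac : (0 : ℝ) < ‖(m.factorial : ℂ)‖ := by
      rw [Complex.norm_natCast]
      exact_mod_cast m.factorial_pos
    rw [hcoef, hcoef, norm_div, norm_div, norm_mul, norm_mul, norm_mul, norm_mul]
    have := hp m
    have h1 := hp2 a m
    have h2 := hp2 b m
    have h3 := this.1
    have h4 := this.2
    gcongr

/-- Gauss's summation formula. -/
theorem tsum_hcoef (hc : ∀ k : ℕ, c ≠ -k) (h : (a + b - c).re < 0) :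
    ∑' m, hcoef a b c m = Gamma c * Gamma (c - a - b) / (Gamma (c - a) * Gamma (c - b)) := by
  have hd : ∀ k : ℕ, c - a - b ≠ -k := fun k hk => by
    have h1 : (a + b - c).re = k := by
      have : a + b - c = k := by linear_combination -hk
      rw [this]
      simp
    have : (0 : ℝ) ≤ k := k.cast_nonneg
    linarith
  set S := ∑' m, hcoef a b c m with hS
  have t1 := ((tendsto_poch_div c).mul (tendsto_poch_div (c - a - b))).mul_const S
  -- In the contiguous relation iterated `m + 1` times the Pochhammer symbols, normalised by powers
  -- of `m` and factorials, become reciprocal Gamma functions, and the shifted series tends to `1`.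
  have t2 := ((tendsto_poch_div (c - a)).mul (tendsto_poch_div (c - b))).mul
    ((tendsto_tsum_hcoef a b c).comp (tendsto_add_atTop_nat 1))
  have t3 := t2.congr' (f₂ := fun m : ℕ => poch c (m + 1) / ((m : ℂ) ^ c * m.factorial)
      * (poch (c - a - b) (m + 1) / ((m : ℂ) ^ (c - a - b) * m.factorial)) * S) (by
    filter_upwards [eventually_gt_atTop 0] with m hm
    have hm' : (m : ℂ) ≠ 0 := by exact_mod_cast hm.ne'
    have e1 := tsum_hcoef_add_natCast hc h (m + 1)
    have e2 : (m : ℂ) ^ (c - a) * (m : ℂ) ^ (c - b) = (m : ℂ) ^ c * (m : ℂ) ^ (c - a - b) := by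
      rw [← Complex.cpow_add _ _ hm', ← Complex.cpow_add _ _ hm']
      ring_nf
    calc _ = (poch (c - a) (m + 1) * poch (c - b) (m + 1) * ∑' k, hcoef a b (c + (m + 1 : ℕ)) k)
          / ((m : ℂ) ^ (c - a) * (m : ℂ) ^ (c - b) * (m.factorial * m.factorial)) := by
          rw [Function.comp_apply, div_mul_div_comm, div_mul_eq_mul_div]
          congr 1
          ring
      _ = _ := by
          rw [← e1, e2, ← hS]
          field_simp)
  have h3 := tendsto_nhds_unique t1 t3
  have h1 := Gamma_ne_zero hc
  have h2 := Gamma_ne_zero hd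
  rw [mul_one, ← mul_inv, ← mul_inv, inv_mul_eq_iff_eq_mul₀ (mul_ne_zero h1 h2)] at h3
  rw [h3, div_eq_mul_inv]

end GaussSum

/-! ### The transform of a power -/

section ForwardIntegral

theorem integrable_of_hasSum {X : Type*} [MeasurableSpace X] {μ : Measure X} {F : ℕ → X → ℂ}
    {f : X → ℂ} (hF : ∀ m, Integrable (F m) μ) (hs : Summable fun m => ∫ x, ‖F m x‖ ∂μ)
    (hf : ∀ᵐ x ∂μ, HasSum (fun m => F m x) (f x)) :
    Integrable f μ ∧ HasSum (fun m => ∫ x, F m x ∂μ) (∫ x, f x ∂μ) := by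
  have hmeas : AEStronglyMeasurable f μ :=
    aestronglyMeasurable_of_tendsto_ae (u := atTop) (f := fun n x => ∑ m ∈ Finset.range n, F m x)
      (fun n => Finset.aestronglyMeasurable_fun_sum _ fun m _ => (hF m).1)
      (hf.mono fun x hx => hx.tendsto_sum_nat)
  refine ⟨⟨hmeas, ?_⟩, ?_⟩
  · have h1 : ∀ m, ∫⁻ x, ‖F m x‖ₑ ∂μ = ENNReal.ofReal (∫ x, ‖F m x‖ ∂μ) := fun m => by
      rw [← ofReal_integral_norm_eq_lintegral_enorm (hF m)]
    calc ∫⁻ x, ‖f x‖ₑ ∂μ ≤ ∫⁻ x, ∑' m, ‖F m x‖ₑ ∂μ := by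
          refine lintegral_mono_ae (hf.mono fun x hx => ?_)
          rw [← hx.tsum_eq]
          exact enorm_tsum_le_tsum_enorm
      _ = ∑' m, ENNReal.ofReal (∫ x, ‖F m x‖ ∂μ) := by
          rw [lintegral_tsum fun m => (hF m).1.enorm]
          exact tsum_congr h1
      _ < ⊤ := hs.tsum_ofReal_lt_top
  · have := hasSum_integral_of_summable_integral_norm hF hs
    rwa [integral_congr_ae (hf.mono fun x hx => hx.tsum_eq)] at this

theorem intervalIntegral_norm_beta {u v : ℂ} (hu : 0 < u.re) (hv : 0 < v.re) :
    ((∫ t in (0 : ℝ)..1, ‖(t : ℂ) ^ (u - 1) * (1 - (t : ℂ)) ^ (v - 1)‖ : ℝ) : ℂ)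
      = Gamma u.re * Gamma v.re / Gamma (u.re + v.re) := by
  rw [← intervalIntegral.integral_ofReal, ← betaIntegral_eq_Gamma_mul_div _ _ (by simpa) (by simpa),
    betaIntegral, intervalIntegral.integral_of_le zero_le_one,
    intervalIntegral.integral_of_le zero_le_one, integral_Ioc_eq_integral_Ioo,
    integral_Ioc_eq_integral_Ioo]
  refine setIntegral_congr_fun measurableSet_Ioo fun t ht => ?_
  have h1 : (0 : ℝ) < 1 - t := by linarith [ht.2]
  have e : 1 - (t : ℂ) = ((1 - t : ℝ) : ℂ) := by push_cast; rfl
  rw [norm_mul, e, Complex.norm_cpow_eq_rpow_re_of_pos ht.1, Complex.norm_cpow_eq_rpow_re_of_pos h1,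
    ofReal_mul, Complex.ofReal_cpow ht.1.le, Complex.ofReal_cpow h1.le]
  simp

variable {u v s : ℝ} {α : ℂ}

/-- The transform of a power: a beta integral of a Gauss hypergeometric function. -/
theorem integral_rpow_mul_th (hc : 0 < u + v) (hs : |α.re| < s) :
    IntervalIntegrable (fun t : ℝ => (t : ℂ) ^ ((u : ℂ) + v - 1)
      * ((1 - (t : ℂ)) ^ ((s : ℂ) - u - 1) * th u v t α)) volume 0 1 ∧
    ∫ t in (0 : ℝ)..1, (t : ℂ) ^ ((u : ℂ) + v - 1)
      * ((1 - (t : ℂ)) ^ ((s : ℂ) - u - 1) * th u v t α)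
      = Gamma (u + v) * gammaPM s α * ((Gamma (s + u))⁻¹ * (Gamma (s + v))⁻¹) := by
  have hcne : ∀ k : ℕ, (u : ℂ) + v ≠ -k := fun k hk => by
    have : u + v = -(k : ℝ) := by exact_mod_cast hk
    have : (0 : ℝ) ≤ k := k.cast_nonneg
    linarith
  have hr : 0 < ((s : ℂ) + α).re := by
    have := neg_abs_le α.re
    simp only [add_re, ofReal_re]
    linarith
  have hcm : ∀ m : ℕ, 0 < ((u : ℂ) + v + m).re := fun m => by
    have : (0 : ℝ) ≤ m := m.cast_nonneg
    simp only [add_re, ofReal_re, natCast_re]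
    linarith
  have hCne : ∀ k : ℕ, (u : ℂ) + v + (s + α) ≠ -k := fun k hk => by
    have h1 := congrArg re hk
    have h2 := hcm 0
    simp only [add_re, ofReal_re, neg_re, natCast_re] at h1 h2 hr
    have : (0 : ℝ) ≤ k := k.cast_nonneg
    push_cast at h2
    linarith
  set r : ℝ := ((s : ℂ) + α).re with hrd
  have hCrne : ∀ k : ℕ, (u : ℂ) + v + r ≠ -k := fun k hk => by
    have h1 := congrArg re hk
    have h2 := hcm 0
    simp only [add_re, ofReal_re, neg_re, natCast_re] at h1 h2
    have : (0 : ℝ) ≤ k := k.cast_nonneg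
    push_cast at h2
    linarith
  have hGc := Gamma_ne_zero hcne
  set F : ℕ → ℝ → ℂ := fun m t => hcoef (u + α) (v + α) (u + v) m
    * ((t : ℂ) ^ ((u : ℂ) + v + m - 1) * (1 - (t : ℂ)) ^ ((s : ℂ) + α - 1)) with hFd
  have key := integrable_of_hasSum (μ := volume.restrict (Set.Ioc (0 : ℝ) 1)) (F := F)
    (f := fun t : ℝ => (t : ℂ) ^ ((u : ℂ) + v - 1)
      * ((1 - (t : ℂ)) ^ ((s : ℂ) - u - 1) * th u v t α)) ?_ ?_ ?_
  · obtain ⟨k1, k2⟩ := key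
    refine ⟨(intervalIntegrable_iff_integrableOn_Ioc_of_le zero_le_one).mpr k1, ?_⟩
    -- Each term is a beta integral; the Gamma quotients turn the coefficients into those of a
    -- series with lower parameter `u + v + s + α`, summed at `1` by Gauss.
    have k3 : ∀ m : ℕ, ∫ t in Set.Ioc (0 : ℝ) 1, F m t
        = Gamma (u + v) * Gamma (s + α) * (Gamma (u + v + (s + α)))⁻¹
          * hcoef (u + α) (v + α) (u + v + (s + α)) m := fun m => by
      rw [← intervalIntegral.integral_of_le zero_le_one, hFd,
        intervalIntegral.integral_const_mul]
      change _ * betaIntegral _ _ = _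
      rw [betaIntegral_eq_Gamma_mul_div _ _ (hcm m) hr, Gamma_add_natCast_eq hcne,
        show (u : ℂ) + v + m + (s + α) = u + v + (s + α) + m by ring, Gamma_add_natCast_eq hCne,
        hcoef, hcoef]
      have := poch_ne_zero_of_field (n := m) hcne
      have := poch_ne_zero_of_field (n := m) hCne
      have := Gamma_ne_zero hCne
      have : (m.factorial : ℂ) ≠ 0 := by exact_mod_cast m.factorial_ne_zero
      field_simp
    have hlt : ((u : ℂ) + α + (v + α) - (u + v + (s + α))).re < 0 := by
      have : (u : ℂ) + α + (v + α) - (u + v + (s + α)) = α - s := by ring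
      rw [this, sub_re, ofReal_re]
      linarith [le_abs_self α.re]
    rw [intervalIntegral.integral_of_le zero_le_one, ← k2.tsum_eq, tsum_congr k3, tsum_mul_left,
      tsum_hcoef hCne hlt, gammaPM,
      show (u : ℂ) + v + (s + α) - (u + α) - (v + α) = s - α by ring,
      show (u : ℂ) + v + (s + α) - (u + α) = s + v by ring,
      show (u : ℂ) + v + (s + α) - (v + α) = s + u by ring]
    have := Gamma_ne_zero hCne
    rw [div_eq_mul_inv, mul_inv]
    field_simp
  · intro m
    exact ((betaIntegral_convergent (hcm m) hr).const_mul _).1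
  -- The same computation for the norms, with `r = Re (s + α)` in place of `s + α`; convergence at
  -- `1` is the condition `Re α < s`.
  · have h1 : ∀ m : ℕ, ∫ t in Set.Ioc (0 : ℝ) 1, ‖F m t‖
        = ‖Gamma (u + v) * Gamma r / Gamma (u + v + r)‖
          * ‖hcoef (u + α) (v + α) (u + v + r) m‖ := fun m => by
      have e0 : ∀ t : ℝ, ‖F m t‖ = ‖hcoef (u + α) (v + α) (u + v) m‖
          * ‖(t : ℂ) ^ ((u : ℂ) + v + m - 1) * (1 - (t : ℂ)) ^ ((s : ℂ) + α - 1)‖ :=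
        fun t => norm_mul _ _
      rw [← intervalIntegral.integral_of_le zero_le_one]
      simp only [e0]
      rw [intervalIntegral.integral_const_mul]
      have e1 := intervalIntegral_norm_beta (hcm m) hr
      set J := ∫ t in (0 : ℝ)..1,
        ‖(t : ℂ) ^ ((u : ℂ) + v + m - 1) * (1 - (t : ℂ)) ^ ((s : ℂ) + α - 1)‖
      have hJ : 0 ≤ J := intervalIntegral.integral_nonneg zero_le_one fun _ _ => norm_nonneg _
      have e2 : (((u : ℂ) + v + m).re : ℂ) = u + v + m := by
        simp
      rw [e2, ← hrd, Gamma_add_natCast_eq hcne,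
        show (u : ℂ) + v + m + r = u + v + r + m by ring, Gamma_add_natCast_eq hCrne] at e1
      rw [← Complex.norm_of_nonneg hJ, e1, ← norm_mul, ← norm_mul, hcoef, hcoef]
      congr 1
      have := poch_ne_zero_of_field (n := m) hcne
      have := poch_ne_zero_of_field (n := m) hCrne
      have := Gamma_ne_zero hCrne
      have : (m.factorial : ℂ) ≠ 0 := by exact_mod_cast m.factorial_ne_zero
      field_simp
    simp only [h1]
    refine (summable_norm_hcoef_one hCrne ?_).mul_left _
    have h2 : ((u : ℂ) + α + (v + α) - (u + v + r)).re = α.re - s := by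
      simp [hrd]; ring
    rw [h2]
    linarith [le_abs_self α.re]
  · refine (ae_restrict_iff' measurableSet_Ioc).mpr ?_
    have : ∀ᵐ t : ℝ, t ≠ 1 := by simp [ae_iff, measure_singleton]
    filter_upwards [this] with t h1 ht
    have ht1 : t < 1 := lt_of_le_of_ne ht.2 h1
    have h0 : (t : ℂ) ≠ 0 := by exact_mod_cast ht.1.ne'
    have hsub := one_sub_ofReal_ne_zero ht1
    have e : (1 - (t : ℂ)) ^ ((s : ℂ) - u - 1) * (1 - (t : ℂ)) ^ ((u : ℂ) + α)
        = (1 - (t : ℂ)) ^ ((s : ℂ) + α - 1) := by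
      rw [← Complex.cpow_add _ _ hsub]
      ring_nf
    have e2 : (t : ℂ) ^ ((u : ℂ) + v - 1) * ((1 - (t : ℂ)) ^ ((s : ℂ) - u - 1) * th u v t α)
        = (t : ℂ) ^ ((u : ℂ) + v - 1) * (1 - (t : ℂ)) ^ ((s : ℂ) + α - 1)
          * hF (u + α) (v + α) (u + v) t := by
      rw [← e, th]
      ring
    rw [e2]
    refine hasSum_of_eq ((hasSum_hF hcne (norm_ofReal_lt_one ht.1.le ht1)).mul_left _) fun m => ?_
    rw [hFd]
    simp only
    rw [show (u : ℂ) + v + m - 1 = u + v - 1 + m by ring, Complex.cpow_add _ _ h0,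
      Complex.cpow_natCast]
    ring

end ForwardIntegral

/-! ### The value of the Mellin-Barnes integral of three Gamma pairs -/

section Value

variable {u v s s' : ℝ}

theorem Admissible.of_pos {a b c : ℝ} (ha : 0 < a) (hb : 0 < b) (hc : 0 < c) : Admissible a b c := by
  constructor <;> intro k hk <;> linarith [(Nat.cast_nonneg k : (0 : ℝ) ≤ k)]

/-- The Mellin-Barnes integral is a plain integral over the imaginary axis if all parameters are
positive. -/
theorem mbInt_of_pos {a b c : ℝ} (ha : 0 < a) (hb : 0 < b) (hc : 0 < c) (E : ℂ → ℂ) :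
    mbInt a b c E = 1 / (2 * Real.pi) * ∫ t : ℝ, kern a b c (fun α => α * E α) (t * I) := by
  have hpos : ∀ p ∈ ({a, b, c} : Set ℝ), 0 < p := by
    rintro p (rfl | rfl | rfl) <;> assumption
  have hL : {x : ℝ | x ∈ leftPoles {a, b, c} ∧ 0 < x} = ∅ := by
    refine Set.eq_empty_of_forall_notMem ?_
    rintro x ⟨⟨p, hp, k, rfl⟩, hx⟩
    linarith [hpos p hp, (Nat.cast_nonneg k : (0 : ℝ) ≤ k)]
  have hR : {x : ℝ | x ∈ rightPoles {a, b, c} ∧ x < 0} = ∅ := by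
    refine Set.eq_empty_of_forall_notMem ?_
    rintro x ⟨⟨p, hp, k, rfl⟩, hx⟩
    linarith [hpos p hp, (Nat.cast_nonneg k : (0 : ℝ) ≤ k)]
  rw [mbInt, mellinBarnes, hL, hR]
  simp

/-- On the imaginary axis `(u+α)(u-α)` is real and positive, so the growth rate in the energy
estimate is zero. This uniform bound is what Fubini needs below. -/
theorem norm_th_mul_I_le_one (hc : 1 / 2 ≤ u + v) (hu : 0 < u) {t : ℝ} (h0 : 0 ≤ t) (h1 : t < 1)
    (τ : ℝ) : ‖th u v t (τ * I)‖ ≤ 1 := by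
  have e : ((u : ℂ) + τ * I) * (u - τ * I) = ((u ^ 2 + τ ^ 2 : ℝ) : ℂ) := by
    push_cast
    linear_combination -(τ : ℂ) ^ 2 * I_sq
  have hsq0 : √t < 1 := by rw [Real.sqrt_lt' one_pos]; simpa
  have hsq : -1 < √t := by linarith [Real.sqrt_nonneg t]
  have key := norm_th_tanhSq_le hc hu.le (α := τ * I) (by rw [e, ofReal_re]; positivity)
    (Real.artanh_nonneg (Real.sqrt_nonneg t))
  rw [← Real.tanh_eq_sinh_div_cosh, Real.tanh_artanh ⟨hsq, hsq0⟩, Real.sq_sqrt h0, e, ofReal_im,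
    abs_zero, mul_zero, zero_div, zero_mul, Real.exp_zero] at key
  exact (sq_le_one_iff₀ (norm_nonneg _)).mp key

theorem stronglyMeasurable_indicator_th (hc : ∀ k : ℕ, u + v ≠ -k) :
    StronglyMeasurable (Function.uncurry fun (τ : ℝ) (t : ℝ) =>
      (Set.Ioo (0 : ℝ) 1).indicator (fun t => th u v t (τ * I)) t) := by
  refine stronglyMeasurable_uncurry_of_continuous_of_stronglyMeasurable (fun t => ?_) fun τ => ?_
  · by_cases ht : t ∈ Set.Ioo (0 : ℝ) 1
    · simp only [Set.indicator_of_mem ht]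
      exact (differentiable_th hc ht.1.le ht.2).continuous.comp (by fun_prop)
    · simp only [Set.indicator_of_notMem ht]
      exact continuous_const
  · refine Measurable.stronglyMeasurable ?_
    rw [← Set.piecewise_eq_indicator]
    exact ((continuousOn_th hc _).mono Set.Ioo_subset_Ico_self).measurable_piecewise
      continuousOn_const measurableSet_Ioo

/-- Integrate `mbInt_th` against `t^{u+v-1} (1-t)^{s'-u-1}` in two orders. The `t`-integral of the
right side is a beta integral. On the left, the `t`-integral of the Jacobi function is known and
produces the fourth pair `Γ(s' ± α)`. -/
theorem mbInt_mul_beta (hu : 0 < u) (hv : 0 < v) (hs : 0 < s) (hc : 1 / 2 ≤ u + v) (hs' : u < s') :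
    mbInt u v s (fun _ => 1) * (Gamma (u + v) * Gamma (s + s') / Gamma (u + v + (s + s')))
      = 1 / (2 * Real.pi) * (∫ τ : ℝ, kern u v s (fun α => α * 1) (τ * I) * gammaPM s' (τ * I))
        * (Gamma (u + v) * ((Gamma (s' + u))⁻¹ * (Gamma (s' + v))⁻¹)) := by
  have h := Admissible.of_pos hu hv hs
  set K : ℝ → ℂ := fun τ => kern u v s (fun α => α * 1) (τ * I) with hK
  set W : ℝ → ℂ := fun t => (t : ℂ) ^ ((u : ℂ) + v - 1) * (1 - (t : ℂ)) ^ ((s' : ℂ) - u - 1) with hW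
  set H : ℝ → ℝ → ℂ := fun τ t => (Set.Ioo (0 : ℝ) 1).indicator (fun t => th u v t (τ * I)) t with hH
  have hKi : Integrable K := integrable_kern h (StripPoly.const 1)
  have hWi : Integrable W (volume.restrict (Set.Ioo 0 1)) := by
    have := betaIntegral_convergent (u := (u : ℂ) + v) (v := (s' : ℂ) - u)
      (by simp; linarith) (by simpa using hs')
    rw [intervalIntegrable_iff_integrableOn_Ioo_of_le zero_le_one] at this
    exact this
  have hint : Integrable (Function.uncurry fun τ t => K τ * (W t * H τ t))
      (volume.prod (volume.restrict (Set.Ioo 0 1))) := by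
    have h1 := (hKi.mul_prod hWi).bdd_mul (c := 1)
      (stronglyMeasurable_indicator_th h.ab).aestronglyMeasurable (Eventually.of_forall fun z => by
        obtain ⟨τ, t⟩ := z
        simp only [Function.uncurry_apply_pair]
        by_cases ht : t ∈ Set.Ioo (0 : ℝ) 1
        · rw [Set.indicator_of_mem ht]
          exact norm_th_mul_I_le_one hc hu ht.1.le ht.2 τ
        · rw [Set.indicator_of_notMem ht, norm_zero]
          exact zero_le_one)
    refine h1.congr (Eventually.of_forall fun z => ?_)
    obtain ⟨τ, t⟩ := z
    simp only [Function.uncurry_apply_pair, hH]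
    ring
  have hswap := integral_integral_swap hint
  have e1 : ∀ τ : ℝ, ∫ t in Set.Ioo (0 : ℝ) 1, K τ * (W t * H τ t)
      = K τ * gammaPM s' (τ * I) * (Gamma (u + v) * ((Gamma (s' + u))⁻¹ * (Gamma (s' + v))⁻¹)) := fun τ => by
    have h2 := (integral_rpow_mul_th (u := u) (v := v) (s := s') (α := τ * I) (by linarith)
      (by simp; linarith)).2
    rw [intervalIntegral.integral_of_le zero_le_one, integral_Ioc_eq_integral_Ioo] at h2
    rw [integral_const_mul, mul_assoc, ← mul_assoc (gammaPM _ _), mul_comm (gammaPM _ _), ← h2]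
    congr 1
    refine setIntegral_congr_fun measurableSet_Ioo fun t ht => ?_
    simp only [hW, hH, Set.indicator_of_mem ht]
    ring
  have e2 : ∀ t ∈ Set.Ioo (0 : ℝ) 1, 1 / (2 * Real.pi) * ∫ τ, K τ * (W t * H τ t)
      = mbInt u v s (fun _ => 1) * ((t : ℂ) ^ ((u : ℂ) + v - 1) * (1 - (t : ℂ)) ^ ((s : ℂ) + s' - 1)) :=
    fun t ht => by
    have h3 := mbInt_th h ht.1.le ht.2
    rw [mbInt_of_pos hu hv hs (th u v t)] at h3
    have e3 : ∀ τ : ℝ, K τ * (W t * H τ t)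
        = W t * kern u v s (fun α => α * th u v t α) (τ * I) := fun τ => by
      simp only [hK, hH, Set.indicator_of_mem ht, kern]
      ring
    simp only [e3]
    rw [integral_const_mul, mul_left_comm, h3, hW,
      show (s : ℂ) + s' - 1 = (s' - u - 1) + (s + u) by ring,
      Complex.cpow_add ((s' : ℂ) - u - 1) ((s : ℂ) + u) (one_sub_ofReal_ne_zero ht.2)]
    ring
  have e4 : ∫ t in Set.Ioo (0 : ℝ) 1, (t : ℂ) ^ ((u : ℂ) + v - 1) * (1 - (t : ℂ)) ^ ((s : ℂ) + s' - 1)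
      = Gamma (u + v) * Gamma (s + s') / Gamma (u + v + (s + s')) := by
    rw [← betaIntegral_eq_Gamma_mul_div _ _ (by simp; linarith) (by simp; linarith), betaIntegral,
      intervalIntegral.integral_of_le zero_le_one, integral_Ioc_eq_integral_Ioo]
  rw [← e4, ← integral_const_mul, ← setIntegral_congr_fun measurableSet_Ioo e2, integral_const_mul,
    ← hswap]
  simp only [e1]
  rw [integral_mul_const, mul_assoc]

/-- The quotient of a Mellin-Barnes integral by its expected value. -/
noncomputable def mbRatio (u v s : ℝ) : ℂ :=
  mbInt u v s (fun _ => 1) / (Gamma (u + v) * Gamma (u + s) * Gamma (v + s))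

theorem mbRatio_swap_one_two (u v s : ℝ) : mbRatio u v s = mbRatio v u s := by
  rw [mbRatio, mbRatio, mbInt_swap_one_two, add_comm (u : ℂ) v]
  ring

theorem mbRatio_swap_one_three (u v s : ℝ) : mbRatio u v s = mbRatio s v u := by
  rw [mbRatio, mbRatio, mbInt_swap_one_three, add_comm (u : ℂ) s, add_comm (s : ℂ) v, add_comm (u : ℂ) v]
  ring

theorem ofReal_add_ne_neg {a b : ℝ} (h : ∀ k : ℕ, a + b ≠ -k) (k : ℕ) : (a : ℂ) + b ≠ -k :=
  fun hk => h k (by exact_mod_cast hk)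

/-- Integral and expected value obey the same recurrence `(u+v)(u+s)`. -/
theorem mbRatio_add_natCast (h : Admissible u v s) (n : ℕ) : mbRatio (u + n) v s = mbRatio u v s := by
  induction n with
  | zero => simp
  | succ n ih =>
    rw [← ih, Nat.cast_succ, ← add_assoc]
    have h' := h.add_natCast n
    generalize u + (n : ℝ) = a at h'
    have h1 : (a : ℂ) + v ≠ 0 := by simpa using ofReal_add_ne_neg h'.ab 0
    have h2 : (a : ℂ) + s ≠ 0 := by simpa using ofReal_add_ne_neg h'.ac 0
    rw [mbRatio, mbRatio, mbInt_one_add_one h', ofReal_add, ofReal_one, add_right_comm, add_right_comm _ 1,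
      Complex.Gamma_add_one _ h1, Complex.Gamma_add_one _ h2]
    have := Gamma_ne_zero (ofReal_add_ne_neg h'.ab)
    have := Gamma_ne_zero (ofReal_add_ne_neg h'.ac)
    have := Gamma_ne_zero (ofReal_add_ne_neg h'.bc)
    field_simp

/-- The integral with four Gamma pairs in `mbInt_mul_beta` is symmetric in `s` and `s'`; comparing
the two evaluations gives the claim. -/
theorem mbRatio_eq_of_pos (hu : 0 < u) (hv : 0 < v) (hc : 1 / 2 ≤ u + v) (hs : u < s) (hs' : u < s') :
    mbRatio u v s = mbRatio u v s' := by
  have k1 := mbInt_mul_beta hu hv (hu.trans hs) hc hs'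
  have k2 := mbInt_mul_beta hu hv (hu.trans hs') hc hs
  have e : ∀ τ : ℝ, kern u v s (fun α => α * 1) (τ * I) * gammaPM s' (τ * I)
      = kern u v s' (fun α => α * 1) (τ * I) * gammaPM s (τ * I) := fun τ => by
    simp only [kern]
    ring
  simp only [e] at k1
  set J := ∫ τ : ℝ, kern u v s' (fun α => α * 1) (τ * I) * gammaPM s (τ * I)
  have hG : ∀ x y : ℝ, 0 < x → 0 < y → Gamma ((x : ℂ) + y) ≠ 0 := fun x y hx hy =>
    Gamma_ne_zero_of_re_pos (by simp; linarith)
  have hs0 := hu.trans hs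
  have hs0' := hu.trans hs'
  have g1 := hG u v hu hv
  have g2 := hG s s' hs0 hs0'
  have g3 := hG u s hu hs0
  have g4 := hG u s' hu hs0'
  have g5 := hG v s hv hs0
  have g6 := hG v s' hv hs0'
  have g7 : Gamma ((u : ℂ) + v + (s + s')) ≠ 0 := Gamma_ne_zero_of_re_pos (by simp; linarith)
  rw [add_comm (s' : ℂ) u, add_comm (s' : ℂ) v] at k1
  rw [add_comm (s : ℂ) u, add_comm (s : ℂ) v, add_comm (s' : ℂ) s] at k2
  rw [mbRatio, mbRatio]
  have hP : (2 * Real.pi : ℂ) ≠ 0 := by exact_mod_cast Real.two_pi_pos.ne'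
  field_simp at k1 k2 ⊢
  have hpi : (Real.pi : ℂ) ≠ 0 := by exact_mod_cast Real.pi_ne_zero
  refine mul_right_cancel₀ (mul_ne_zero g2 (mul_ne_zero hpi two_ne_zero)) ?_
  linear_combination k1 - k2

/-- Periodicity moves the parameters into the region where all contours are the imaginary axis and
`mbRatio_eq_of_pos` applies. -/
theorem mbRatio_eq_mbRatio (h : Admissible u v s) (h' : Admissible u v s') :
    mbRatio u v s = mbRatio u v s' := by
  obtain ⟨n, hn⟩ := exists_nat_ge (max (1 - u) (1 - v))
  have hu := (le_max_left _ _).trans hn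
  have hv := (le_max_right _ _).trans hn
  obtain ⟨m, hm⟩ := exists_nat_ge (max (1 + u + n - s) (1 + u + n - s'))
  have hs := (le_max_left _ _).trans hm
  have hs' := (le_max_right _ _).trans hm
  have shift : ∀ r : ℝ, Admissible u v r → mbRatio (u + n) (v + n) (r + m) = mbRatio u v r := fun r hr => by
    have a1 := hr.swap_one_three.add_natCast m
    have a2 := a1.swap_one_three.add_natCast n
    have a3 := a2.swap_one_two
    rw [mbRatio_swap_one_two, mbRatio_add_natCast a3, mbRatio_swap_one_two,
      mbRatio_add_natCast a1.swap_one_three, mbRatio_swap_one_three,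
      mbRatio_add_natCast hr.swap_one_three, mbRatio_swap_one_three]
  rw [← shift s h, ← shift s' h']
  exact mbRatio_eq_of_pos (by linarith) (by linarith) (by linarith) (by linarith) (by linarith)

theorem mbRatio_eq_half (h : Admissible u v s) : mbRatio u v s = mbRatio (1 / 2) (1 / 2) (1 / 2) := by
  obtain ⟨m, hm⟩ := exists_nat_ge (max (-u) (-v))
  have hu := (le_max_left _ _).trans hm
  have hv := (le_max_right _ _).trans hm
  have hm0 : (0 : ℝ) ≤ m := m.cast_nonneg
  set w : ℝ := 1 / 2 + m with hw
  have hp : ∀ x : ℝ, 0 < x → ∀ k : ℕ, x ≠ -k := fun x hx k hk => by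
    linarith [(Nat.cast_nonneg k : (0 : ℝ) ≤ k)]
  have a1 : Admissible u v w := ⟨h.ab, hp _ (by linarith), hp _ (by linarith)⟩
  have a2 : Admissible w v w := ⟨hp _ (by linarith), hp _ (by linarith), hp _ (by linarith)⟩
  have a3 : Admissible w w (1 / 2) := ⟨hp _ (by linarith), hp _ (by linarith), hp _ (by linarith)⟩
  have b : Admissible (1 / 2) (1 / 2) (1 / 2) := Admissible.of_pos (by norm_num) (by norm_num) (by norm_num)
  have b1 := b.add_natCast m
  rw [mbRatio_eq_mbRatio h a1, mbRatio_swap_one_three,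
    mbRatio_eq_mbRatio a1.swap_one_three a2, mbRatio_swap_one_two, mbRatio_swap_one_three,
    mbRatio_eq_mbRatio a2.swap_one_two.swap_one_three a3, hw,
    mbRatio_add_natCast b1.swap_one_two, mbRatio_swap_one_two, mbRatio_add_natCast b]

theorem tendsto_mul_inv_cosh {l : Filter ℝ} (hl : Tendsto (fun x : ℝ => |x|) l atTop) :
    Tendsto (fun x : ℝ => x / Real.cosh (Real.pi * x)) l (𝓝 0) := by
  rw [tendsto_zero_iff_norm_tendsto_zero]
  have h := ((Real.tendsto_pow_mul_exp_neg_atTop_nhds_zero 1).comp hl).const_mul 2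
  rw [mul_zero] at h
  refine squeeze_zero (fun _ => norm_nonneg _) (fun x => ?_) h
  have h1 : Real.exp |x| ≤ 2 * Real.cosh (Real.pi * x) := by
    rw [← Real.cosh_abs (Real.pi * x), abs_mul, abs_of_pos Real.pi_pos, Real.cosh_eq]
    have := Real.exp_le_exp.mpr
      (le_mul_of_one_le_left (abs_nonneg x) (by linarith [Real.pi_gt_three] : 1 ≤ Real.pi))
    linarith [Real.exp_pos (-(Real.pi * |x|))]
  have h2 := Real.cosh_pos (Real.pi * x)
  rw [Function.comp_apply, norm_div, Real.norm_eq_abs, Real.norm_of_nonneg h2.le, pow_one,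
    Real.exp_neg, div_le_iff₀ h2]
  have h3 : 1 ≤ 2 * (Real.exp |x|)⁻¹ * Real.cosh (Real.pi * x) := by
    rw [mul_right_comm, ← div_eq_mul_inv, le_div_iff₀ (Real.exp_pos _)]
    linarith
  nlinarith [abs_nonneg x]

theorem gammaPM_half_mul_I (τ : ℝ) :
    gammaPM (1 / 2) (τ * I) = ((Real.pi / Real.cosh (Real.pi * τ) : ℝ) : ℂ) := by
  have h := Complex.Gamma_mul_Gamma_one_sub (1 / 2 + τ * I)
  have e : Complex.sin (Real.pi * (1 / 2 + τ * I)) = Complex.cosh (Real.pi * τ) := by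
    rw [show (Real.pi : ℂ) * (1 / 2 + τ * I) = Real.pi * τ * I + Real.pi / 2 by ring,
      Complex.sin_add_pi_div_two, Complex.cos_mul_I]
  rw [e] at h
  rw [gammaPM]
  push_cast
  rw [← h]
  congr 2
  ring

/-- With all parameters `1/2` each Gamma pair is `π / cosh(πτ)`. The integrand is then a multiple of
`πτ sinh(πτ) / cosh²(πτ)`, with primitive `(2/π) arctan(exp(πτ)) - τ / cosh(πτ)` and total integral
`1`. -/
theorem mbRatio_half : mbRatio (1 / 2) (1 / 2) (1 / 2) = -Real.pi := by
  have h2 : (0 : ℝ) < 1 / 2 := by norm_num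
  have hi := integrable_kern (Admissible.of_pos h2 h2 h2) (StripPoly.const 1)
  set f : ℝ → ℝ := fun τ =>
    Real.pi * τ * Real.sinh (Real.pi * τ) / Real.cosh (Real.pi * τ) ^ 2 with hf
  have e : (fun τ : ℝ => kern (1 / 2) (1 / 2) (1 / 2) (fun α => α * 1) (τ * I))
      = fun τ => (-2 * Real.pi ^ 2 : ℂ) * (f τ : ℂ) := by
    funext τ
    have hs : Complex.sin (2 * Real.pi * (τ * I))
        = 2 * Complex.sinh (Real.pi * τ) * Complex.cosh (Real.pi * τ) * I := by
      rw [show (2 * Real.pi * (τ * I) : ℂ) = (2 * (Real.pi * τ)) * I by ring, Complex.sin_mul_I,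
        Complex.sinh_two_mul]
    have hc : Complex.cosh (Real.pi * τ) ≠ 0 := by
      exact_mod_cast (Real.cosh_pos (Real.pi * τ)).ne'
    rw [kern, gammaPM_half_mul_I, hs, hf]
    push_cast
    field_simp
    rw [I_sq]
    ring
  have hfi : Integrable f := by
    rw [e] at hi
    have hne : (-2 * Real.pi ^ 2 : ℂ) ≠ 0 := by
      simp [Real.pi_ne_zero]
    have := (integrable_const_mul_iff (IsUnit.mk0 _ hne) _).mp hi
    simpa using this.re
  have hder : ∀ τ : ℝ, HasDerivAt (fun x : ℝ => 2 / Real.pi * Real.arctan (Real.exp (Real.pi * x))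
      - x / Real.cosh (Real.pi * x)) (f τ) τ := fun τ => by
    have hc := Real.cosh_pos (Real.pi * τ)
    have d0 : HasDerivAt (fun x : ℝ => Real.pi * x) Real.pi τ := by
      simpa using (hasDerivAt_id τ).const_mul Real.pi
    have d1 := ((d0.exp).arctan).const_mul (2 / Real.pi)
    have d2 := (hasDerivAt_id τ).div d0.cosh hc.ne'
    refine (d1.sub d2).congr_deriv ?_
    have h1 : 1 + Real.exp (Real.pi * τ) ^ 2 = 2 * Real.exp (Real.pi * τ) * Real.cosh (Real.pi * τ) := by
      rw [Real.cosh_eq, Real.exp_neg]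
      field_simp
      ring
    rw [h1, hf]
    simp only [id]
    field_simp
    ring
  have hint := integral_of_hasDerivAt_of_tendsto hder hfi
    (m := 2 / Real.pi * Real.arctan 0 - 0) (n := 2 / Real.pi * (Real.pi / 2) - 0)
    (((Real.continuous_arctan.tendsto 0).comp (Real.tendsto_exp_atBot.comp
      (tendsto_id.const_mul_atBot Real.pi_pos))).const_mul _ |>.sub
        (tendsto_mul_inv_cosh tendsto_abs_atBot_atTop))
    ((((tendsto_nhds_of_tendsto_nhdsWithin Real.tendsto_arctan_atTop).comp (Real.tendsto_exp_atTop.comp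
      (tendsto_id.const_mul_atTop Real.pi_pos))).const_mul _).sub
        (tendsto_mul_inv_cosh tendsto_abs_atTop_atTop))
  have hI : ∫ τ, f τ = 1 := by
    rw [hint, Real.arctan_zero]
    field_simp
    ring
  have hpi : (Real.pi : ℂ) ≠ 0 := by exact_mod_cast Real.pi_ne_zero
  rw [mbRatio, mbInt_of_pos h2 h2 h2, e, integral_const_mul, integral_complex_ofReal, hI]
  have h1 : (((1 / 2 : ℝ) : ℂ) + ((1 / 2 : ℝ) : ℂ)) = 1 := by push_cast; norm_num
  rw [h1, Complex.Gamma_one]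
  push_cast
  field_simp

/-- The Mellin-Barnes integral of three Gamma factors (continuous dual Hahn weight). -/
theorem mbInt_const_one (h : Admissible u v s) :
    mbInt u v s (fun _ => 1) = -Real.pi * (Gamma (u + v) * Gamma (u + s) * Gamma (v + s)) := by
  have h1 := Gamma_ne_zero (ofReal_add_ne_neg h.ab)
  have h2 := Gamma_ne_zero (ofReal_add_ne_neg h.ac)
  have h3 := Gamma_ne_zero (ofReal_add_ne_neg h.bc)
  rw [← mbRatio_half, ← mbRatio_eq_half h, mbRatio, div_mul_cancel₀]
  exact mul_ne_zero (mul_ne_zero h1 h2) h3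

end Value

/-! ### From powers to polynomials -/

section Expansion

variable {u v s r : ℝ} {α : ℂ}

/-- The coefficients of `n! P_n^{(r,p)}(1 - 2x)`. -/
noncomputable def jacobiCoeff (n : ℕ) (r p : ℝ) (k : ℕ) : ℂ :=
  poch (-(n : ℂ)) k * poch ((n : ℂ) + r + p + 1) k * poch ((r : ℂ) + 1 + k) (n - k) / k.factorial

theorem factorial_mul_jacobiP (n : ℕ) (r p x : ℝ) :
    (n.factorial : ℂ) * (jacobiP n r p (1 - 2 * x) : ℂ)
      = ∑ k ∈ Finset.range (n + 1), jacobiCoeff n r p k * (x : ℂ) ^ k := by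
  rw [jacobiP, ofReal_sum, Finset.mul_sum]
  refine Finset.sum_congr rfl fun k hk => ?_
  rw [jacobiCoeff, poch_neg_natCast (Nat.lt_succ_iff.mp (Finset.mem_range.mp hk)),
    show (1 - 2 * x - 1) / 2 = -x by ring]
  push_cast [poch_ofReal]
  have h1 : (k.factorial : ℂ) ≠ 0 := by exact_mod_cast k.factorial_ne_zero
  have h2 : ((n - k).factorial : ℂ) ≠ 0 := by exact_mod_cast (n - k).factorial_ne_zero
  rw [neg_pow]
  field_simp

/-- Counterpart of `factorial_mul_jacobiP`: with first two parameters summing to `r + 1`, the Wilson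
polynomial has the same coefficients in `(s ± α)_k` as the Jacobi polynomial in `x ^ k`, apart from
two Pochhammer factors that come from Gamma quotients. -/
theorem wilsonP_eq_sum (n : ℕ) (α : ℂ) :
    wilsonP n s (r + 1 - s) v u α = ∑ k ∈ Finset.range (n + 1), jacobiCoeff n r (u + v - 1) k
      * (poch ((s : ℂ) + u + k) (n - k) * poch ((s : ℂ) + v + k) (n - k))
      * (poch ((s : ℂ) + α) k * poch ((s : ℂ) - α) k) := by
  refine Finset.sum_congr rfl fun k _ => ?_
  rw [jacobiCoeff]
  push_cast
  rw [show (n : ℂ) + s + (r + 1 - s) + v + u - 1 = n + r + (u + v - 1) + 1 by ring,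
    show (s : ℂ) + (r + 1 - s) + k = r + 1 + k by ring]
  ring

/-- Also correct at the poles of `Γ(y)`: there the default value `Gamma y = 0` agrees with the
vanishing of the Pochhammer symbol. Hence the transforms need only `Γ(s+u+n)` and `Γ(s+v+n)` to be
finite. -/
theorem Gamma_add_mul_inv_Gamma {y : ℂ} {m : ℕ} (h : ∀ j : ℕ, y + m ≠ -j) :
    Gamma (y + m) * (Gamma y)⁻¹ = poch y m := by
  by_cases hy : ∀ k : ℕ, y ≠ -k
  · rw [Gamma_add_natCast_eq hy, mul_inv_cancel_right₀ (Gamma_ne_zero hy)]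
  · push Not at hy
    obtain ⟨k, rfl⟩ := hy
    rw [Complex.Gamma_neg_nat_eq_zero, inv_zero, mul_zero, poch_eq_zero_of_lt]
    by_contra hk
    push Not at hk
    exact h (k - m) (by rw [Nat.cast_sub hk]; ring)

theorem gammaPM_add_natCast (h1 : 0 < (s + α).re) (h2 : 0 < (s - α).re) (k : ℕ) :
    gammaPM (s + k) α = poch ((s : ℂ) + α) k * poch ((s : ℂ) - α) k * gammaPM s α := by
  have key : ∀ z : ℂ, 0 < z.re → ∀ j : ℕ, z ≠ -j := fun z hz j hj => by
    rw [hj] at hz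
    simp only [neg_re, natCast_re] at hz
    linarith [(Nat.cast_nonneg j : (0 : ℝ) ≤ j)]
  rw [gammaPM, gammaPM, ofReal_add, ofReal_natCast, add_right_comm, add_sub_right_comm,
    Gamma_add_natCast_eq (key _ h1), Gamma_add_natCast_eq (key _ h2)]
  ring

/-- The transform of `x ^ (s + u) * P_n^{(r,p)}(1 - 2x)`. -/
theorem integral_jacobiP_mul_th (n : ℕ) (hc : 0 < u + v) (hs : |α.re| < s)
    (hu : ∀ k : ℕ, s + u + n ≠ -k) (hv : ∀ k : ℕ, s + v + n ≠ -k) {g : ℝ → ℂ}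
    (hg : ∀ t ∈ Set.Ioo (0 : ℝ) 1, g t = ((n.factorial * Real.Gamma (s + u + n) * Real.Gamma (s + v + n)
      * (t ^ (u + v - 1) * (1 - t) ^ (s - u - 1)) * jacobiP n r (u + v - 1) (1 - 2 * (1 - t)) : ℝ) : ℂ)
      * th u v t α) :
    IntervalIntegrable g volume 0 1 ∧
      ∫ t in (0 : ℝ)..1, g t = Gamma (u + v) * gammaPM s α * wilsonP n s (r + 1 - s) v u α := by
  set c : ℕ → ℂ := fun k => Gamma (s + u + n) * Gamma (s + v + n) * jacobiCoeff n r (u + v - 1) k with hcd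
  set f : ℕ → ℝ → ℂ := fun k t => c k * ((t : ℂ) ^ ((u : ℂ) + v - 1)
      * ((1 - (t : ℂ)) ^ (((s + k : ℝ) : ℂ) - u - 1) * th u v t α)) with hf
  have hre := abs_lt.mp hs
  have h1 : 0 < ((s : ℂ) + α).re := by simp only [add_re, ofReal_re]; linarith [hre.1]
  have h2 : 0 < ((s : ℂ) - α).re := by simp only [sub_re, ofReal_re]; linarith [hre.2]
  have hk : ∀ k : ℕ, |α.re| < s + k := fun k => by
    linarith [(Nat.cast_nonneg k : (0 : ℝ) ≤ k)]
  have hfi : ∀ k, IntervalIntegrable (f k) volume 0 1 := fun k =>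
    (integral_rpow_mul_th hc (hk k)).1.const_mul _
  have e : Set.EqOn (fun t => ∑ k ∈ Finset.range (n + 1), f k t) g (Set.uIoo 0 1) := fun t ht => by
    rw [Set.uIoo_of_le zero_le_one] at ht
    have h3 : (0 : ℝ) < 1 - t := by linarith [ht.2]
    have h4 := one_sub_ofReal_ne_zero ht.2
    have hj := factorial_mul_jacobiP n r (u + v - 1) (1 - t)
    simp only
    rw [hg t ht]
    have h5 : ((n.factorial * Real.Gamma (s + u + n) * Real.Gamma (s + v + n)
        * (t ^ (u + v - 1) * (1 - t) ^ (s - u - 1)) * jacobiP n r (u + v - 1) (1 - 2 * (1 - t)) : ℝ) : ℂ)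
        = Gamma (s + u + n) * Gamma (s + v + n)
          * ((t : ℂ) ^ ((u : ℂ) + v - 1) * (1 - (t : ℂ)) ^ ((s : ℂ) - u - 1))
          * (n.factorial * (jacobiP n r (u + v - 1) (1 - 2 * (1 - t)) : ℂ)) := by
      rw [ofReal_mul, ofReal_mul, ofReal_mul, ofReal_mul, ofReal_mul, Complex.ofReal_cpow ht.1.le,
        Complex.ofReal_cpow h3.le, ← Complex.Gamma_ofReal, ← Complex.Gamma_ofReal]
      push_cast
      ring
    rw [h5, hj, Finset.mul_sum, Finset.sum_mul]
    refine Finset.sum_congr rfl fun k _ => ?_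
    simp only [hf, hcd]
    push_cast
    rw [show (s : ℂ) + k - u - 1 = s - u - 1 + k by ring, Complex.cpow_add _ _ h4, Complex.cpow_natCast]
    ring
  have hu' : ∀ k : ℕ, (s : ℂ) + u + n ≠ -k := fun k hk => hu k (by exact_mod_cast hk)
  have hv' : ∀ k : ℕ, (s : ℂ) + v + n ≠ -k := fun k hk => hv k (by exact_mod_cast hk)
  refine ⟨?_, ?_⟩
  · refine IntervalIntegrable.congr_uIoo ?_ e
    have := IntervalIntegrable.sum (Finset.range (n + 1)) fun k _ => hfi k
    rwa [show (∑ k ∈ Finset.range (n + 1), f k) = fun t => ∑ k ∈ Finset.range (n + 1), f k t from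
      funext fun t => Finset.sum_apply _ _ _] at this
  · rw [← intervalIntegral.integral_congr_uIoo e,
      intervalIntegral.integral_finsetSum fun k _ => hfi k, wilsonP_eq_sum, Finset.mul_sum]
    refine Finset.sum_congr rfl fun k hkn => ?_
    have hkn' : k ≤ n := Nat.lt_succ_iff.mp (Finset.mem_range.mp hkn)
    have en : (n : ℂ) = k + (n - k : ℕ) := by rw [Nat.cast_sub hkn']; ring
    simp only [hf, hcd]
    -- The power `x ^ k` raises `s` to `s + k`. The reciprocal Gamma functions of the integral,
    -- multiplied by `Γ(s+u+n) Γ(s+v+n)`, are the Pochhammer factors of the Wilson coefficients.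
    rw [intervalIntegral.integral_const_mul, (integral_rpow_mul_th hc (hk k)).2,
      gammaPM_add_natCast h1 h2, ← Gamma_add_mul_inv_Gamma (y := (s : ℂ) + u + k) (m := n - k) ?_,
      ← Gamma_add_mul_inv_Gamma (y := (s : ℂ) + v + k) (m := n - k) ?_]
    · rw [add_assoc ((s : ℂ) + u), ← en, add_assoc ((s : ℂ) + v), ← en]
      push_cast
      rw [add_right_comm (s : ℂ) k u, add_right_comm (s : ℂ) k v]
      ring
    · rw [add_assoc, ← en]
      exact hv'
    · rw [add_assoc, ← en]
      exact hu'

theorem mbInt_add_natCast (h : Admissible u v s) {E : ℂ → ℂ} (hE : StripPoly E) (k : ℕ) :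
    mbInt u v s (fun α => poch ((s : ℂ) + α) k * poch ((s : ℂ) - α) k * E α) = mbInt u v (s + k) E := by
  induction k generalizing E with
  | zero => simp
  | succ k ih =>
    have h' := (h.swap_one_three.add_natCast k)
    have := mbInt_add_one h' hE
    rw [mbInt_swap_one_three, mbInt_swap_one_three (s + k) v u] at this
    rw [Nat.cast_succ, ← add_assoc, this, ← ih ((StripPoly.sq_sub_sq _).mul hE)]
    congr 1
    funext α
    rw [poch_succ, poch_succ]
    push_cast
    ring

/-- The inverse transform of a Wilson polynomial. -/
theorem mellinBarnes_wilsonP (n : ℕ) (h : Admissible u v s) {t : ℝ} (h0 : 0 ≤ t) (h1 : t < 1) (κ : ℂ)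
    {G : ℂ → ℂ} (hG : ∀ α, G α = kern u v s
      (fun α => α * (κ * (wilsonP n s (r + 1 - s) v u α * th u v t α))) α) :
    Integrable (fun τ : ℝ => G (τ * I)) ∧ mellinBarnes {u, v, s} G
      = κ * (-Real.pi * Gamma (u + v)) * ((n.factorial * Real.Gamma (s + u + n) * Real.Gamma (s + v + n)
        * (1 - t) ^ (s + u) * jacobiP n r (u + v - 1) (1 - 2 * (1 - t)) : ℝ) : ℂ) := by
  have hGf : G = kern u v s (fun α => α * (κ * (wilsonP n s (r + 1 - s) v u α * th u v t α))) := funext hG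
  have hth := stripPoly_th h.ab h0 h1
  set c : ℕ → ℂ := fun k => jacobiCoeff n r (u + v - 1) k
      * (poch ((s : ℂ) + u + k) (n - k) * poch ((s : ℂ) + v + k) (n - k)) with hcd
  set f : ℕ → ℂ → ℂ := fun k α => c k * (poch ((s : ℂ) + α) k * poch ((s : ℂ) - α) k * th u v t α) with hf
  have hfs : ∀ k, StripPoly (f k) := fun k => ((StripPoly.poch_mul_poch _ k).mul hth).const_mul _
  have e : (fun α => wilsonP n s (r + 1 - s) v u α * th u v t α)
      = fun α => ∑ k ∈ Finset.range (n + 1), f k α := by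
    funext α
    rw [wilsonP_eq_sum, Finset.sum_mul]
    refine Finset.sum_congr rfl fun k _ => ?_
    simp only [hf, hcd]
    ring
  have hE : StripPoly fun α => wilsonP n s (r + 1 - s) v u α * th u v t α := by
    rw [e]
    exact StripPoly.sum _ fun k _ => hfs k
  rw [hGf]
  refine ⟨integrable_kern h (hE.const_mul κ), ?_⟩
  change mbInt u v s _ = _
  have hsu : ∀ k : ℕ, (s : ℂ) + u ≠ -k := fun k => by
    rw [add_comm]; exact ofReal_add_ne_neg h.ac k
  have hsv : ∀ k : ℕ, (s : ℂ) + v ≠ -k := fun k => by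
    rw [add_comm]; exact ofReal_add_ne_neg h.bc k
  have h2 : (0 : ℝ) < 1 - t := by linarith
  have hj := factorial_mul_jacobiP n r (u + v - 1) (1 - t)
  have h5 : ((n.factorial * Real.Gamma (s + u + n) * Real.Gamma (s + v + n)
      * (1 - t) ^ (s + u) * jacobiP n r (u + v - 1) (1 - 2 * (1 - t)) : ℝ) : ℂ)
      = Gamma (s + u + n) * Gamma (s + v + n) * (1 - (t : ℂ)) ^ ((s : ℂ) + u)
        * (n.factorial * (jacobiP n r (u + v - 1) (1 - 2 * (1 - t)) : ℂ)) := by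
    rw [ofReal_mul, ofReal_mul, ofReal_mul, ofReal_mul, Complex.ofReal_cpow h2.le,
      ← Complex.Gamma_ofReal, ← Complex.Gamma_ofReal]
    push_cast
    ring
  rw [mbInt_const_mul h κ hE, e, mbInt_sum h _ fun k _ => hfs k, mul_assoc, h5, hj]
  congr 1
  rw [Finset.mul_sum, Finset.mul_sum]
  refine Finset.sum_congr rfl fun k hkn => ?_
  have hkn' : k ≤ n := Nat.lt_succ_iff.mp (Finset.mem_range.mp hkn)
  have en : (n : ℂ) = k + (n - k : ℕ) := by rw [Nat.cast_sub hkn']; ring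
  have hk' := (h.swap_one_three.add_natCast k).swap_one_three
  -- The Pochhammer factors of the Wilson coefficients complete the `Γ(s+u+k) Γ(s+v+k)` from
  -- `mbInt_const_one` to `Γ(s+u+n) Γ(s+v+n)`, so the constant does not depend on `k`.
  have g : ∀ y : ℂ, (∀ j : ℕ, y ≠ -j) → poch (y + k) (n - k) * Gamma (y + k) = Gamma (y + n) :=
    fun y hy => by
      have hyk : ∀ j : ℕ, y + k ≠ -j := fun j hj => hy (j + k) (by
        push_cast; linear_combination hj)
      rw [← Gamma_add_natCast_eq hyk, en, add_assoc]
  simp only [hf]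
  rw [mbInt_const_mul h _ ((StripPoly.poch_mul_poch _ k).mul hth), mbInt_add_natCast h hth,
    mbInt_th hk' h0 h1, mbInt_const_one hk', ← g _ hsu, ← g _ hsv, hcd]
  push_cast
  rw [show (s : ℂ) + k + u = s + u + k by ring, Complex.cpow_add _ _ (one_sub_ofReal_ne_zero h1),
    Complex.cpow_natCast, show (u : ℂ) + (s + k) = s + u + k by ring,
    show (v : ℂ) + (s + k) = s + v + k by ring]
  ring

/-- The reflection formula; at `2α` it is the origin of the factor `α sin(2πα)` in the kernel. -/
theorem inv_Gamma_mul_Gamma_neg (z : ℂ) :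
    (Gamma z * Gamma (-z))⁻¹ = -z * Complex.sin (Real.pi * z) / Real.pi := by
  by_cases hz : z = 0
  · simp [hz]
  · have h := Complex.Gamma_mul_Gamma_one_sub z
    rw [sub_eq_add_neg, add_comm, Complex.Gamma_add_one _ (neg_ne_zero.mpr hz)] at h
    have : Gamma z * Gamma (-z) = -(Real.pi / Complex.sin (Real.pi * z)) / z := by
      rw [← h]
      field_simp
    rw [this, inv_div, ← neg_div, div_div_eq_mul_div, div_neg, neg_mul, neg_div]

/-- The integrand of an inverse transform. -/
theorem div_jacobiN_mul {p q : ℝ} (hc : ∀ k : ℕ, 1 + p ≠ -k) (s : ℝ) (P W T α : ℂ) :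
    Gamma (1 + p) * gammaPM s α * W / jacobiN p q α * (P * T)
      = kern ((1 + p + q) / 2) ((1 + p - q) / 2) s
        (fun _ => α * (-P / (Real.pi * Gamma (1 + p)) * (W * T))) α := by
  have hG : Gamma (1 + (p : ℂ)) ≠ 0 := Gamma_ne_zero fun k hk => hc k (by exact_mod_cast hk)
  have hpi : (Real.pi : ℂ) ≠ 0 := by exact_mod_cast Real.pi_ne_zero
  have h := inv_Gamma_mul_Gamma_neg (2 * α)
  have e : (jacobiN p q α)⁻¹ = gammaPM ((1 + p + q) / 2) α * gammaPM ((1 + p - q) / 2) α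
      * (Gamma (2 * α) * Gamma (-(2 * α)))⁻¹ / (2 * Gamma (1 + p) ^ 2) := by
    rw [jacobiN, jacobiQ, jacobiQ, gammaPM, gammaPM]
    simp only [div_eq_mul_inv, mul_inv, inv_inv, mul_neg, neg_mul, neg_neg, sub_neg_eq_add]
    push_cast
    ring
  rw [div_eq_mul_inv, e, h, kern]
  field_simp

end Expansion

/-! ### The three transform pairs as instances of one -/

section Transforms

variable {n : ℕ} {p q r s : ℝ}

theorem inverse_transform_jacobiP (h : Admissible ((1 + p + q) / 2) ((1 + p - q) / 2) s) {x : ℝ}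
    (hx : x ∈ Set.Ioo (0 : ℝ) 1) {P : ℝ} {F Ψ : ℂ → ℂ}
    (hF : ∀ α, F α = Gamma (1 + p) * gammaPM s α
      * wilsonP n s (r + 1 - s) ((1 + p - q) / 2) ((1 + p + q) / 2) α)
    (hΨ : ∀ α, Ψ α = P * jacobiFun p q α x) :
    Integrable (fun τ : ℝ => F (τ * I) / jacobiN p q (τ * I) * Ψ (τ * I)) ∧
      mellinBarnes {(1 + p + q) / 2, (1 + p - q) / 2, s} (fun α => F α / jacobiN p q α * Ψ α)
        = ((P * (n.factorial * Real.Gamma (s + (1 + p + q) / 2 + n)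
          * Real.Gamma (s + (1 + p - q) / 2 + n) * x ^ (s + (1 + p + q) / 2)
          * jacobiP n r p (1 - 2 * x)) : ℝ) : ℂ) := by
  have hp : (1 + p + q) / 2 + (1 + p - q) / 2 - 1 = p := by ring
  have hpc : (((1 + p + q) / 2 : ℝ) : ℂ) + (((1 + p - q) / 2 : ℝ) : ℂ) = 1 + p := by push_cast; ring
  have hc : ∀ k : ℕ, 1 + p ≠ -k := fun k hk => h.ab k (by linarith)
  have hG : Gamma (1 + (p : ℂ)) ≠ 0 := Gamma_ne_zero fun k hk => hc k (by exact_mod_cast hk)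
  have hpi : (Real.pi : ℂ) ≠ 0 := by exact_mod_cast Real.pi_ne_zero
  have key := mellinBarnes_wilsonP (r := r) n h (t := 1 - x) (by linarith [hx.2]) (by linarith [hx.1])
    (-P / (Real.pi * Gamma (1 + p))) (G := fun α => F α / jacobiN p q α * Ψ α) fun α => by
      rw [hF, hΨ, jacobiFun_eq_th p q α hx.1, div_jacobiN_mul hc]
      rfl
  rw [sub_sub_cancel, hp, hpc] at key
  refine ⟨key.1, key.2.trans ?_⟩
  rw [ofReal_mul P]
  congr 1
  field_simp

theorem transform_jacobiP (hp : 0 < 1 + p) {α : ℂ} (hs : |α.re| < s)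
    (hu : ∀ k : ℕ, s + (1 + p + q) / 2 + n ≠ -k) (hv : ∀ k : ℕ, s + (1 + p - q) / 2 + n ≠ -k)
    {g : ℝ → ℂ} (hg : ∀ x ∈ Set.Ioo (0 : ℝ) 1, g x
      = ((n.factorial * Real.Gamma (s + (1 + p + q) / 2 + n) * Real.Gamma (s + (1 + p - q) / 2 + n)
        * ((1 - x) ^ p * x ^ (s - (1 + p + q) / 2 - 1)) * jacobiP n r p (1 - 2 * x) : ℝ) : ℂ)
        * jacobiFun p q α x) :
    IntervalIntegrable g volume 0 1 ∧ ∫ x in (0 : ℝ)..1, g x = Gamma (1 + p) * gammaPM s α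
      * wilsonP n s (r + 1 - s) ((1 + p - q) / 2) ((1 + p + q) / 2) α := by
  have hp1 : (1 + p + q) / 2 + (1 + p - q) / 2 - 1 = p := by ring
  have hpc : (((1 + p + q) / 2 : ℝ) : ℂ) + (((1 + p - q) / 2 : ℝ) : ℂ) = 1 + p := by push_cast; ring
  have key := integral_jacobiP_mul_th (r := r) (u := (1 + p + q) / 2) (v := (1 + p - q) / 2) n
    (by linarith) hs hu hv (g := fun t => g (1 - t)) fun t ht => by
      have h1 : 0 < 1 - t := by linarith [ht.2]
      rw [hg (1 - t) ⟨h1, by linarith [ht.1]⟩, jacobiFun_eq_th p q α h1, sub_sub_cancel, hp1]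
  rw [hpc, intervalIntegral.integral_comp_sub_left (fun x => g x) 1, sub_self, sub_zero] at key
  refine ⟨?_, key.2⟩
  have := (key.1.comp_sub_left 1).symm
  simpa using this

theorem wilsonP_swap_three_four (n : ℕ) (a b c d : ℝ) (α : ℂ) :
    wilsonP n a b c d α = wilsonP n a b d c α := by
  unfold wilsonP
  refine Finset.sum_congr rfl fun k _ => ?_
  rw [show (n : ℂ) + a + b + c + d - 1 = n + a + b + d + c - 1 by ring]
  ring

theorem wilsonP_third_first (n : ℕ) (a b c d : ℝ) (α : ℂ) :
    wilsonP n a b c d α = wilsonP n c d b a α := by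
  rw [wilsonP_swap_one_three, wilsonP_swap_three_four, wilsonP_swap_two_three]

variable {d Δ₁ Δ₂ : ℝ}

/-- The symmetries of the Wilson polynomial bring the parameter of the explicit Gamma pair to the
front; the other three become `r + 1 - s`, `v`, `u` with `r = p = d/2 - 1`. The bulk and boundary
versions below have the same form. -/
theorem xiProj_eq (α : ℂ) : xiProj n d Δ₁ Δ₂ α
    = Gamma (1 + ((d / 2 - 1 : ℝ) : ℂ)) * gammaPM ((Δ₁ + Δ₂) / 2 - d / 4) α
      * wilsonP n ((Δ₁ + Δ₂) / 2 - d / 4) (d / 2 - 1 + 1 - ((Δ₁ + Δ₂) / 2 - d / 4))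
        ((1 + (d / 2 - 1) - (Δ₁ - Δ₂)) / 2) ((1 + (d / 2 - 1) + (Δ₁ - Δ₂)) / 2) α := by
  rw [xiProj, wilsonP_third_first]
  congr 2
  · congr 1
    push_cast
    ring
  all_goals ring

theorem xiBulk_eq (α : ℂ) : xiBulk n d Δ₁ Δ₂ α
    = Gamma (1 + ((Δ₁ - Δ₂ : ℝ) : ℂ)) * gammaPM ((Δ₁ + Δ₂) / 2 - d / 4) α
      * wilsonP n ((Δ₁ + Δ₂) / 2 - d / 4) (d / 2 - 1 + 1 - ((Δ₁ + Δ₂) / 2 - d / 4))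
        ((1 + (Δ₁ - Δ₂) - (d / 2 - 1)) / 2) ((1 + (Δ₁ - Δ₂) + (d / 2 - 1)) / 2) α := by
  rw [xiBulk]
  congr 2
  · congr 1
    push_cast
    ring
  all_goals ring

theorem xiBdy_eq (ν : ℂ) : xiBdy n d Δ₁ Δ₂ ν
    = Gamma (1 + ((d / 2 - 1 : ℝ) : ℂ)) * gammaPM (Δ₁ + 1 / 2 - d / 2) ν
      * wilsonP n (Δ₁ + 1 / 2 - d / 2) (Δ₁ - Δ₂ + 1 - (Δ₁ + 1 / 2 - d / 2))
        ((1 + (d / 2 - 1) - (d / 2 - 1)) / 2) ((1 + (d / 2 - 1) + (d / 2 - 1)) / 2) ν := by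
  rw [xiBdy, wilsonP_swap, wilsonP_third_first]
  congr 2
  · congr 1
    push_cast
    ring
  all_goals ring

theorem inverseTransform_xiProj (hd : 0 < d) (h : ∀ k : ℕ, Δ₁ ≠ -k ∧ Δ₂ ≠ -k) {η : ℝ}
    (hη : η ∈ Set.Ioo (0 : ℝ) 1) :
    Integrable (fun t : ℝ => inverseIntegrand (normProj d Δ₁ Δ₂) (waveProj d Δ₁ Δ₂)
      (xiProj n d Δ₁ Δ₂) η (t * I)) ∧
    inverseTransform (polesProj d Δ₁ Δ₂) (normProj d Δ₁ Δ₂) (waveProj d Δ₁ Δ₂)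
      (xiProj n d Δ₁ Δ₂) η = (posProj n d Δ₁ Δ₂ η : ℂ) := by
  -- The sums `u + v`, `u + s`, `v + s` are `d/2`, `Δ₁`, `Δ₂`.
  have hA : Admissible ((1 + (d / 2 - 1) + (Δ₁ - Δ₂)) / 2) ((1 + (d / 2 - 1) - (Δ₁ - Δ₂)) / 2)
      ((Δ₁ + Δ₂) / 2 - d / 4) :=
    ⟨fun k hk => by linarith [(Nat.cast_nonneg k : (0 : ℝ) ≤ k)],
      fun k hk => (h k).1 (by linarith), fun k hk => (h k).2 (by linarith)⟩
  obtain ⟨k1, k2⟩ := inverse_transform_jacobiP (n := n) hA hη xiProj_eq (Ψ := fun α => waveProj d Δ₁ Δ₂ α η)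
    fun α => rfl
  have hpoles : polesProj d Δ₁ Δ₂ = {(1 + (d / 2 - 1) + (Δ₁ - Δ₂)) / 2,
      (1 + (d / 2 - 1) - (Δ₁ - Δ₂)) / 2, (Δ₁ + Δ₂) / 2 - d / 4} := by
    rw [polesProj]
    congr 1
    · ring
    · congr 1
      ring
  refine ⟨k1, ?_⟩
  rw [inverseTransform, hpoles]
  refine k2.trans ?_
  rw [posProj_eq n hd, show (Δ₁ + Δ₂) / 2 - d / 4 + (1 + (d / 2 - 1) + (Δ₁ - Δ₂)) / 2 = Δ₁ by ring,
    show (Δ₁ + Δ₂) / 2 - d / 4 + (1 + (d / 2 - 1) - (Δ₁ - Δ₂)) / 2 = Δ₂ by ring,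
    show (Δ₁ + Δ₂) / 2 = -((Δ₁ - Δ₂) / 2) + Δ₁ by ring, Real.rpow_add hη.1]
  congr 1
  ring

theorem alphaTransform_posProj (hd : 0 < d) (h : ∀ k : ℕ, Δ₁ + n ≠ -k ∧ Δ₂ + n ≠ -k) {α : ℂ}
    (hα : |α.re| < (Δ₁ + Δ₂) / 2 - d / 4) :
    IntervalIntegrable (transformIntegrand (wProj d) (waveProj d Δ₁ Δ₂) (posProj n d Δ₁ Δ₂) α)
      volume 0 1 ∧
    alphaTransform (wProj d) (waveProj d Δ₁ Δ₂) (posProj n d Δ₁ Δ₂) α = xiProj n d Δ₁ Δ₂ α := by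
  have e1 : (Δ₁ + Δ₂) / 2 - d / 4 + (1 + (d / 2 - 1) + (Δ₁ - Δ₂)) / 2 = Δ₁ := by ring
  have e2 : (Δ₁ + Δ₂) / 2 - d / 4 + (1 + (d / 2 - 1) - (Δ₁ - Δ₂)) / 2 = Δ₂ := by ring
  rw [xiProj_eq]
  refine transform_jacobiP (q := Δ₁ - Δ₂) (by linarith) hα (fun k => ?_) (fun k => ?_) fun x hx => ?_
  · rw [e1]; exact (h k).1
  · rw [e2]; exact (h k).2
  · rw [e1, e2, transformIntegrand, waveProj, posProj_eq n hd, wProj, ← mul_assoc, ← ofReal_mul,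
      ← ofReal_mul, div_eq_mul_inv, ← Real.rpow_neg hx.1.le,
      show (Δ₁ + Δ₂) / 2 - d / 4 - (1 + (d / 2 - 1) + (Δ₁ - Δ₂)) / 2 - 1
        = -(d / 2 + 1) + (Δ₁ + Δ₂) / 2 + -((Δ₁ - Δ₂) / 2) by ring, Real.rpow_add hx.1, Real.rpow_add hx.1]
    congr 2
    ring

theorem inverseTransform_xiBulk
    (h : ∀ k : ℕ, Δ₁ ≠ -k ∧ Δ₁ + 1 - d / 2 ≠ -k ∧ 1 + (Δ₁ - Δ₂) ≠ -k) {ρ : ℝ}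
    (hρ : ρ ∈ Set.Ioo (0 : ℝ) 1) :
    Integrable (fun t : ℝ => inverseIntegrand (normBulk d Δ₁ Δ₂) (waveBulk d Δ₁ Δ₂)
      (xiBulk n d Δ₁ Δ₂) ρ (t * I)) ∧
    inverseTransform (polesBulk d Δ₁ Δ₂) (normBulk d Δ₁ Δ₂) (waveBulk d Δ₁ Δ₂)
      (xiBulk n d Δ₁ Δ₂) ρ = (posBulk n d Δ₁ Δ₂ ρ : ℂ) := by
  -- The sums `u + v`, `u + s`, `v + s` are `1 + Δ₁ - Δ₂`, `Δ₁`, `Δ₁ + 1 - d/2`.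
  have hA : Admissible ((1 + (Δ₁ - Δ₂) + (d / 2 - 1)) / 2) ((1 + (Δ₁ - Δ₂) - (d / 2 - 1)) / 2)
      ((Δ₁ + Δ₂) / 2 - d / 4) :=
    ⟨fun k hk => (h k).2.2 (by linarith),
      fun k hk => (h k).1 (by linarith), fun k hk => (h k).2.1 (by linarith)⟩
  obtain ⟨k1, k2⟩ := inverse_transform_jacobiP (n := n) hA hρ xiBulk_eq (Ψ := fun α => waveBulk d Δ₁ Δ₂ α ρ)
    fun α => rfl
  have hpoles : polesBulk d Δ₁ Δ₂ = {(1 + (Δ₁ - Δ₂) + (d / 2 - 1)) / 2,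
      (1 + (Δ₁ - Δ₂) - (d / 2 - 1)) / 2, (Δ₁ + Δ₂) / 2 - d / 4} := by
    rw [polesBulk]
    congr 1
    · ring
    · congr 1
      ring
  refine ⟨k1, ?_⟩
  rw [inverseTransform, hpoles]
  refine k2.trans ?_
  have h1 : (0 : ℝ) ≤ 1 - ρ := by linarith [hρ.2]
  rw [posBulk, show (Δ₁ + Δ₂) / 2 - d / 4 + (1 + (Δ₁ - Δ₂) + (d / 2 - 1)) / 2 = Δ₁ by ring,
    show (Δ₁ + Δ₂) / 2 - d / 4 + (1 + (Δ₁ - Δ₂) - (d / 2 - 1)) / 2 = Δ₁ + 1 - d / 2 by ring,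
    show (Δ₁ + Δ₂) / 2 = Δ₁ - (Δ₁ - Δ₂) / 2 by ring, Real.rpow_sub hρ.1, Real.div_rpow h1 hρ.1.le]
  congr 1
  ring

theorem alphaTransform_posBulk (h : ∀ k : ℕ, Δ₁ + n ≠ -k ∧ Δ₁ + 1 - d / 2 + n ≠ -k)
    (hΔ : -1 < Δ₁ - Δ₂) {α : ℂ} (hα : |α.re| < (Δ₁ + Δ₂) / 2 - d / 4) :
    IntervalIntegrable (transformIntegrand (wBulk d) (waveBulk d Δ₁ Δ₂) (posBulk n d Δ₁ Δ₂) α)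
      volume 0 1 ∧
    alphaTransform (wBulk d) (waveBulk d Δ₁ Δ₂) (posBulk n d Δ₁ Δ₂) α = xiBulk n d Δ₁ Δ₂ α := by
  have e1 : (Δ₁ + Δ₂) / 2 - d / 4 + (1 + (Δ₁ - Δ₂) + (d / 2 - 1)) / 2 = Δ₁ := by ring
  have e2 : (Δ₁ + Δ₂) / 2 - d / 4 + (1 + (Δ₁ - Δ₂) - (d / 2 - 1)) / 2 = Δ₁ + 1 - d / 2 := by ring
  rw [xiBulk_eq]
  refine transform_jacobiP (q := d / 2 - 1) (by linarith) hα (fun k => ?_) (fun k => ?_) fun x hx => ?_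
  · rw [e1]; exact (h k).1
  · rw [e2]; exact (h k).2
  · have h1 : (0 : ℝ) < 1 - x := by linarith [hx.2]
    -- One half of the power of `1 - x` comes from the partial wave, the other from the position
    -- space function.
    have e3 : (1 - x) ^ (Δ₁ - Δ₂) = (1 - x) ^ ((Δ₁ - Δ₂) / 2) * (1 - x) ^ ((Δ₁ - Δ₂) / 2) := by
      rw [← Real.rpow_add h1, add_halves]
    rw [e1, e2, e3, transformIntegrand, waveBulk, posBulk, wBulk, ← mul_assoc, ← ofReal_mul,
      ← ofReal_mul, one_div, ← Real.rpow_neg hx.1.le,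
      show (Δ₁ + Δ₂) / 2 - d / 4 - (1 + (Δ₁ - Δ₂) + (d / 2 - 1)) / 2 - 1
        = -(d / 2 + 1) + (Δ₁ + Δ₂) / 2 - (Δ₁ - Δ₂) / 2 by ring, Real.rpow_sub hx.1, Real.rpow_add hx.1,
      Real.div_rpow h1.le hx.1.le]
    congr 2
    ring

/-- The boundary partial wave is a Jacobi function of `1 - ρ`. Reflection makes the polynomial one
in `1 - ρ` too, exchanging its parameters and absorbing the sign. -/
theorem posBdy_eq (n : ℕ) (d Δ₁ Δ₂ ρ : ℝ) : posBdy n d Δ₁ Δ₂ ρ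
    = n.factorial * Real.Gamma (Δ₁ + n) * Real.Gamma (Δ₁ + 1 - d / 2 + n) * (1 - ρ) ^ Δ₁
      * jacobiP n (Δ₁ - Δ₂) (d / 2 - 1) (1 - 2 * (1 - ρ)) := by
  rw [posBdy, show 1 - 2 * (1 - ρ) = -(1 - 2 * ρ) by ring, jacobiP_neg]
  ring

theorem inverseTransform_xiBdy (hd : 0 < d) (h : ∀ k : ℕ, Δ₁ ≠ -k ∧ Δ₁ + 1 - d / 2 ≠ -k) {ρ : ℝ}
    (hρ : ρ ∈ Set.Ioo (0 : ℝ) 1) :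
    Integrable (fun t : ℝ => inverseIntegrand (normBdy d) (waveBdy d) (xiBdy n d Δ₁ Δ₂) ρ (t * I)) ∧
    inverseTransform (polesBdy d Δ₁) (normBdy d) (waveBdy d) (xiBdy n d Δ₁ Δ₂) ρ
      = (posBdy n d Δ₁ Δ₂ ρ : ℂ) := by
  -- The sums `u + v`, `u + s`, `v + s` are `d/2`, `Δ₁`, `Δ₁ + 1 - d/2`.
  have hA : Admissible ((1 + (d / 2 - 1) + (d / 2 - 1)) / 2) ((1 + (d / 2 - 1) - (d / 2 - 1)) / 2)
      (Δ₁ + 1 / 2 - d / 2) :=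
    ⟨fun k hk => by linarith [(Nat.cast_nonneg k : (0 : ℝ) ≤ k)],
      fun k hk => (h k).1 (by linarith), fun k hk => (h k).2 (by linarith)⟩
  obtain ⟨k1, k2⟩ := inverse_transform_jacobiP (n := n) hA (x := 1 - ρ) ⟨by linarith [hρ.2], by linarith [hρ.1]⟩
    (P := 1) xiBdy_eq (Ψ := fun ν => waveBdy d ν ρ) fun ν => by rw [ofReal_one, one_mul]; rfl
  have hpoles : polesBdy d Δ₁ = {(1 + (d / 2 - 1) + (d / 2 - 1)) / 2,
      (1 + (d / 2 - 1) - (d / 2 - 1)) / 2, Δ₁ + 1 / 2 - d / 2} := by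
    rw [polesBdy, triple_swap_one_two]
    congr 1
    · ring
    · congr 1
      ring
  refine ⟨k1, ?_⟩
  rw [inverseTransform, hpoles]
  refine k2.trans ?_
  rw [posBdy_eq, show Δ₁ + 1 / 2 - d / 2 + (1 + (d / 2 - 1) + (d / 2 - 1)) / 2 = Δ₁ by ring,
    show Δ₁ + 1 / 2 - d / 2 + (1 + (d / 2 - 1) - (d / 2 - 1)) / 2 = Δ₁ + 1 - d / 2 by ring, one_mul]

theorem alphaTransform_posBdy (hd : 0 < d) (h : ∀ k : ℕ, Δ₁ + n ≠ -k ∧ Δ₁ + 1 - d / 2 + n ≠ -k)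
    {ν : ℂ} (hν : |ν.re| < Δ₁ + 1 / 2 - d / 2) :
    IntervalIntegrable (transformIntegrand (wBdy d) (waveBdy d) (posBdy n d Δ₁ Δ₂) ν) volume 0 1 ∧
    alphaTransform (wBdy d) (waveBdy d) (posBdy n d Δ₁ Δ₂) ν = xiBdy n d Δ₁ Δ₂ ν := by
  have e1 : Δ₁ + 1 / 2 - d / 2 + (1 + (d / 2 - 1) + (d / 2 - 1)) / 2 = Δ₁ := by ring
  have e2 : Δ₁ + 1 / 2 - d / 2 + (1 + (d / 2 - 1) - (d / 2 - 1)) / 2 = Δ₁ + 1 - d / 2 := by ring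
  set g := transformIntegrand (wBdy d) (waveBdy d) (posBdy n d Δ₁ Δ₂) ν with hg
  have key : IntervalIntegrable (fun x => g (1 - x)) volume 0 1 ∧
      ∫ x in (0 : ℝ)..1, g (1 - x) = xiBdy n d Δ₁ Δ₂ ν := by
    rw [xiBdy_eq]
    refine transform_jacobiP (q := d / 2 - 1) (by linarith) hν (fun k => ?_) (fun k => ?_) fun x hx => ?_
    · rw [e1]; exact (h k).1
    · rw [e2]; exact (h k).2
    · rw [e1, e2, hg, transformIntegrand, waveBdy, posBdy_eq, wBdy, sub_sub_cancel, ← ofReal_mul,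
        show Δ₁ + 1 / 2 - d / 2 - (1 + (d / 2 - 1) + (d / 2 - 1)) / 2 - 1 = Δ₁ - d by ring,
        Real.rpow_sub hx.1]
      congr 2
      ring
  rw [intervalIntegral.integral_comp_sub_left (fun x => g x) 1, sub_self, sub_zero] at key
  refine ⟨?_, key.2⟩
  have := (key.1.comp_sub_left 1).symm
  simpa using this

end Transforms

theorem mainTheorem7 (n : ℕ) (d Δ₁ Δ₂ : ℝ) (hd : 0 < d) :
    -- crosscap: `posProj` is the inverse transform of `xiProj`
    ((∀ k : ℕ, Δ₁ ≠ -k ∧ Δ₂ ≠ -k) →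
      ∀ η ∈ Set.Ioo (0 : ℝ) 1,
        MeasureTheory.Integrable (fun t : ℝ =>
          inverseIntegrand (normProj d Δ₁ Δ₂) (waveProj d Δ₁ Δ₂) (xiProj n d Δ₁ Δ₂) η
            (t * Complex.I)) ∧
        inverseTransform (polesProj d Δ₁ Δ₂) (normProj d Δ₁ Δ₂) (waveProj d Δ₁ Δ₂)
          (xiProj n d Δ₁ Δ₂) η = (posProj n d Δ₁ Δ₂ η : ℂ)) ∧
    -- crosscap: `xiProj` is the transform of `posProj`
    ((∀ k : ℕ, Δ₁ + n ≠ -k ∧ Δ₂ + n ≠ -k) →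
      ∀ α : ℂ, |α.re| < (Δ₁ + Δ₂) / 2 - d / 4 →
        IntervalIntegrable
          (transformIntegrand (wProj d) (waveProj d Δ₁ Δ₂) (posProj n d Δ₁ Δ₂) α)
          MeasureTheory.volume 0 1 ∧
        alphaTransform (wProj d) (waveProj d Δ₁ Δ₂) (posProj n d Δ₁ Δ₂) α
          = xiProj n d Δ₁ Δ₂ α) ∧
    -- bulk: `posBulk` is the inverse transform of `xiBulk`
    ((∀ k : ℕ, Δ₁ ≠ -k ∧ Δ₁ + 1 - d / 2 ≠ -k ∧ 1 + (Δ₁ - Δ₂) ≠ -k) →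
      ∀ ρ ∈ Set.Ioo (0 : ℝ) 1,
        MeasureTheory.Integrable (fun t : ℝ =>
          inverseIntegrand (normBulk d Δ₁ Δ₂) (waveBulk d Δ₁ Δ₂) (xiBulk n d Δ₁ Δ₂) ρ
            (t * Complex.I)) ∧
        inverseTransform (polesBulk d Δ₁ Δ₂) (normBulk d Δ₁ Δ₂) (waveBulk d Δ₁ Δ₂)
          (xiBulk n d Δ₁ Δ₂) ρ = (posBulk n d Δ₁ Δ₂ ρ : ℂ)) ∧
    -- bulk: `xiBulk` is the transform of `posBulk`
    ((∀ k : ℕ, Δ₁ + n ≠ -k ∧ Δ₁ + 1 - d / 2 + n ≠ -k) → -1 < Δ₁ - Δ₂ →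
      ∀ α : ℂ, |α.re| < (Δ₁ + Δ₂) / 2 - d / 4 →
        IntervalIntegrable
          (transformIntegrand (wBulk d) (waveBulk d Δ₁ Δ₂) (posBulk n d Δ₁ Δ₂) α)
          MeasureTheory.volume 0 1 ∧
        alphaTransform (wBulk d) (waveBulk d Δ₁ Δ₂) (posBulk n d Δ₁ Δ₂) α
          = xiBulk n d Δ₁ Δ₂ α) ∧
    -- boundary: `posBdy` is the inverse transform of `xiBdy`
    ((∀ k : ℕ, Δ₁ ≠ -k ∧ Δ₁ + 1 - d / 2 ≠ -k) →
      ∀ ρ ∈ Set.Ioo (0 : ℝ) 1,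
        MeasureTheory.Integrable (fun t : ℝ =>
          inverseIntegrand (normBdy d) (waveBdy d) (xiBdy n d Δ₁ Δ₂) ρ (t * Complex.I)) ∧
        inverseTransform (polesBdy d Δ₁) (normBdy d) (waveBdy d) (xiBdy n d Δ₁ Δ₂) ρ
          = (posBdy n d Δ₁ Δ₂ ρ : ℂ)) ∧
    -- boundary: `xiBdy` is the transform of `posBdy`
    ((∀ k : ℕ, Δ₁ + n ≠ -k ∧ Δ₁ + 1 - d / 2 + n ≠ -k) →
      ∀ ν : ℂ, |ν.re| < Δ₁ + 1 / 2 - d / 2 →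
        IntervalIntegrable
          (transformIntegrand (wBdy d) (waveBdy d) (posBdy n d Δ₁ Δ₂) ν)
          MeasureTheory.volume 0 1 ∧
        alphaTransform (wBdy d) (waveBdy d) (posBdy n d Δ₁ Δ₂) ν = xiBdy n d Δ₁ Δ₂ ν) :=
  ⟨fun h _ hη => inverseTransform_xiProj hd h hη,
    fun h _ hα => alphaTransform_posProj hd h hα,
    fun h _ hρ => inverseTransform_xiBulk h hρ,
    fun h hΔ _ hα => alphaTransform_posBulk h hΔ hα,
    fun h _ hρ => inverseTransform_xiBdy hd h hρ,
    fun h _ hν => alphaTransform_posBdy hd h hν⟩
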